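/- Let $L,M,a>0$, $\Omega=(-a,a)$, and let $u^{-a},u^{a}\in C^2(\mathbb{R}^2)$ be fixed boundary data that are $L$-periodic in $x$ and $M$-periodic in $y$. All functions on slabs $\mathbb{R}^2\times(b,c)$ below are $L$-periodic in $x$ and $M$-periodic in $y$; their $L^2$, $H^1$ and $H^2$ norms and spaces are taken over one period cell $(0,L]\times(0,M]\times(b,c)$ (with weak derivatives on $\mathbb{R}^2\times(b,c)$), and point values of $H^2$ functions are those of the continuous representative. Let $T>0$, and suppose that for a.e. $t\in[0,T]$ the function $u(\cdot,\cdot,\cdot,t)$ belongs to $H^2(\mathbb{R}^2\times\Omega)$ and satisfies $u(x,y,-a,t)=u^{-a}(x,y)$ and $u(x,y,a,t)=u^{a}(x,y)$. Let $x_0<\dots<x_p$, $y_0<\dots<y_q$ and $-a=z_0<\dots<z_v=a$ be nodes with maximal mesh sizes $d_1,d_2,d_3$, and put $d=\max\{d_1,d_2,d_3\}$. Assume that the grid fills one period, i.e. $0\le x_0+L-x_p\le d_1$ and $0\le y_0+M-y_q\le d_2$, and that it is quasi-uniform: in each direction the largest mesh size is at most $\kappa$ times the smallest one. For each $t\in[0,T]$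 let $v^{(-)}<v^{(+)}\le v$ be indices (which may depend on $t$) for which the outer regions $\Omega^l=(-a,z_{v^{(-)}})$ and $\Omega^r=(z_{v^{(+)}},a)$ have length at least $\rho>0$. Let $0<\delta\le\delta_0$, and for a.e. $t$ let $u^\delta_{i,j,k}(t)$ be noisy data with $$|u(x_i,y_j,z_k,t)-u^\delta_{i,j,k}(t)|\le\delta\qquad\text{for all } i\le p,\ j\le q,\ \text{and all } k\le v^{(-)} \text{ and } v^{(+)}\le k\le v .$$ With $\varepsilon=\delta^2$, let $u^\varepsilon(\cdot,\cdot,\cdot,t)$, for a.e. $t$, minimize $$\frac{1}{(p+1)(q+1)(v^{(-)}+1)}\sum_{i=0}^{p}\sum_{j=0}^{q}\sum_{k=0}^{v^{(-)}}\big(w(x_i,y_j,z_k)-u^\delta_{i,j,k}(t)\big)^2+\varepsilon\Big(\|w_{xx}\|_{L^2(\mathbb{R}^2\times\Omega^l)}^2+\|w_{yy}\|_{L^2(\mathbb{R}^2\times\Omega^l)}^2+\|w_{zz}\|_{L^2(\mathbb{R}^2\times\Omega^l)}^2\Big)$$ over $w\in H^2(\mathbb{R}^2\times\Omega^l)$,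 and likewise minimize the corresponding functional on the right, with $\Omega^r$ in place of $\Omega^l$, the sum over $v^{(+)}\le k\le v$ and the factor $\frac{1}{v-v^{(+)}+1}$, over $w\in H^2(\mathbb{R}^2\times\Omega^r)$. Then, for a.e. $t\in[0,T]$, $$\|u^\varepsilon(\cdot,\cdot,\cdot,t)-u(\cdot,\cdot,\cdot,t)\|_{H^1(\mathbb{R}^2\times(\Omega^l\cup\Omega^r))}\le C_2\,d^{1/4}+C_3\sqrt{\delta},$$ where $C_2$ and $C_3$ depend only on the geometry and the fixed data $L,M,a,\rho,\kappa,\delta_0,u^{-a},u^{a}$ and on the quantity $\|\Delta u(\cdot,\cdot,\cdot,t)\|_{L^2(\mathbb{R}^2\times\Omega)}$; in particular they do not depend on $T$, $u$, $t$ otherwise, on the grid, on $v^{(\mp)}$, on $\delta$, or on the data. -/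

import Mathlib

open MeasureTheory Set
open scoped ContDiff

namespace NoisySmoothing

noncomputable section

/-- Points `(x, y, z)` of three-dimensional space. -/
abbrev Pt : Type := ℝ × ℝ × ℝ

/-- The three coordinate directions. -/
def dir : Fin 3 → Pt := ![(1, 0, 0), (0, 1, 0), (0, 0, 1)]

/-- The open slab `ℝ² × (b, c)`. -/
def slab (b c : ℝ) : Set Pt := {P | P.2.2 ∈ Ioo b c}

/-- The closed slab `ℝ² × [b, c]`. -/
def closedSlab (b c : ℝ) : Set Pt := {P | P.2.2 ∈ Icc b c}

/-- One period cell of the slab `ℝ² × (b, c)`, for functions that are `L`-periodic in `x` and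
`M`-periodic in `y`. Norms of such functions are taken over one period cell. -/
def cell (L M b c : ℝ) : Set Pt := Ioc 0 L ×ˢ (Ioc 0 M ×ˢ Ioo b c)

/-- `g` is the weak partial derivative of `w` in the `i`-th coordinate on the open set `U`. -/
def HasWeakPartial (U : Set Pt) (i : Fin 3) (w g : Pt → ℝ) : Prop :=
  LocallyIntegrableOn w U ∧ LocallyIntegrableOn g U ∧
    ∀ φ : Pt → ℝ, ContDiff ℝ ∞ φ → HasCompactSupport φ → tsupport φ ⊆ U →
      ∫ P in U, w P * fderiv ℝ φ P (dir i) = -∫ P in U, g P * φ P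

open Classical in
/-- The weak partial derivative of `w` in the `i`-th coordinate on `U` (unique up to a null set of
`U`), and `0` if there is none. -/
def weakPartial (U : Set Pt) (i : Fin 3) (w : Pt → ℝ) : Pt → ℝ :=
  if h : ∃ g, HasWeakPartial U i w g then h.choose else 0

/-- The weak Laplacian on `U`. -/
def weakLaplacian (U : Set Pt) (w : Pt → ℝ) : Pt → ℝ :=
  fun P => ∑ i : Fin 3, weakPartial U i (weakPartial U i w) P

/-- `w` is (the continuous representative of) an element of the space `H²(ℝ² × (b, c))` of
functions that are `L`-periodic in `x` and `M`-periodic in `y`: the weak derivatives up to order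
two exist on the whole slab and are square integrable over a period cell. In dimension three every
such class has exactly one representative that is continuous on the closed slab; it gives the
meaning of the point values. Square integrability of `w` itself follows from the continuity. -/
structure MemH2 (L M b c : ℝ) (w : Pt → ℝ) : Prop where
  continuousOn : ContinuousOn w (closedSlab b c)
  periodic_x : ∀ x y z, z ∈ Icc b c → w (x + L, y, z) = w (x, y, z)
  periodic_y : ∀ x y z, z ∈ Icc b c → w (x, y + M, z) = w (x, y, z)
  exists_first : ∀ i, ∃ g, HasWeakPartial (slab b c) i w g
  exists_second : ∀ i j, ∃ g, HasWeakPartial (slab b c) j (weakPartial (slab b c) i w) g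
  memLp_first : ∀ i, MemLp (weakPartial (slab b c) i w) 2 (volume.restrict (cell L M b c))
  memLp_second : ∀ i j,
    MemLp (weakPartial (slab b c) j (weakPartial (slab b c) i w)) 2
      (volume.restrict (cell L M b c))

/-- The square of the `L²(ℝ² × (b, c))` norm (over one period cell). -/
def l2NormSq (L M b c : ℝ) (g : Pt → ℝ) : ℝ := ∫ P in cell L M b c, g P ^ 2

/-- The square of the `H¹(ℝ² × (b, c))` norm (over one period cell). -/
def h1NormSq (L M b c : ℝ) (w : Pt → ℝ) : ℝ :=
  l2NormSq L M b c w + ∑ i : Fin 3, l2NormSq L M b c (weakPartial (slab b c) i w)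

/-- The `L²(ℝ² × (b, c))` norm of the Laplacian (over one period cell). -/
def laplacianNorm (L M b c : ℝ) (w : Pt → ℝ) : ℝ :=
  Real.sqrt (l2NormSq L M b c (weakLaplacian (slab b c) w))

/-- The maximal mesh size of the nodes `s 0 < s 1 < ⋯ < s n`. -/
def maxStep (n : ℕ) (s : ℕ → ℝ) : ℝ := ⨆ i : Fin n, (s (i + 1) - s i)

/-- The nodes `s 0 < s 1 < ⋯ < s n` are increasing, and the largest mesh size is at most `κ` times
the smallest one. -/
def QuasiUniform (κ : ℝ) (n : ℕ) (s : ℕ → ℝ) : Prop :=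
  ∀ i, i < n → s i < s (i + 1) ∧ maxStep n s ≤ κ * (s (i + 1) - s i)

/-- The nodes `s 0 < s 1 < ⋯ < s n` fill one period of length `ℓ`: they lie in `[s 0, s 0 + ℓ]`,
and the gap to the next period is at most the maximal mesh size. (Equality `s n = s 0 + ℓ` is
allowed.) -/
def FillsPeriod (ℓ : ℝ) (n : ℕ) (s : ℕ → ℝ) : Prop :=
  s n ≤ s 0 + ℓ ∧ s 0 + ℓ - s n ≤ maxStep n s

/-- A quasi-uniform tensor grid of measurement points `(x i, y j, z k)`, `i ≤ p`, `j ≤ q`,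
`k ≤ v`, on one period of `ℝ² × [-a, a]`. -/
structure IsGrid (L M a κ : ℝ) (p q v : ℕ) (x y z : ℕ → ℝ) : Prop where
  quasiUniform_x : QuasiUniform κ p x
  quasiUniform_y : QuasiUniform κ q y
  quasiUniform_z : QuasiUniform κ v z
  fills_x : FillsPeriod L p x
  fills_y : FillsPeriod M q y
  z_first : z 0 = -a
  z_last : z v = a

/-- The maximal mesh size `d = max {d₁, d₂, d₃}` of a grid. -/
def meshSize (p q v : ℕ) (x y z : ℕ → ℝ) : ℝ :=
  max (maxStep p x) (max (maxStep q y) (maxStep v z))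

/-- The Tikhonov functional on `ℝ² × (b, c)`, with the data at the nodes `(x i, y j, z k)`,
`i ≤ p`, `j ≤ q`, `k₀ ≤ k ≤ k₁`, and with regularization parameter `ε`. -/
def tikhonov (L M b c : ℝ) (p q k₀ k₁ : ℕ) (x y z : ℕ → ℝ) (data : ℕ → ℕ → ℕ → ℝ) (ε : ℝ)
    (w : Pt → ℝ) : ℝ :=
  1 / ((p : ℝ) + 1) * (1 / ((q : ℝ) + 1)) * (1 / ((k₁ : ℝ) - (k₀ : ℝ) + 1)) *
      (∑ i ∈ Finset.range (p + 1), ∑ j ∈ Finset.range (q + 1), ∑ k ∈ Finset.Icc k₀ k₁,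
        (w (x i, y j, z k) - data i j k) ^ 2) +
    ε * ∑ i : Fin 3, l2NormSq L M b c (weakPartial (slab b c) i (weakPartial (slab b c) i w))

/-- `w` minimizes the Tikhonov functional on `ℝ² × (b, c)` over the periodic `H²` functions. -/
def IsTikhonovMin (L M b c : ℝ) (p q k₀ k₁ : ℕ) (x y z : ℕ → ℝ) (data : ℕ → ℕ → ℕ → ℝ) (ε : ℝ)
    (w : Pt → ℝ) : Prop :=
  MemH2 L M b c w ∧ ∀ w' : Pt → ℝ, MemH2 L M b c w' →
    tikhonov L M b c p q k₀ k₁ x y z data ε w ≤ tikhonov L M b c p q k₀ k₁ x y z data ε w'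

end

end NoisySmoothing

open NoisySmoothing

/-! Time is only a parameter, so the estimate is proved for one fixed `t`, separately on each outer
slab. Let `e` be the minimizer minus the exact function, `S(·)` the sum of the squared `L²` norms of
the pure second derivatives (`secondNormSq`), and `E` the mean of `e²` over the nodes.

Testing minimality against the exact function `u`, whose misfit is at most `δ²`, and using `ε = δ²`,
gives `S(e) ≤ K` and `E ≤ K δ²` with `K = 4 + 4 S(u)` (`IsTikhonovMin.sub_bounds`). `S(u)` is
controlled by the Laplacian and the boundary data (`exists_secondNormSq_le`): at horizontal
frequency `(X, Y)` the Laplacian acts as `f'' - Λ f` with `Λ = X² + Y²`, and under Dirichlet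
conditions integration by parts makes the cross term nonnegative, so `∫|f''|² + Λ² ∫|f|² ≤ ∫|f'' - Λ
f|²`. General boundary values are removed by subtracting an affine function.

A sampling inequality then bounds `‖e‖²` in `L²` by `C (E + (S(e) + E) d)`
(`exists_l2NormSq_le_nodeAvg`). It rests on the embedding of `H²` into the Hölder class of exponent
`1/2` in dimension three (`exists_sup_holder`), which makes the squared oscillation over a grid box
`O(d)`. The seminorm `S` does not see affine functions of `z`, so the Hölder bound also contains the
slope `β` of the affine part. The slope is recovered from the node values, because an affine
function is controlled by its mean square over quasi-uniform nodes (`sq_norm_le_mean_affine`).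

Finally `‖e‖²` in `H¹` is at most `(1 + 650/s²) ‖e‖² + 2 s² S(e)` for every admissible length `s`
(`h1NormSq_le`). With `η = δ + √d` the `L²` term is `O(η²)`. The choice `s²` proportional to `η`
makes both terms `O(η)`, and `√η ≤ √δ + d^(1/4)`.

All estimates on `H²` functions are made on horizontal Fourier coefficients. `MemH2.fourierData`
shows that these are one-dimensional `H²` curves in `z`, and that Parseval's identity turns the
norms of the function, of its derivatives and of its Laplacian into sums over modes. Each inequality
thus becomes one about a single curve, summed over `ℤ²`. -/

/-! ### Weak derivatives on an interval. -/

/-- Integration by parts for primitives of integrable functions. -/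
theorem integral_mul_of_primitive {b c : ℝ} (hbc : b ≤ c) {u u' v v' : ℝ → ℝ}
    (hu' : IntervalIntegrable u' volume b c) (hv' : IntervalIntegrable v' volume b c)
    (hu : ∀ z ∈ Icc b c, u z = u b + ∫ t in b..z, u' t)
    (hv : ∀ z ∈ Icc b c, v z = v b + ∫ t in b..z, v' t) :
    ∫ z in b..c, u z * v' z = u c * v c - u b * v b - ∫ z in b..c, u' z * v z := by
  have key : ∀ {w w' : ℝ → ℝ}, IntervalIntegrable w' volume b c →
      AbsolutelyContinuousOnInterval (fun z => w b + ∫ t in b..z, w' t) b c ∧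
      ∀ᵐ z, z ∈ uIcc b c → deriv (fun z => w b + ∫ t in b..z, w' t) z = w' z := by
    intro w w' hw'
    refine ⟨?_, ?_⟩
    · have h0 : AbsolutelyContinuousOnInterval (fun _ : ℝ => w b) b c :=
        LipschitzOnWith.absolutelyContinuousOnInterval (K := 0)
          ((LipschitzWith.const (w b)).lipschitzOnWith)
      exact h0.fun_add (hw'.absolutelyContinuousOnInterval_intervalIntegral left_mem_uIcc)
    · filter_upwards [hw'.ae_hasDerivAt_integral] with z hz hz'
      exact ((hz hz' b left_mem_uIcc).const_add (w b)).deriv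
  obtain ⟨hU, hdU⟩ := key (w := u) hu'
  obtain ⟨hV, hdV⟩ := key (w := v) hv'
  have h := hU.integral_mul_deriv_eq_deriv_mul hV
  have sub : ∀ z, z ∈ uIoc b c → z ∈ Icc b c := fun z hz => by
    rw [uIoc_of_le hbc] at hz; exact ⟨hz.1.le, hz.2⟩
  have e1 : ∫ z in b..c, u z * v' z =
      ∫ z in b..c, (u b + ∫ t in b..z, u' t) * deriv (fun z => v b + ∫ t in b..z, v' t) z := by
    refine intervalIntegral.integral_congr_ae ?_
    filter_upwards [hdV] with z hz hz'
    rw [hz (uIoc_subset_uIcc hz'), ← hu z (sub z hz')]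
  have e2 : ∫ z in b..c, u' z * v z =
      ∫ z in b..c, deriv (fun z => u b + ∫ t in b..z, u' t) z * (v b + ∫ t in b..z, v' t) := by
    refine intervalIntegral.integral_congr_ae ?_
    filter_upwards [hdU] with z hz hz'
    rw [hz (uIoc_subset_uIcc hz'), ← hv z (sub z hz')]
  rw [e1, e2, h, ← hu c (right_mem_Icc.2 hbc), ← hv c (right_mem_Icc.2 hbc)]
  simp

theorem exists_Icc_of_isCompact_subset_Ioo {b c : ℝ} (hbc : b < c) {K : Set ℝ}
    (hK : IsCompact K) (hKbc : K ⊆ Ioo b c) :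
    ∃ b' c', b < b' ∧ b' ≤ c' ∧ c' < c ∧ K ⊆ Icc b' c' := by
  rcases K.eq_empty_or_nonempty with rfl | hne
  · exact ⟨(b + c) / 2, (b + c) / 2, by linarith, le_rfl, by linarith, empty_subset _⟩
  · obtain ⟨x, hx⟩ := hK.exists_isLeast hne
    obtain ⟨y, hy⟩ := hK.exists_isGreatest hne
    exact ⟨x, y, (hKbc hx.1).1, hx.2 hy.1, (hKbc hy.1).2, fun z hz => ⟨hx.2 hz, hy.2 hz⟩⟩

/-- Vanishing mean makes the primitive return to zero to the right of the support, so the primitive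
is itself an admissible test function. -/
theorem primitive_testFunction {b c : ℝ} (hbc : b < c) {φ : ℝ → ℝ} (hφ : ContDiff ℝ ∞ φ)
    (hφc : HasCompactSupport φ) (hφs : tsupport φ ⊆ Ioo b c) (hφ0 : ∫ t in b..c, φ t = 0) :
    ContDiff ℝ ∞ (fun z => ∫ t in b..z, φ t) ∧ HasCompactSupport (fun z => ∫ t in b..z, φ t) ∧
      tsupport (fun z => ∫ t in b..z, φ t) ⊆ Ioo b c ∧
      deriv (fun z => ∫ t in b..z, φ t) = φ := by
  have hd : ∀ z, HasDerivAt (fun z => ∫ t in b..z, φ t) (φ z) z := fun z =>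
    hφ.continuous.integral_hasStrictDerivAt b z |>.hasDerivAt
  have hderiv : deriv (fun z => ∫ t in b..z, φ t) = φ := funext fun z => (hd z).deriv
  obtain ⟨b', c', h1, h2, h3, h4⟩ := exists_Icc_of_isCompact_subset_Ioo hbc hφc hφs
  have hzero : ∀ t, t ∉ Icc b' c' → φ t = 0 := fun t ht => by
    by_contra hne
    exact ht (h4 (subset_tsupport _ hne))
  have hsupp : Function.support (fun z => ∫ t in b..z, φ t) ⊆ Icc b' c' := by
    intro z hz
    by_contra hz'
    apply hz
    rw [mem_Icc, not_and_or, not_le, not_le] at hz'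
    rcases hz' with hz' | hz'
    · refine intervalIntegral.integral_zero_ae (Filter.Eventually.of_forall fun t ht => hzero t ?_)
      rcases mem_uIoc.1 ht with ht | ht
      · exact fun h => by linarith [h.1, ht.2]
      · exact fun h => by linarith [h.1, ht.2]
    · have : ∫ t in b..z, φ t = (∫ t in b..c, φ t) + ∫ t in c..z, φ t :=
        (intervalIntegral.integral_add_adjacent_intervals
          (hφ.continuous.intervalIntegrable _ _) (hφ.continuous.intervalIntegrable _ _)).symm
      simp only [this, hφ0, zero_add]
      refine intervalIntegral.integral_zero_ae (Filter.Eventually.of_forall fun t ht => hzero t ?_)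
      rcases mem_uIoc.1 ht with ht | ht
      · exact fun h => by linarith [h.2, ht.1]
      · exact fun h => by linarith [h.2, ht.1]
  have hts : tsupport (fun z => ∫ t in b..z, φ t) ⊆ Icc b' c' :=
    closure_minimal hsupp isClosed_Icc
  refine ⟨?_, isCompact_Icc.of_isClosed_subset (isClosed_tsupport _) hts,
    hts.trans fun z hz => ⟨h1.trans_le hz.1, hz.2.trans_lt h3⟩, hderiv⟩
  rw [contDiff_infty_iff_deriv, hderiv]
  exact ⟨fun z => (hd z).differentiableAt, hφ⟩

/-- An integrable function with an integrable weak derivative is a primitive (real case). -/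
theorem ae_eq_primitive_of_weak_deriv_real {b c : ℝ} (hbc : b < c) {f g : ℝ → ℝ}
    (hf : IntervalIntegrable f volume b c) (hg : IntervalIntegrable g volume b c)
    (h : ∀ ψ : ℝ → ℝ, ContDiff ℝ ∞ ψ → HasCompactSupport ψ → tsupport ψ ⊆ Ioo b c →
      ∫ z in b..c, f z * deriv ψ z = -∫ z in b..c, g z * ψ z) :
    ∃ C, ∀ᵐ z, z ∈ Ioo b c → f z = C + ∫ t in b..z, g t := by
  set r : ℝ := (c - b) / 4 with hr
  have hr0 : 0 < r := by rw [hr]; linarith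
  let B : ContDiffBump ((b + c) / 2) := ⟨r / 2, r, by linarith, by linarith⟩
  set ψ₀ : ℝ → ℝ := B.normed volume with hψ₀
  have hψs : ContDiff ℝ ∞ ψ₀ := B.contDiff_normed
  have hψt : tsupport ψ₀ ⊆ Ioo b c := by
    rw [hψ₀, B.tsupport_normed_eq, Real.closedBall_eq_Icc]
    change Icc ((b + c) / 2 - r) ((b + c) / 2 + r) ⊆ _
    intro z hz
    constructor <;> [linarith [hz.1]; linarith [hz.2]]
  have hψc : HasCompactSupport ψ₀ := B.hasCompactSupport_normed
  have full : ∀ {φ : ℝ → ℝ}, tsupport φ ⊆ Ioo b c → ∫ z in b..c, φ z = ∫ z, φ z := by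
    intro φ hφ
    rw [intervalIntegral.integral_of_le hbc.le]
    refine setIntegral_eq_integral_of_forall_compl_eq_zero fun z hz => ?_
    by_contra hne
    have := hφ (subset_tsupport _ hne)
    exact hz ⟨this.1, this.2.le⟩
  have hψ1 : ∫ z in b..c, ψ₀ z = 1 := by rw [full hψt, hψ₀, B.integral_normed]
  set G : ℝ → ℝ := fun z => ∫ t in b..z, g t with hG
  have hGint : IntervalIntegrable G volume b c :=
    (hg.absolutelyContinuousOnInterval_intervalIntegral left_mem_uIcc).continuousOn.intervalIntegrable
  -- If `f - G` is a constant, averaging against the unit-mass bump `ψ₀` recovers it.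
  set C : ℝ := ∫ z in b..c, (f z - G z) * ψ₀ z with hC
  refine ⟨C, ?_⟩
  have hloc : LocallyIntegrableOn (fun z => f z - G z - C) (Ioo b c) := by
    have : IntervalIntegrable (fun z => f z - G z - C) volume b c :=
      (hf.sub hGint).sub intervalIntegrable_const
    exact ((intervalIntegrable_iff_integrableOn_Ioo_of_le hbc.le).1 this).locallyIntegrableOn
  have main := isOpen_Ioo.ae_eq_zero_of_integral_contDiff_smul_eq_zero hloc ?_
  · filter_upwards [main] with z hz hz'
    linarith [hz hz']
  intro φ hφ hφc hφt
  have e0 : ∫ x, φ x • (f x - G x - C) = ∫ x in b..c, φ x • (f x - G x - C) := by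
    refine (full (φ := fun x => φ x • (f x - G x - C)) ?_).symm
    exact (closure_mono (Function.support_smul_subset_left _ _)).trans hφt
  rw [e0]
  set m := ∫ x in b..c, φ x with hm
  -- Du Bois-Reymond's device: an arbitrary test function becomes one of mean zero, hence the
  -- derivative of a test function `θ`, after subtracting a multiple of `ψ₀`.
  set φ' : ℝ → ℝ := fun x => φ x - m * ψ₀ x with hφ'
  have s1 : ContDiff ℝ ∞ φ' := hφ.sub (contDiff_const.mul hψs)
  have hts : tsupport φ' ⊆ tsupport φ ∪ tsupport ψ₀ := by
    refine closure_minimal (fun x hx => ?_) ((isClosed_tsupport _).union (isClosed_tsupport _))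
    by_contra hn
    rw [mem_union, not_or] at hn
    apply hx
    simp [hφ', image_eq_zero_of_notMem_tsupport hn.1, image_eq_zero_of_notMem_tsupport hn.2]
  have s2 : HasCompactSupport φ' :=
    (hφc.union hψc).of_isClosed_subset (isClosed_tsupport _) hts
  have s3 : tsupport φ' ⊆ Ioo b c := hts.trans (union_subset hφt hψt)
  have ci : ∀ {w : ℝ → ℝ}, ContDiff ℝ ∞ w → IntervalIntegrable w volume b c :=
    fun hw => hw.continuous.intervalIntegrable _ _
  have s4 : ∫ x in b..c, φ' x = 0 := by
    rw [hφ', intervalIntegral.integral_sub (ci hφ) ((ci hψs).const_mul _),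
      intervalIntegral.integral_const_mul, hψ1, ← hm]; ring
  obtain ⟨p1, p2, p3, p4⟩ := primitive_testFunction hbc s1 s2 s3 s4
  set θ : ℝ → ℝ := fun z => ∫ t in b..z, φ' t with hθ
  have hw := h θ p1 p2 p3
  rw [p4] at hw
  have hθc : θ c = 0 := s4
  have hib := integral_mul_of_primitive hbc.le (u := G) (u' := g) (v := θ) (v' := φ') hg (ci s1)
    (fun z _ => by simp [hG]) (fun z _ => by simp [hθ])
  have hGb : G b = 0 := by simp [hG]
  rw [hθc, hGb] at hib
  have hfi : ∀ {w : ℝ → ℝ}, ContDiff ℝ ∞ w →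
      IntervalIntegrable (fun z => (f z - G z) * w z) volume b c :=
    fun hw => (hf.sub hGint).mul_continuousOn hw.continuous.continuousOn
  have h0 : ∫ z in b..c, (f z - G z) * φ' z = 0 := by
    have : ∀ z, (f z - G z) * φ' z = f z * φ' z - G z * φ' z := fun z => by ring
    simp_rw [this]
    rw [intervalIntegral.integral_sub (hf.mul_continuousOn s1.continuous.continuousOn)
      (hGint.mul_continuousOn s1.continuous.continuousOn), hw, hib]
    ring
  have h1 : ∀ z, (f z - G z) * φ' z = (f z - G z) * φ z - m * ((f z - G z) * ψ₀ z) := fun z => by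
    simp only [hφ']; ring
  simp_rw [h1] at h0
  rw [intervalIntegral.integral_sub (hfi hφ) ((hfi hψs).const_mul _),
    intervalIntegral.integral_const_mul, ← hC] at h0
  have h2 : ∀ z, φ z • (f z - G z - C) = (f z - G z) * φ z - C * φ z := fun z => by
    simp only [smul_eq_mul]; ring
  simp_rw [h2]
  rw [intervalIntegral.integral_sub (hfi hφ) ((ci hφ).const_mul _),
    intervalIntegral.integral_const_mul, ← hm]
  linarith

theorem IntervalIntegrable.re' {b c : ℝ} {f : ℝ → ℂ} (hf : IntervalIntegrable f volume b c) :
    IntervalIntegrable (fun z => (f z).re) volume b c :=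
  ⟨hf.1.re, hf.2.re⟩

theorem IntervalIntegrable.im' {b c : ℝ} {f : ℝ → ℂ} (hf : IntervalIntegrable f volume b c) :
    IntervalIntegrable (fun z => (f z).im) volume b c :=
  ⟨hf.1.im, hf.2.im⟩

theorem intervalIntegral_re {b c : ℝ} {f : ℝ → ℂ} (hf : IntervalIntegrable f volume b c) :
    (∫ z in b..c, f z).re = ∫ z in b..c, (f z).re :=
  (Complex.reCLM.intervalIntegral_comp_comm hf).symm

theorem intervalIntegral_im {b c : ℝ} {f : ℝ → ℂ} (hf : IntervalIntegrable f volume b c) :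
    (∫ z in b..c, f z).im = ∫ z in b..c, (f z).im :=
  (Complex.imCLM.intervalIntegral_comp_comm hf).symm

/-- An integrable function with an integrable weak derivative is a primitive. -/
theorem ae_eq_primitive_of_weak_deriv {b c : ℝ} (hbc : b < c) {f g : ℝ → ℂ}
    (hf : IntervalIntegrable f volume b c) (hg : IntervalIntegrable g volume b c)
    (h : ∀ ψ : ℝ → ℝ, ContDiff ℝ ∞ ψ → HasCompactSupport ψ → tsupport ψ ⊆ Ioo b c →
      ∫ z in b..c, f z * ((deriv ψ z : ℝ) : ℂ) = -∫ z in b..c, g z * (ψ z : ℂ)) :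
    ∃ C, ∀ᵐ z, z ∈ Ioo b c → f z = C + ∫ t in b..z, g t := by
  have mulc : ∀ {w : ℝ → ℂ} {ψ : ℝ → ℝ}, IntervalIntegrable w volume b c → Continuous ψ →
      IntervalIntegrable (fun z => w z * (ψ z : ℂ)) volume b c := fun hw hψ =>
    hw.mul_continuousOn (Complex.continuous_ofReal.comp hψ).continuousOn
  have dc : ∀ {ψ : ℝ → ℝ}, ContDiff ℝ ∞ ψ → Continuous (deriv ψ) := fun hψ =>
    hψ.continuous_deriv (by simp)
  obtain ⟨C₁, h₁⟩ := ae_eq_primitive_of_weak_deriv_real hbc hf.re' hg.re' (by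
    intro ψ h1 h2 h3
    have := congrArg Complex.re (h ψ h1 h2 h3)
    rw [Complex.neg_re, intervalIntegral_re (mulc hf (dc h1)),
      intervalIntegral_re (mulc hg h1.continuous)] at this
    simpa using this)
  obtain ⟨C₂, h₂⟩ := ae_eq_primitive_of_weak_deriv_real hbc hf.im' hg.im' (by
    intro ψ h1 h2 h3
    have := congrArg Complex.im (h ψ h1 h2 h3)
    rw [Complex.neg_im, intervalIntegral_im (mulc hf (dc h1)),
      intervalIntegral_im (mulc hg h1.continuous)] at this
    simpa using this)
  refine ⟨⟨C₁, C₂⟩, ?_⟩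
  filter_upwards [h₁, h₂] with z h1 h2 hz
  have hgz : IntervalIntegrable g volume b z := hg.mono_set (by
    rw [uIcc_of_le hz.1.le, uIcc_of_le hbc.le]; exact Icc_subset_Icc_right hz.2.le)
  apply Complex.ext
  · rw [Complex.add_re, intervalIntegral_re hgz, h1 hz]
  · rw [Complex.add_im, intervalIntegral_im hgz, h2 hz]

/-! ### Pointwise bounds, interpolation and energy inequality for `H²` curves. -/

/-- The curve `f` on `[b, c]` has the derivative `p`, which is a primitive of the square integrable
function `q`. -/
structure IsH2Curve (b c : ℝ) (f p q : ℝ → ℂ) : Prop where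
  integrable : IntervalIntegrable q volume b c
  sq_integrable : IntervalIntegrable (fun z => ‖q z‖ ^ 2) volume b c
  f_eq : ∀ z ∈ Icc b c, f z = f b + ∫ t in b..z, p t
  p_eq : ∀ z ∈ Icc b c, p z = p b + ∫ t in b..z, q t

/-- Cauchy–Schwarz, read off from `∫ ((c - b) g - I)² ≥ 0` with `I = ∫ g`. -/
theorem sq_integral_le {b c : ℝ} (hbc : b < c) {g : ℝ → ℝ} (hg : IntervalIntegrable g volume b c)
    (hg2 : IntervalIntegrable (fun z => g z ^ 2) volume b c) :
    (∫ z in b..c, g z) ^ 2 ≤ (c - b) * ∫ z in b..c, g z ^ 2 := by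
  set I := ∫ z in b..c, g z with hI
  have h0 : 0 ≤ ∫ z in b..c, (((c - b) * g z) - I) ^ 2 :=
    intervalIntegral.integral_nonneg hbc.le fun z _ => sq_nonneg _
  have h1 : ∀ z, (((c - b) * g z) - I) ^ 2 =
      (c - b) ^ 2 * g z ^ 2 - 2 * (c - b) * I * g z + I ^ 2 := fun z => by ring
  simp_rw [h1] at h0
  rw [intervalIntegral.integral_add ((hg2.const_mul _).sub (hg.const_mul _))
      intervalIntegrable_const, intervalIntegral.integral_sub (hg2.const_mul _) (hg.const_mul _),
    intervalIntegral.integral_const_mul, intervalIntegral.integral_const_mul,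
    intervalIntegral.integral_const, ← hI, smul_eq_mul] at h0
  have hpos : 0 < c - b := by linarith
  have : 0 ≤ (c - b) * ((c - b) * (∫ z in b..c, g z ^ 2) - I ^ 2) := by nlinarith
  have := (mul_nonneg_iff_of_pos_left hpos).1 this
  linarith

/-- Somewhere a continuous function is at most its mean value. -/
theorem exists_le_mean {b c : ℝ} (hbc : b < c) {g : ℝ → ℝ} (hg : ContinuousOn g (Icc b c)) :
    ∃ y ∈ Icc b c, (c - b) * g y ≤ ∫ z in b..c, g z := by
  obtain ⟨y, hy, hmin⟩ := isCompact_Icc.exists_isMinOn (nonempty_Icc.2 hbc.le) hg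
  refine ⟨y, hy, ?_⟩
  have := intervalIntegral.integral_mono_on hbc.le (intervalIntegrable_const (μ := volume) (c := g y))
    (hg.intervalIntegrable_of_Icc hbc.le) fun z hz => hmin hz
  simpa using this

theorem intervalIntegral_mono_interval {b b' c' c : ℝ} (h1 : b ≤ b') (h2 : b' ≤ c') (h3 : c' ≤ c)
    {g : ℝ → ℝ} (hg : IntervalIntegrable g volume b c) (h0 : ∀ z, 0 ≤ g z) :
    ∫ z in b'..c', g z ≤ ∫ z in b..c, g z :=
  intervalIntegral.integral_mono_interval h1 h2 h3 (Filter.Eventually.of_forall h0) hg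

theorem IntervalIntegrable.mono_Icc {E : Type*} [NormedAddCommGroup E] {b b' c' c : ℝ}
    (h1 : b ≤ b') (h2 : b' ≤ c') (h3 : c' ≤ c)
    {g : ℝ → E} (hg : IntervalIntegrable g volume b c) : IntervalIntegrable g volume b' c' :=
  hg.mono_set (by
    rw [uIcc_of_le h2, uIcc_of_le (h1.trans (h2.trans h3))]; exact Icc_subset_Icc h1 h3)

namespace IsH2Curve

variable {b c : ℝ} {f p q : ℝ → ℂ}

theorem continuousOn_p (h : IsH2Curve b c f p q) (hbc : b ≤ c) : ContinuousOn p (Icc b c) := by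
  have : ContinuousOn (fun z => p b + ∫ t in b..z, q t) (Icc b c) := by
    refine continuousOn_const.add ?_
    have := intervalIntegral.continuousOn_primitive_interval (μ := volume) (f := q)
      (a := b) (b := c) (by
        rw [uIcc_of_le hbc]
        exact (intervalIntegrable_iff_integrableOn_Icc_of_le hbc).1 h.integrable)
    rwa [uIcc_of_le hbc] at this
  exact this.congr h.p_eq

theorem intervalIntegrable_p (h : IsH2Curve b c f p q) (hbc : b ≤ c) :
    IntervalIntegrable p volume b c :=
  (h.continuousOn_p hbc).intervalIntegrable_of_Icc hbc

theorem continuousOn_f (h : IsH2Curve b c f p q) (hbc : b ≤ c) : ContinuousOn f (Icc b c) := by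
  have : ContinuousOn (fun z => f b + ∫ t in b..z, p t) (Icc b c) := by
    refine continuousOn_const.add ?_
    have := intervalIntegral.continuousOn_primitive_interval (μ := volume) (f := p)
      (a := b) (b := c) (by
        rw [uIcc_of_le hbc]
        exact (intervalIntegrable_iff_integrableOn_Icc_of_le hbc).1 (h.intervalIntegrable_p hbc))
    rwa [uIcc_of_le hbc] at this
  exact this.congr h.f_eq

theorem f_sub (h : IsH2Curve b c f p q) {x y : ℝ} (hx : b ≤ x) (hxy : x ≤ y) (hy : y ≤ c) :
    f y - f x = ∫ t in x..y, p t := by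
  have hp := h.intervalIntegrable_p (hx.trans (hxy.trans hy))
  rw [h.f_eq y ⟨hx.trans hxy, hy⟩, h.f_eq x ⟨hx, hxy.trans hy⟩,
    ← intervalIntegral.integral_add_adjacent_intervals (hp.mono_Icc le_rfl hx (hxy.trans hy))
      (hp.mono_Icc hx hxy hy)]
  ring

theorem p_sub (h : IsH2Curve b c f p q) {x y : ℝ} (hx : b ≤ x) (hxy : x ≤ y) (hy : y ≤ c) :
    p y - p x = ∫ t in x..y, q t := by
  have hp := h.integrable
  rw [h.p_eq y ⟨hx.trans hxy, hy⟩, h.p_eq x ⟨hx, hxy.trans hy⟩,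
    ← intervalIntegral.integral_add_adjacent_intervals (hp.mono_Icc le_rfl hx (hxy.trans hy))
      (hp.mono_Icc hx hxy hy)]
  ring

theorem mono (h : IsH2Curve b c f p q) {b' c' : ℝ} (h1 : b ≤ b') (h2 : b' ≤ c') (h3 : c' ≤ c) :
    IsH2Curve b' c' f p q where
  integrable := h.integrable.mono_Icc h1 h2 h3
  sq_integrable := h.sq_integrable.mono_Icc h1 h2 h3
  f_eq z hz := by rw [← h.f_sub h1 hz.1 (hz.2.trans h3)]; ring
  p_eq z hz := by rw [← h.p_sub h1 hz.1 (hz.2.trans h3)]; ring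

theorem norm_p_sub_le (h : IsH2Curve b c f p q) {x y : ℝ} (hx : x ∈ Icc b c) (hy : y ∈ Icc b c) :
    ‖p x - p y‖ ≤ ∫ t in b..c, ‖q t‖ := by
  have key : ∀ {x y : ℝ}, x ∈ Icc b c → y ∈ Icc b c → x ≤ y →
      ‖p y - p x‖ ≤ ∫ t in b..c, ‖q t‖ := by
    intro x y hx hy hxy
    rw [h.p_sub hx.1 hxy hy.2]
    exact (intervalIntegral.norm_integral_le_integral_norm hxy).trans
      (intervalIntegral_mono_interval hx.1 hxy hy.2 h.integrable.norm fun _ => norm_nonneg _)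
  rcases le_total x y with hxy | hxy
  · rw [norm_sub_rev]; exact key hx hy hxy
  · exact key hy hx hxy

/-- In the first and in the last third of the interval there is a point where `‖f‖` is at most its
mean. The difference quotient of `f` between these points, at distance at least `(c - b)/3`, is
bounded by `∫ ‖f‖`, and `p z` differs from it by at most the total variation `∫ ‖q‖` of `p`. -/
theorem norm_p_le (h : IsH2Curve b c f p q) (hbc : b < c) {z : ℝ} (hz : z ∈ Icc b c) :
    ‖p z‖ ≤ 9 / (c - b) ^ 2 * (∫ t in b..c, ‖f t‖) + ∫ t in b..c, ‖q t‖ := by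
  set s := c - b with hs
  have hs0 : 0 < s := by rw [hs]; linarith
  have hfn : ContinuousOn (fun t => ‖f t‖) (Icc b c) := (h.continuousOn_f hbc.le).norm
  have hfi : IntervalIntegrable (fun t => ‖f t‖) volume b c := hfn.intervalIntegrable_of_Icc hbc.le
  obtain ⟨y₁, hy₁, e₁⟩ := exists_le_mean (b := b) (c := b + s / 3) (by linarith)
    (hfn.mono (Icc_subset_Icc_right (by linarith)))
  obtain ⟨y₂, hy₂, e₂⟩ := exists_le_mean (b := c - s / 3) (c := c) (by linarith)
    (hfn.mono (Icc_subset_Icc_left (by linarith)))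
  have esum : (∫ t in b..(b + s / 3), ‖f t‖) + ∫ t in (c - s / 3)..c, ‖f t‖ ≤
      ∫ t in b..c, ‖f t‖ := by
    rw [← intervalIntegral.integral_add_adjacent_intervals
      (hfi.mono_Icc (c' := b + s / 3) le_rfl (by linarith) (by linarith))
      (hfi.mono_Icc (b' := b + s / 3) (by linarith) (by linarith) le_rfl)]
    gcongr
    exact intervalIntegral_mono_interval (by linarith) (by linarith) le_rfl
      (hfi.mono_Icc (by linarith) (by linarith) le_rfl) fun _ => norm_nonneg _
  have hy12 : s / 3 ≤ y₂ - y₁ := by linarith [hy₁.2, hy₂.1]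
  have hy0 : y₁ ≤ y₂ := by linarith
  have hb1 : b ≤ y₁ := hy₁.1
  have hc2 : y₂ ≤ c := hy₂.2
  have hpi := (h.intervalIntegrable_p hbc.le).mono_Icc hb1 hy0 hc2
  have id1 : ((y₂ - y₁ : ℝ) : ℂ) * p z = (∫ t in y₁..y₂, (p z - p t)) + (f y₂ - f y₁) := by
    rw [h.f_sub hb1 hy0 hc2, intervalIntegral.integral_sub intervalIntegrable_const hpi,
      intervalIntegral.integral_const, Complex.real_smul]
    ring
  have n1 : ‖∫ t in y₁..y₂, (p z - p t)‖ ≤ (∫ t in b..c, ‖q t‖) * (y₂ - y₁) := by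
    have := intervalIntegral.norm_integral_le_of_norm_le_const (a := y₁) (b := y₂)
      (f := fun t => p z - p t) (C := ∫ t in b..c, ‖q t‖) (fun t ht => by
        rw [uIoc_of_le hy0] at ht
        exact h.norm_p_sub_le hz ⟨hb1.trans ht.1.le, ht.2.trans hc2⟩)
    rwa [abs_of_nonneg (by linarith)] at this
  have n2 : ‖f y₂ - f y₁‖ ≤ 3 / s * ∫ t in b..c, ‖f t‖ := by
    have : s / 3 * (‖f y₁‖ + ‖f y₂‖) ≤ ∫ t in b..c, ‖f t‖ := by
      have e1' : s / 3 * ‖f y₁‖ ≤ ∫ t in b..(b + s / 3), ‖f t‖ := by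
        convert e₁ using 2; ring
      have e2' : s / 3 * ‖f y₂‖ ≤ ∫ t in (c - s / 3)..c, ‖f t‖ := by
        convert e₂ using 2; ring
      linarith
    calc ‖f y₂ - f y₁‖ ≤ ‖f y₁‖ + ‖f y₂‖ := by
          rw [add_comm]; exact norm_sub_le _ _
      _ = 3 / s * (s / 3 * (‖f y₁‖ + ‖f y₂‖)) := by field_simp
      _ ≤ _ := by gcongr
  have n3 : (y₂ - y₁) * ‖p z‖ ≤
      (∫ t in b..c, ‖q t‖) * (y₂ - y₁) + 3 / s * ∫ t in b..c, ‖f t‖ := by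
    have : ‖((y₂ - y₁ : ℝ) : ℂ) * p z‖ = (y₂ - y₁) * ‖p z‖ := by
      rw [norm_mul, Complex.norm_real, Real.norm_of_nonneg (by linarith)]
    rw [← this, id1]
    exact (norm_add_le _ _).trans (add_le_add n1 n2)
  have hF : 0 ≤ ∫ t in b..c, ‖f t‖ :=
    intervalIntegral.integral_nonneg hbc.le fun _ _ => norm_nonneg _
  have hpos : 0 < y₂ - y₁ := by linarith
  have n4 : 3 / s * ∫ t in b..c, ‖f t‖ ≤ (y₂ - y₁) * (9 / s ^ 2 * ∫ t in b..c, ‖f t‖) := by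
    calc 3 / s * ∫ t in b..c, ‖f t‖ = s / 3 * (9 / s ^ 2 * ∫ t in b..c, ‖f t‖) := by
          field_simp; norm_num; exact mul_comm _ _
      _ ≤ _ := by gcongr
  exact le_of_mul_le_mul_left (by linarith) hpos

theorem sq_norm_p_le_self (h : IsH2Curve b c f p q) (hbc : b < c) {z : ℝ} (hz : z ∈ Icc b c) :
    ‖p z‖ ^ 2 ≤ 162 / (c - b) ^ 3 * (∫ t in b..c, ‖f t‖ ^ 2) +
      2 * (c - b) * ∫ t in b..c, ‖q t‖ ^ 2 := by
  have hs0 : 0 < c - b := by linarith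
  have hfn : ContinuousOn (fun t => ‖f t‖) (Icc b c) := (h.continuousOn_f hbc.le).norm
  have e1 := sq_integral_le hbc (hfn.intervalIntegrable_of_Icc hbc.le)
    ((hfn.pow 2).intervalIntegrable_of_Icc hbc.le)
  have e2 := sq_integral_le hbc h.integrable.norm h.sq_integrable
  have e3 := h.norm_p_le hbc hz
  set F := ∫ t in b..c, ‖f t‖
  set Q := ∫ t in b..c, ‖q t‖
  set s := c - b
  calc ‖p z‖ ^ 2 ≤ (9 / s ^ 2 * F + Q) ^ 2 := by gcongr
    _ ≤ 2 * (9 / s ^ 2 * F) ^ 2 + 2 * Q ^ 2 := by nlinarith [sq_nonneg (9 / s ^ 2 * F - Q)]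
    _ = 162 / s ^ 4 * F ^ 2 + 2 * Q ^ 2 := by rw [mul_pow, div_pow]; ring
    _ ≤ 162 / s ^ 4 * (s * ∫ t in b..c, ‖f t‖ ^ 2) + 2 * (s * ∫ t in b..c, ‖q t‖ ^ 2) := by
        gcongr
    _ = _ := by field_simp

theorem exists_subinterval {s z : ℝ} (hs : 0 < s) (hsc : s ≤ c - b)
    (hz : z ∈ Icc b c) : ∃ b', b ≤ b' ∧ b' + s ≤ c ∧ z ∈ Icc b' (b' + s) := by
  rcases le_total (b + s) z with h | h
  · exact ⟨z - s, by linarith, by linarith [hz.2], by linarith, by linarith⟩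
  · exact ⟨b, le_rfl, by linarith, hz.1, h⟩

/-- The bound on a whole interval is applied to a subinterval of length `s` around `z`. The free
scale `s` is later matched to the frequency. -/
theorem sq_norm_p_le (h : IsH2Curve b c f p q) {s : ℝ} (hs : 0 < s) (hsc : s ≤ c - b)
    {z : ℝ} (hz : z ∈ Icc b c) :
    ‖p z‖ ^ 2 ≤ 162 / s ^ 3 * (∫ t in b..c, ‖f t‖ ^ 2) + 2 * s * ∫ t in b..c, ‖q t‖ ^ 2 := by
  obtain ⟨b', h1, h2, h3⟩ := exists_subinterval hs hsc hz
  have hbc : b ≤ c := hz.1.trans hz.2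
  have h' := h.mono (c' := b' + s) h1 (by linarith) h2
  have := h'.sq_norm_p_le_self (by linarith) h3
  rw [add_sub_cancel_left] at this
  refine this.trans ?_
  have i1 := intervalIntegral_mono_interval (c' := b' + s) h1 (by linarith) h2
    (((h.continuousOn_f hbc).norm.pow 2).intervalIntegrable_of_Icc hbc) (fun _ => sq_nonneg _)
  have i2 := intervalIntegral_mono_interval (c' := b' + s) h1 (by linarith) h2
    h.sq_integrable (fun _ => sq_nonneg _)
  gcongr
  exact i1

/-- On a window of length `s` the curve is small at one point, by the mean value, and moves by at
most `s · sup ‖p‖`. Squaring gives `326 = 2 + 2 · 162`. -/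
theorem sq_norm_f_le (h : IsH2Curve b c f p q) {s : ℝ} (hs : 0 < s) (hsc : s ≤ c - b)
    {z : ℝ} (hz : z ∈ Icc b c) :
    ‖f z‖ ^ 2 ≤ 326 / s * (∫ t in b..c, ‖f t‖ ^ 2) + 4 * s ^ 3 * ∫ t in b..c, ‖q t‖ ^ 2 := by
  obtain ⟨b', h1, h2, h3⟩ := exists_subinterval hs hsc hz
  have hbc : b ≤ c := hz.1.trans hz.2
  have hf2 : ContinuousOn (fun t => ‖f t‖ ^ 2) (Icc b c) := (h.continuousOn_f hbc).norm.pow 2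
  set F := ∫ t in b..c, ‖f t‖ ^ 2 with hF
  set Q := ∫ t in b..c, ‖q t‖ ^ 2
  obtain ⟨y, hy, hy'⟩ := exists_le_mean (b := b') (c := b' + s) (by linarith)
    (hf2.mono (Icc_subset_Icc h1 h2))
  have i1 : ∫ t in b'..(b' + s), ‖f t‖ ^ 2 ≤ F :=
    intervalIntegral_mono_interval h1 (by linarith) h2
      (hf2.intervalIntegrable_of_Icc hbc) (fun _ => sq_nonneg _)
  rw [add_sub_cancel_left] at hy'
  have e1 : ‖f y‖ ^ 2 ≤ F / s := by rw [le_div_iff₀ hs]; linarith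
  set P := 162 / s ^ 3 * F + 2 * s * Q with hP
  have hF0 : 0 ≤ F := intervalIntegral.integral_nonneg hbc fun _ _ => sq_nonneg _
  have hQ0 : 0 ≤ Q := intervalIntegral.integral_nonneg hbc fun _ _ => sq_nonneg _
  have hP0 : 0 ≤ P := by positivity
  have hp : ∀ t ∈ Icc b c, ‖p t‖ ≤ Real.sqrt P := fun t ht =>
    Real.le_sqrt_of_sq_le (h.sq_norm_p_le hs hsc ht)
  have key : ∀ {x w : ℝ}, x ∈ Icc b' (b' + s) → w ∈ Icc b' (b' + s) → x ≤ w →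
      ‖f w - f x‖ ≤ Real.sqrt P * s := by
    intro x w hx hw hxw
    rw [h.f_sub (h1.trans hx.1) hxw (hw.2.trans h2)]
    have := intervalIntegral.norm_integral_le_of_norm_le_const (a := x) (b := w)
      (f := p) (C := Real.sqrt P) (fun t ht => by
        rw [uIoc_of_le hxw] at ht
        exact hp t ⟨h1.trans (hx.1.trans ht.1.le), ht.2.trans (hw.2.trans h2)⟩)
    refine this.trans ?_
    rw [abs_of_nonneg (by linarith)]
    gcongr
    linarith [hx.1, hw.2]
  have e2 : ‖f z - f y‖ ≤ Real.sqrt P * s := by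
    rcases le_total y z with hyz | hyz
    · exact key hy h3 hyz
    · rw [norm_sub_rev]; exact key h3 hy hyz
  have e3 : ‖f z‖ ≤ ‖f y‖ + Real.sqrt P * s := by
    have := norm_add_le (f y) (f z - f y)
    rw [add_sub_cancel] at this
    linarith
  calc ‖f z‖ ^ 2 ≤ (‖f y‖ + Real.sqrt P * s) ^ 2 := by gcongr
    _ ≤ 2 * ‖f y‖ ^ 2 + 2 * (Real.sqrt P * s) ^ 2 := by
        nlinarith [sq_nonneg (‖f y‖ - Real.sqrt P * s)]
    _ = 2 * ‖f y‖ ^ 2 + 2 * (P * s ^ 2) := by rw [mul_pow, Real.sq_sqrt hP0]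
    _ ≤ 2 * (F / s) + 2 * (P * s ^ 2) := by gcongr
    _ = _ := by rw [hP]; field_simp; ring

theorem integral_sq_p_le_self (h : IsH2Curve b c f p q) (hbc : b < c) :
    ∫ t in b..c, ‖p t‖ ^ 2 ≤ 162 / (c - b) ^ 2 * (∫ t in b..c, ‖f t‖ ^ 2) +
      2 * (c - b) ^ 2 * ∫ t in b..c, ‖q t‖ ^ 2 := by
  have := intervalIntegral.integral_mono_on hbc.le
    (((h.continuousOn_p hbc.le).norm.pow 2).intervalIntegrable_of_Icc hbc.le)
    (intervalIntegrable_const (μ := volume) (c := 162 / (c - b) ^ 3 * (∫ t in b..c, ‖f t‖ ^ 2) +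
      2 * (c - b) * ∫ t in b..c, ‖q t‖ ^ 2)) (fun z hz => h.sq_norm_p_le_self hbc hz)
  refine this.trans (le_of_eq ?_)
  rw [intervalIntegral.integral_const, smul_eq_mul]
  have : c - b ≠ 0 := by linarith
  field_simp

/-- Interpolation between a curve and its second derivative at the scale `s`. -/
theorem integral_sq_p_le (h : IsH2Curve b c f p q) {s : ℝ} (hs : 0 < s) (hsc : s ≤ c - b) :
    ∫ t in b..c, ‖p t‖ ^ 2 ≤ 648 / s ^ 2 * (∫ t in b..c, ‖f t‖ ^ 2) +
      2 * s ^ 2 * ∫ t in b..c, ‖q t‖ ^ 2 := by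
  have hbc : b < c := by linarith
  -- Equal pieces of length `s'` with `s/2 ≤ s' ≤ s`. Replacing `s'` by `s` costs the factor four in
  -- `648 = 4 · 162`.
  set N := ⌈(c - b) / s⌉₊ with hN
  have hx1 : 1 ≤ (c - b) / s := by rwa [one_le_div hs]
  have hN1 : (c - b) / s ≤ N := Nat.le_ceil _
  have hN2 : (N : ℝ) < (c - b) / s + 1 := Nat.ceil_lt_add_one (by linarith)
  have hN0 : (0 : ℝ) < N := by linarith
  set s' := (c - b) / N with hs'
  have hs'0 : 0 < s' := div_pos (by linarith) hN0
  have hs's : s' ≤ s := by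
    rw [hs', div_le_iff₀ hN0]; rw [div_le_iff₀ hs] at hN1; linarith
  have hss' : s ≤ 2 * s' := by
    rw [hs', mul_div_assoc', le_div_iff₀ hN0]
    have : (N : ℝ) ≤ 2 * ((c - b) / s) := by linarith
    calc s * N ≤ s * (2 * ((c - b) / s)) := by gcongr
      _ = _ := by field_simp
  set a : ℕ → ℝ := fun k => b + k * s' with ha
  have ha0 : a 0 = b := by simp [ha]
  have haN : a N = c := by simp only [ha, hs']; field_simp; ring
  have hstep : ∀ k, a (k + 1) - a k = s' := fun k => by simp only [ha]; push_cast; ring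
  have hlb : ∀ k, b ≤ a k := fun k => by simp only [ha]; nlinarith [k.cast_nonneg (α := ℝ)]
  have hub : ∀ k, k < N → a (k + 1) ≤ c := fun k hk => by
    rw [← haN]; simp only [ha]
    have : ((k + 1 : ℕ) : ℝ) ≤ N := by exact_mod_cast hk
    nlinarith
  have hlt : ∀ k, a k < a (k + 1) := fun k => by linarith [hstep k]
  have sumI : ∀ {g : ℝ → ℝ}, IntervalIntegrable g volume b c →
      ∑ k ∈ Finset.range N, ∫ t in (a k)..(a (k + 1)), g t = ∫ t in b..c, g t := by
    intro g hg
    rw [intervalIntegral.sum_integral_adjacent_intervals, ha0, haN]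
    intro k hk
    exact hg.mono_Icc (hlb k) (hlt k).le (hub k hk)
  have if2 : IntervalIntegrable (fun t => ‖f t‖ ^ 2) volume b c :=
    ((h.continuousOn_f hbc.le).norm.pow 2).intervalIntegrable_of_Icc hbc.le
  have ip2 : IntervalIntegrable (fun t => ‖p t‖ ^ 2) volume b c :=
    ((h.continuousOn_p hbc.le).norm.pow 2).intervalIntegrable_of_Icc hbc.le
  have hF0 : 0 ≤ ∫ t in b..c, ‖f t‖ ^ 2 :=
    intervalIntegral.integral_nonneg hbc.le fun _ _ => sq_nonneg _
  have hQ0 : 0 ≤ ∫ t in b..c, ‖q t‖ ^ 2 :=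
    intervalIntegral.integral_nonneg hbc.le fun _ _ => sq_nonneg _
  calc ∫ t in b..c, ‖p t‖ ^ 2 = ∑ k ∈ Finset.range N, ∫ t in (a k)..(a (k + 1)), ‖p t‖ ^ 2 :=
        (sumI ip2).symm
    _ ≤ ∑ k ∈ Finset.range N, (162 / s' ^ 2 * (∫ t in (a k)..(a (k + 1)), ‖f t‖ ^ 2) +
          2 * s' ^ 2 * ∫ t in (a k)..(a (k + 1)), ‖q t‖ ^ 2) := by
        refine Finset.sum_le_sum fun k hk => ?_
        have := (h.mono (hlb k) (hlt k).le (hub k (Finset.mem_range.1 hk))).integral_sq_p_le_self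
          (hlt k)
        rwa [hstep k] at this
    _ = 162 / s' ^ 2 * (∫ t in b..c, ‖f t‖ ^ 2) + 2 * s' ^ 2 * ∫ t in b..c, ‖q t‖ ^ 2 := by
        rw [Finset.sum_add_distrib, ← Finset.mul_sum, ← Finset.mul_sum, sumI if2,
          sumI h.sq_integrable]
    _ ≤ _ := by
        have : 162 / s' ^ 2 ≤ 648 / s ^ 2 := by
          rw [div_le_div_iff₀ (by positivity) (by positivity)]
          nlinarith
        gcongr

/-- The energy identity for `f'' - Λ f` with Dirichlet conditions (real case). -/
theorem integral_sq_add_le_of_primitive {b c Λ : ℝ} (hbc : b ≤ c) (hΛ : 0 ≤ Λ) {f p q : ℝ → ℝ}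
    (hp : ContinuousOn p (Icc b c)) (hf : ContinuousOn f (Icc b c))
    (hq : IntervalIntegrable q volume b c) (hq2 : IntervalIntegrable (fun z => q z ^ 2) volume b c)
    (hfp : ∀ z ∈ Icc b c, f z = f b + ∫ t in b..z, p t)
    (hpq : ∀ z ∈ Icc b c, p z = p b + ∫ t in b..z, q t) (hfb : f b = 0) (hfc : f c = 0) :
    (∫ z in b..c, q z ^ 2) + Λ ^ 2 * (∫ z in b..c, f z ^ 2) ≤
      ∫ z in b..c, (q z - Λ * f z) ^ 2 := by
  have h1 := integral_mul_of_primitive hbc (hp.intervalIntegrable_of_Icc hbc) hq hfp hpq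
  rw [hfb, hfc] at h1
  have e : ∀ z, (q z - Λ * f z) ^ 2 = q z ^ 2 - 2 * Λ * (f z * q z) + Λ ^ 2 * f z ^ 2 :=
    fun z => by ring
  have hf' : ContinuousOn f (uIcc b c) := by rwa [uIcc_of_le hbc]
  have i1 : IntervalIntegrable (fun z => f z * q z) volume b c := hq.continuousOn_mul hf'
  have i2 : IntervalIntegrable (fun z => f z ^ 2) volume b c :=
    (hf.pow 2).intervalIntegrable_of_Icc hbc
  simp_rw [e]
  rw [intervalIntegral.integral_add (hq2.sub (i1.const_mul _)) (i2.const_mul _),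
    intervalIntegral.integral_sub hq2 (i1.const_mul _), intervalIntegral.integral_const_mul,
    intervalIntegral.integral_const_mul, h1]
  -- The cross term `-2Λ ∫ f q` equals `2Λ ∫ p²`, because the boundary terms vanish; it may
  -- therefore be dropped.
  have h2 : 0 ≤ ∫ z in b..c, p z * p z :=
    intervalIntegral.integral_nonneg hbc fun z _ => mul_self_nonneg _
  nlinarith [mul_nonneg hΛ h2]

/-- The energy inequality for `f'' - Λ f` with Dirichlet conditions. -/
theorem integral_sq_add_le (h : IsH2Curve b c f p q) (hbc : b ≤ c) {Λ : ℝ} (hΛ : 0 ≤ Λ)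
    (hfb : f b = 0) (hfc : f c = 0) :
    (∫ z in b..c, ‖q z‖ ^ 2) + Λ ^ 2 * (∫ z in b..c, ‖f z‖ ^ 2) ≤
      ∫ z in b..c, ‖q z - Λ * f z‖ ^ 2 := by
  have sq : ∀ w : ℂ, ‖w‖ ^ 2 = w.re ^ 2 + w.im ^ 2 := fun w => by
    rw [← Complex.normSq_eq_norm_sq, Complex.normSq_apply]; ring
  have hp := h.continuousOn_p hbc
  have hf := h.continuousOn_f hbc
  have hpi := h.intervalIntegrable_p hbc
  have r2 : IntervalIntegrable (fun z => (q z).re ^ 2) volume b c :=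
    h.sq_integrable.mono_fun (by
      exact (h.integrable.re'.def'.aestronglyMeasurable.pow 2)) (Filter.Eventually.of_forall fun z => by
      simp only [sq, norm_pow, Real.norm_eq_abs, sq_abs]
      rw [abs_of_nonneg (by positivity)]
      nlinarith [sq_nonneg (q z).im])
  have i2 : IntervalIntegrable (fun z => (q z).im ^ 2) volume b c :=
    h.sq_integrable.mono_fun (by
      exact (h.integrable.im'.def'.aestronglyMeasurable.pow 2)) (Filter.Eventually.of_forall fun z => by
      simp only [sq, norm_pow, Real.norm_eq_abs, sq_abs]
      rw [abs_of_nonneg (by positivity)]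
      nlinarith [sq_nonneg (q z).re])
  have fr : ContinuousOn (fun z => (f z).re) (Icc b c) :=
    Complex.continuous_re.comp_continuousOn hf
  have fi : ContinuousOn (fun z => (f z).im) (Icc b c) :=
    Complex.continuous_im.comp_continuousOn hf
  have sub : ∀ {g : ℝ → ℂ} {z : ℝ}, IntervalIntegrable g volume b c → z ∈ Icc b c →
      IntervalIntegrable g volume b z := fun hg hz => hg.mono_Icc le_rfl hz.1 hz.2
  have hR := integral_sq_add_le_of_primitive (f := fun z => (f z).re) (p := fun z => (p z).re)
    (q := fun z => (q z).re) hbc hΛ (Complex.continuous_re.comp_continuousOn hp) fr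
    h.integrable.re' r2
    (fun z hz => by
      rw [← intervalIntegral_re (sub hpi hz), ← Complex.add_re, ← h.f_eq z hz])
    (fun z hz => by
      rw [← intervalIntegral_re (sub h.integrable hz), ← Complex.add_re, ← h.p_eq z hz])
    (by simp [hfb]) (by simp [hfc])
  have hI := integral_sq_add_le_of_primitive (f := fun z => (f z).im) (p := fun z => (p z).im)
    (q := fun z => (q z).im) hbc hΛ (Complex.continuous_im.comp_continuousOn hp) fi
    h.integrable.im' i2
    (fun z hz => by
      rw [← intervalIntegral_im (sub hpi hz), ← Complex.add_im, ← h.f_eq z hz])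
    (fun z hz => by
      rw [← intervalIntegral_im (sub h.integrable hz), ← Complex.add_im, ← h.p_eq z hz])
    (by simp [hfb]) (by simp [hfc])
  have e1 : ∫ z in b..c, ‖q z‖ ^ 2 = (∫ z in b..c, (q z).re ^ 2) + ∫ z in b..c, (q z).im ^ 2 := by
    rw [← intervalIntegral.integral_add r2 i2]; simp_rw [sq]
  have e2 : ∫ z in b..c, ‖f z‖ ^ 2 = (∫ z in b..c, (f z).re ^ 2) + ∫ z in b..c, (f z).im ^ 2 := by
    rw [← intervalIntegral.integral_add]
    · simp_rw [sq]
    · exact (fr.pow 2).intervalIntegrable_of_Icc hbc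
    · exact (fi.pow 2).intervalIntegrable_of_Icc hbc
  have sqi : ∀ {u v : ℝ → ℝ}, IntervalIntegrable u volume b c →
      IntervalIntegrable (fun z => u z ^ 2) volume b c → ContinuousOn v (Icc b c) →
      IntervalIntegrable (fun z => (u z - Λ * v z) ^ 2) volume b c := by
    intro u v hu hu2 hv
    have e : ∀ z, (u z - Λ * v z) ^ 2 = u z ^ 2 - 2 * Λ * (v z * u z) + Λ ^ 2 * v z ^ 2 :=
      fun z => by ring
    simp_rw [e]
    refine (hu2.sub ((hu.continuousOn_mul ?_).const_mul _)).add
      (((hv.pow 2).intervalIntegrable_of_Icc hbc).const_mul _)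
    rwa [uIcc_of_le hbc]
  have e3 : ∫ z in b..c, ‖q z - Λ * f z‖ ^ 2 = (∫ z in b..c, ((q z).re - Λ * (f z).re) ^ 2) +
      ∫ z in b..c, ((q z).im - Λ * (f z).im) ^ 2 := by
    rw [← intervalIntegral.integral_add (sqi h.integrable.re' r2 fr) (sqi h.integrable.im' i2 fi)]
    simp_rw [sq]
    simp
  rw [e1, e2, e3]
  linarith

/-- A curve deviates from its tangent at `b` by its second derivative. -/
theorem norm_f_sub_sub_le (h : IsH2Curve b c f p q) (hbc : b < c) {x y : ℝ} (hx : x ∈ Icc b c)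
    (hy : y ∈ Icc b c) :
    ‖f x - f y - (x - y) * p b‖ ≤ |x - y| * Real.sqrt ((c - b) * ∫ t in b..c, ‖q t‖ ^ 2) := by
  set K := Real.sqrt ((c - b) * ∫ t in b..c, ‖q t‖ ^ 2) with hK
  have hq : ∀ t ∈ Icc b c, ‖p t - p b‖ ≤ K := fun t ht =>
    (h.norm_p_sub_le ht (left_mem_Icc.2 hbc.le)).trans
      (Real.le_sqrt_of_sq_le (sq_integral_le hbc h.integrable.norm h.sq_integrable))
  have key : ∀ {x y : ℝ}, x ∈ Icc b c → y ∈ Icc b c → x ≤ y →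
      ‖f y - f x - (y - x) * p b‖ ≤ |y - x| * K := by
    intro x y hx hy hxy
    have e : f y - f x - (y - x) * p b = ∫ t in x..y, (p t - p b) := by
      rw [h.f_sub hx.1 hxy hy.2, intervalIntegral.integral_sub
        ((h.intervalIntegrable_p hbc.le).mono_Icc hx.1 hxy hy.2) intervalIntegrable_const,
        intervalIntegral.integral_const, Complex.real_smul]
      push_cast; ring
    rw [e, mul_comm]
    refine intervalIntegral.norm_integral_le_of_norm_le_const fun t ht => ?_
    rw [uIoc_of_le hxy] at ht
    exact hq t ⟨hx.1.trans ht.1.le, ht.2.trans hy.2⟩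
  rcases le_total x y with hxy | hxy
  · have := key hx hy hxy
    have e : f x - f y - (x - y) * p b = -(f y - f x - (y - x) * p b) := by ring
    rw [abs_sub_comm, e, norm_neg]
    exact this
  · exact key hy hx hxy

end IsH2Curve

/-! ### Fourier series in the horizontal variables and Parseval's identity. -/

noncomputable section

/-- The character `exp (2πimx/L)`. -/
def char (L : ℝ) (m : ℤ) (x : ℝ) : ℂ := Complex.exp (2 * Real.pi * Complex.I * m * x / L)

/-- The Fourier coefficient of an `L`-periodic function. -/
def fc (L : ℝ) (m : ℤ) (F : ℝ → ℂ) : ℂ := (L : ℂ)⁻¹ * ∫ x in Ioc 0 L, char L (-m) x * F x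

theorem char_eq_fourier (L : ℝ) (m : ℤ) (x : ℝ) : char L m x = fourier m (x : AddCircle L) := by
  rw [fourier_coe_apply, char]

theorem char_arg (L : ℝ) (m : ℤ) (x : ℝ) :
    2 * (Real.pi : ℂ) * Complex.I * m * x / L = ((2 * Real.pi * m * x / L : ℝ) : ℂ) * Complex.I := by
  push_cast; ring

theorem norm_char (L : ℝ) (m : ℤ) (x : ℝ) : ‖char L m x‖ = 1 := by
  rw [char, char_arg, Complex.norm_exp_ofReal_mul_I]

theorem contDiff_char (L : ℝ) (m : ℤ) : ContDiff ℝ ∞ (char L m) := by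
  have : ContDiff ℝ ∞ fun x : ℝ => 2 * (Real.pi : ℂ) * Complex.I * m * (x : ℂ) / L :=
    (contDiff_const.mul Complex.ofRealCLM.contDiff).div_const _
  exact this.cexp

theorem continuous_char (L : ℝ) (m : ℤ) : Continuous (char L m) := (contDiff_char L m).continuous

theorem char_add (L : ℝ) (m : ℤ) (x : ℝ) : char L m (x + L) = char L m x := by
  rw [char_eq_fourier, char_eq_fourier, AddCircle.coe_add, AddCircle.coe_period, add_zero]

theorem hasDerivAt_char (L : ℝ) (m : ℤ) (x : ℝ) :
    HasDerivAt (char L m) (2 * Real.pi * Complex.I * m / L * char L m x) x := by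
  have h1 : HasDerivAt (fun x : ℝ => 2 * (Real.pi : ℂ) * Complex.I * m * (x : ℂ) / L)
      (2 * (Real.pi : ℂ) * Complex.I * m * 1 / L) x :=
    ((Complex.ofRealCLM.hasDerivAt (x := x)).const_mul _).div_const _
  have := h1.cexp
  rw [mul_one] at this
  have e : 2 * Real.pi * Complex.I * m / L * char L m x =
      Complex.exp (2 * Real.pi * Complex.I * m * x / L) * (2 * Real.pi * Complex.I * m / L) := by
    rw [char]; ring
  rw [e]
  exact this

theorem norm_char_sub_le {L : ℝ} (hL : 0 < L) (m : ℤ) (x y : ℝ) :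
    ‖char L m x - char L m y‖ ≤ 2 * Real.pi * |(m : ℝ)| / L * |x - y| := by
  have := Convex.norm_image_sub_le_of_norm_hasDerivWithin_le (f := char L m)
    (C := 2 * Real.pi * |(m : ℝ)| / L) (s := univ) (x := y) (y := x)
    (fun z _ => (hasDerivAt_char L m z).hasDerivWithinAt) (fun z _ => by
      rw [norm_mul, norm_char, mul_one, norm_div, norm_mul, norm_mul, norm_mul]
      simp [abs_of_pos hL, abs_of_pos Real.pi_pos]) convex_univ trivial trivial
  simpa using this

theorem fc_const_mul (L : ℝ) (m : ℤ) (a : ℂ) (F : ℝ → ℂ) :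
    fc L m (fun x => a * F x) = a * fc L m F := by
  have : ∀ x, char L (-m) x * (a * F x) = a * (char L (-m) x * F x) := fun x => by ring
  simp_rw [fc, this, integral_const_mul]
  ring

theorem fc_eq_fourierCoeffOn {L : ℝ} (hL : 0 < L) (m : ℤ) (F : ℝ → ℂ) :
    fc L m F = fourierCoeffOn hL F m := by
  rw [fourierCoeffOn_eq_integral, fc, sub_zero, intervalIntegral.integral_of_le hL.le,
    Complex.real_smul]
  simp [char_eq_fourier]

theorem hasSum_sq_fc {L : ℝ} (hL : 0 < L) {F : ℝ → ℂ} (hF : MemLp F 2 (volume.restrict (Ioc 0 L))) :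
    HasSum (fun m => ‖fc L m F‖ ^ 2) (L⁻¹ * ∫ x in Ioc 0 L, ‖F x‖ ^ 2) := by
  have := hasSum_sq_fourierCoeffOn hL hF
  simp_rw [← fc_eq_fourierCoeffOn hL] at this
  rwa [sub_zero, intervalIntegral.integral_of_le hL.le, smul_eq_mul] at this

theorem hasSum_fc_mul_char {L : ℝ} (hL : 0 < L) {F : ℝ → ℂ} (hF : Continuous F)
    (hper : ∀ x, F (x + L) = F x) (hs : Summable fun m => fc L m F) (x : ℝ) :
    HasSum (fun m => fc L m F * char L m x) (F x) := by
  have : Fact (0 < L) := ⟨hL⟩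
  have hp : Function.Periodic F L := hper
  let G : C(AddCircle L, ℂ) := ⟨hp.lift, continuous_coinduced_dom.2 (by exact hF)⟩
  have hG : ∀ m, fourierCoeff G m = fc L m F := by
    intro m
    rw [fourierCoeff_eq_intervalIntegral _ _ 0, zero_add, intervalIntegral.integral_of_le hL.le, fc,
      Complex.real_smul]
    simp only [char_eq_fourier, smul_eq_mul]
    push_cast
    rw [one_div]
    rfl
  have := has_pointwise_sum_fourier_series_of_summable (f := G) (by
    convert hs using 1; exact funext hG) (x : AddCircle L)
  simp_rw [hG, smul_eq_mul, ← char_eq_fourier] at this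
  exact this

section Parameter

variable {Y : Type*} [MeasurableSpace Y] {ν : Measure Y}

theorem integrable_char_mul {L : ℝ} {m : ℤ} {G : ℝ × Y → ℂ}
    (hG : Integrable G ((volume.restrict (Ioc 0 L)).prod ν)) :
    Integrable (fun P => char L m P.1 * G P) ((volume.restrict (Ioc 0 L)).prod ν) := by
  refine hG.bdd_mul (c := 1) ?_ (Filter.Eventually.of_forall fun P => (norm_char _ _ _).le)
  exact ((continuous_char L m).measurable.comp measurable_fst).aestronglyMeasurable

variable [SFinite ν]

theorem integral_fc {L : ℝ} {m : ℤ} {G : ℝ × Y → ℂ}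
    (hG : Integrable G ((volume.restrict (Ioc 0 L)).prod ν)) :
    ∫ y, fc L m (fun x => G (x, y)) ∂ν =
      (L : ℂ)⁻¹ * ∫ P, char L (-m) P.1 * G P ∂((volume.restrict (Ioc 0 L)).prod ν) := by
  simp_rw [fc]
  rw [integral_const_mul, integral_prod_symm _ (integrable_char_mul hG)]

theorem integrable_fc {L : ℝ} {m : ℤ} {G : ℝ × Y → ℂ}
    (hG : Integrable G ((volume.restrict (Ioc 0 L)).prod ν)) :
    Integrable (fun y => fc L m (fun x => G (x, y))) ν :=
  (integrable_char_mul hG).integral_prod_right.const_mul _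

/-- Parseval's identity for a Fourier series with coefficients depending on a parameter. -/
theorem parseval_parameter {L : ℝ} (hL : 0 < L) {G : ℝ × Y → ℂ}
    (hG : MemLp G 2 ((volume.restrict (Ioc 0 L)).prod ν)) :
    (∀ m, MemLp (fun y => fc L m (fun x => G (x, y))) 2 ν) ∧
      HasSum (fun m => ∫ y, ‖fc L m (fun x => G (x, y))‖ ^ 2 ∂ν)
        (L⁻¹ * ∫ P, ‖G P‖ ^ 2 ∂((volume.restrict (Ioc 0 L)).prod ν)) := by
  have hG2 : Integrable (fun P => ‖G P‖ ^ 2) ((volume.restrict (Ioc 0 L)).prod ν) :=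
    hG.integrable_norm_pow (by norm_num)
  have hmeas : ∀ m, AEStronglyMeasurable (fun y => fc L m (fun x => G (x, y))) ν := by
    intro m
    have : AEStronglyMeasurable (fun P : ℝ × Y => char L (-m) P.1 * G P)
        ((volume.restrict (Ioc 0 L)).prod ν) :=
      ((continuous_char L _).measurable.comp measurable_fst).aestronglyMeasurable.mul hG.1
    exact (this.prod_swap.integral_prod_right').const_mul _
  have hae : ∀ᵐ y ∂ν, HasSum (fun m => ‖fc L m (fun x => G (x, y))‖ ^ 2)
      (L⁻¹ * ∫ x in Ioc 0 L, ‖G (x, y)‖ ^ 2) := by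
    filter_upwards [hG2.prod_left_ae, hG.1.prodMk_right] with y h1 h2
    exact hasSum_sq_fc hL ((memLp_two_iff_integrable_sq_norm h2).2 h1)
  have hTint : Integrable (fun y => L⁻¹ * ∫ x in Ioc 0 L, ‖G (x, y)‖ ^ 2) ν :=
    hG2.integral_prod_right.const_mul _
  have hTval : ∫ y, (L⁻¹ * ∫ x in Ioc 0 L, ‖G (x, y)‖ ^ 2) ∂ν =
      L⁻¹ * ∫ P, ‖G P‖ ^ 2 ∂((volume.restrict (Ioc 0 L)).prod ν) := by
    rw [integral_const_mul, integral_prod_symm _ hG2]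
  have hFint : ∀ m, Integrable (fun y => ‖fc L m (fun x => G (x, y))‖ ^ 2) ν := by
    intro m
    refine hTint.mono' ((hmeas m).norm.pow 2) ?_
    filter_upwards [hae] with y hy
    rw [Real.norm_of_nonneg (sq_nonneg _), ← hy.tsum_eq]
    exact hy.summable.le_tsum m fun _ _ => sq_nonneg _
  refine ⟨fun m => (memLp_two_iff_integrable_sq_norm (hmeas m)).2 (hFint m), ?_⟩
  -- Finite partial sums are bounded by Bessel's inequality at almost every `y`; this permits the
  -- exchange of the sum over modes with the integral in `y`.
  have hsum : Summable fun m => ∫ y, ‖‖fc L m (fun x => G (x, y))‖ ^ 2‖ ∂ν := by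
    refine summable_of_sum_le (c := ∫ y, (L⁻¹ * ∫ x in Ioc 0 L, ‖G (x, y)‖ ^ 2) ∂ν)
      (fun m => integral_nonneg fun _ => norm_nonneg _) fun s => ?_
    rw [← integral_finsetSum _ fun m _ => (hFint m).norm]
    refine integral_mono_ae (integrable_finsetSum _ fun m _ => (hFint m).norm) hTint ?_
    filter_upwards [hae] with y hy
    simp only [norm_pow, norm_norm]
    rw [← hy.tsum_eq]
    exact hy.summable.sum_le_tsum s fun _ _ => sq_nonneg _
  have := hasSum_integral_of_summable_integral_norm hFint hsum
  rw [← hTval]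
  have e : ∫ y, (L⁻¹ * ∫ x in Ioc 0 L, ‖G (x, y)‖ ^ 2) ∂ν =
      ∫ y, ∑' m, ‖fc L m (fun x => G (x, y))‖ ^ 2 ∂ν := by
    refine integral_congr_ae ?_
    filter_upwards [hae] with y hy
    exact hy.tsum_eq.symm
  rwa [e]

end Parameter

/-- The horizontal Fourier coefficients of a function of `(x, y, z)`. -/
def coef (L M : ℝ) (k : ℤ × ℤ) (G : Pt → ℂ) (z : ℝ) : ℂ :=
  fc M k.2 (fun y => fc L k.1 (fun x => G (x, y, z)))

theorem restrict_cell (L M b c : ℝ) : (volume : Measure Pt).restrict (cell L M b c) =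
    (volume.restrict (Ioc 0 L)).prod
      ((volume.restrict (Ioc 0 M)).prod (volume.restrict (Ioo b c))) := by
  rw [Measure.prod_restrict, Measure.prod_restrict]; rfl

/-- Parseval's identity for the horizontal Fourier coefficients. -/
theorem parseval_cell {L M b c : ℝ} (hL : 0 < L) (hM : 0 < M) {G : Pt → ℂ}
    (hG : MemLp G 2 (volume.restrict (cell L M b c))) :
    (∀ k, MemLp (coef L M k G) 2 (volume.restrict (Ioo b c))) ∧
      HasSum (fun k => ∫ z in Ioo b c, ‖coef L M k G z‖ ^ 2)
        ((L * M)⁻¹ * ∫ P in cell L M b c, ‖G P‖ ^ 2) := by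
  rw [restrict_cell] at hG ⊢
  obtain ⟨h1, h2⟩ := parseval_parameter hL hG
  have h3 := fun m => (parseval_parameter hM (h1 m)).1
  have h4 := fun m => (parseval_parameter hM (h1 m)).2
  refine ⟨fun k => h3 k.1 k.2, ?_⟩
  have hs : Summable (fun k : ℤ × ℤ => ∫ z in Ioo b c, ‖coef L M k G z‖ ^ 2) := by
    rw [summable_prod_of_nonneg (fun k => integral_nonneg fun _ => sq_nonneg _)]
    refine ⟨fun m => (h4 m).summable, ?_⟩
    have : Summable fun m => M⁻¹ * ∫ P, ‖fc L m fun x => G (x, P)‖ ^ 2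
        ∂((volume.restrict (Ioc 0 M)).prod (volume.restrict (Ioo b c))) := h2.summable.mul_left _
    exact this.congr fun m => (h4 m).tsum_eq.symm
  have e := (hs.hasSum.prod_fiberwise h4).unique (h2.mul_left M⁻¹)
  rw [mul_inv, mul_comm L⁻¹, mul_assoc, ← e]
  exact hs.hasSum

/-- Fubini's theorem. Identities between integrals over the period cell become identities for the
coefficients tested in `z` alone, so the weak derivatives of a coefficient can be computed. -/
theorem integral_coef_mul {L M b c : ℝ} {k : ℤ × ℤ} {G : Pt → ℂ} {ψ : ℝ → ℂ}
    (hψ : Continuous ψ) (hG : IntegrableOn G (cell L M b c)) :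
    ∫ z in Ioo b c, coef L M k G z * ψ z = ((L : ℂ) * M)⁻¹ * ∫ P in cell L M b c,
      G P * (char L (-k.1) P.1 * char M (-k.2) P.2.1 * ψ P.2.2) := by
  obtain ⟨C, hC⟩ := isCompact_Icc.exists_bound_of_continuousOn (s := Icc b c) hψ.continuousOn
  rw [IntegrableOn, restrict_cell] at hG
  rw [restrict_cell]
  have hGψ : Integrable (fun P : Pt => G P * ψ P.2.2) ((volume.restrict (Ioc 0 L)).prod
      ((volume.restrict (Ioc 0 M)).prod (volume.restrict (Ioo b c)))) := by
    refine hG.mul_bdd (c := C) (hψ.comp (by fun_prop)).aestronglyMeasurable ?_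
    rw [← restrict_cell]
    refine ae_restrict_of_forall_mem ?_ fun P hP => hC _ ⟨hP.2.2.1.le, hP.2.2.2.le⟩
    exact measurableSet_Ioc.prod (measurableSet_Ioc.prod measurableSet_Ioo)
  have hK := integrable_fc (m := k.1) hGψ
  have hGc : Integrable (fun P : Pt => char M (-k.2) P.2.1 * (G P * ψ P.2.2))
      ((volume.restrict (Ioc 0 L)).prod
      ((volume.restrict (Ioc 0 M)).prod (volume.restrict (Ioo b c)))) :=
    hGψ.bdd_mul (c := 1) ((continuous_char M _).comp (by fun_prop)).aestronglyMeasurable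
      (Filter.Eventually.of_forall fun P => (norm_char _ _ _).le)
  have e1 : ∀ z, coef L M k G z * ψ z =
      fc M k.2 fun y => fc L k.1 fun x => G (x, y, z) * ψ z := fun z => by
    simp_rw [mul_comm _ (ψ z), fc_const_mul]; rfl
  have e2 : ∀ P : ℝ × ℝ, char M (-k.2) P.1 * (fc L k.1 fun x => G (x, P) * ψ P.2) =
      fc L k.1 fun x => char M (-k.2) P.1 * (G (x, P) * ψ P.2) := fun P => by
    rw [fc_const_mul]
  simp_rw [e1]
  rw [integral_fc (G := fun P : ℝ × ℝ => fc L k.1 fun x => G (x, P) * ψ P.2) hK]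
  simp_rw [e2]
  rw [integral_fc (G := fun P : Pt => char M (-k.2) P.2.1 * (G P * ψ P.2.2)) hGc, mul_inv,
    mul_assoc]
  have e3 : ∀ P : Pt, char L (-k.1) P.1 * (char M (-k.2) P.2.1 * (G P * ψ P.2.2)) =
      G P * (char L (-k.1) P.1 * char M (-k.2) P.2.1 * ψ P.2.2) := fun P => by ring
  simp_rw [e3]
  exact mul_left_comm _ _ _

theorem coef_congr {L M : ℝ} {k : ℤ × ℤ} {G H : Pt → ℂ} {z : ℝ} (h : ∀ x y, G (x, y, z) = H (x, y, z)) :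
    coef L M k G z = coef L M k H z := by
  simp only [coef, h]

theorem continuous_fc {Y : Type*} [TopologicalSpace Y] [FirstCountableTopology Y]
    {L : ℝ} (hL : 0 < L) {m : ℤ} {G : ℝ × Y → ℂ} (hG : Continuous G) :
    Continuous fun y => fc L m (fun x => G (x, y)) := by
  simp_rw [fc, ← intervalIntegral.integral_of_le hL.le]
  refine continuous_const.mul ?_
  refine intervalIntegral.continuous_parametric_intervalIntegral_of_continuous' ?_ _ _
  exact ((continuous_char L _).comp continuous_snd).mul (hG.comp continuous_swap)

theorem continuous_coef {L M : ℝ} (hL : 0 < L) (hM : 0 < M) {k : ℤ × ℤ} {G : Pt → ℂ}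
    (hG : Continuous G) : Continuous (coef L M k G) :=
  continuous_fc hM (continuous_fc hL hG)

/-- Pointwise convergence of the horizontal Fourier series. -/
theorem hasSum_coef_mul_char {L M : ℝ} (hL : 0 < L) (hM : 0 < M) {G : Pt → ℂ} (hG : Continuous G)
    (hx : ∀ x y z, G (x + L, y, z) = G (x, y, z)) (hy : ∀ x y z, G (x, y + M, z) = G (x, y, z))
    {z : ℝ} (hs : Summable fun k => ‖coef L M k G z‖) (x y : ℝ) :
    HasSum (fun k => coef L M k G z * (char L k.1 x * char M k.2 y)) (G (x, y, z)) := by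
  have hs1 := (summable_prod_of_nonneg (f := fun k : ℤ × ℤ => ‖coef L M k G z‖)
    (fun k => norm_nonneg _)).1 hs
  have h1 : ∀ m, HasSum (fun n => coef L M (m, n) G z * char M n y)
      (fc L m fun x => G (x, y, z)) := fun m => by
    refine hasSum_fc_mul_char hM (F := fun y => fc L m fun x => G (x, y, z)) ?_ ?_
      (hs1.1 m).of_norm y
    · exact (continuous_fc hL hG).comp (Continuous.prodMk continuous_id continuous_const)
    · intro y; simp only [hy]
  have h2 : Summable fun m => fc L m fun x => G (x, y, z) := by
    refine Summable.of_norm_bounded hs1.2 fun m => ?_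
    rw [← (h1 m).tsum_eq]
    refine (norm_tsum_le_tsum_norm ?_).trans (le_of_eq ?_)
    · simpa only [norm_mul, norm_char, mul_one] using hs1.1 m
    · simp only [norm_mul, norm_char, mul_one]
  have h3 := hasSum_fc_mul_char hL (F := fun x => G (x, y, z))
    (hG.comp (by fun_prop)) (fun x => hx x y z) h2 x
  have h4 : Summable fun k : ℤ × ℤ => coef L M k G z * (char L k.1 x * char M k.2 y) := by
    refine Summable.of_norm ?_
    simpa only [norm_mul, norm_char, mul_one] using hs
  have h5 : ∀ m, HasSum (fun n => coef L M (m, n) G z * (char L m x * char M n y))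
      ((fc L m fun x => G (x, y, z)) * char L m x) := fun m => by
    have e : (fun n => coef L M (m, n) G z * (char L m x * char M n y)) =
        fun n => coef L M (m, n) G z * char M n y * char L m x := funext fun n => by ring
    rw [e]
    exact (h1 m).mul_right (char L m x)
  have := (h4.hasSum.prod_fiberwise h5).unique h3
  rw [← this]
  exact h4.hasSum

/-! ### Calculus of weak partial derivatives on open sets. -/

instance isAddHaarMeasure_volume_pt : (volume : Measure Pt).IsAddHaarMeasure :=
  inferInstanceAs ((volume : Measure ℝ).prod (volume : Measure (ℝ × ℝ))).IsAddHaarMeasure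

theorem isOpen_slab (b c : ℝ) : IsOpen (slab b c) :=
  isOpen_Ioo.preimage (continuous_snd.comp continuous_snd)

theorem measurableSet_slab (b c : ℝ) : MeasurableSet (slab b c) := (isOpen_slab b c).measurableSet

theorem measurableSet_cell (L M b c : ℝ) : MeasurableSet (cell L M b c) :=
  measurableSet_Ioc.prod (measurableSet_Ioc.prod measurableSet_Ioo)

theorem cell_subset_slab (L M b c : ℝ) : cell L M b c ⊆ slab b c := fun _ hP => hP.2.2

theorem slab_mono {b b' c c' : ℝ} (h1 : b ≤ b') (h2 : c' ≤ c) : slab b' c' ⊆ slab b c :=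
  fun _ hP => ⟨h1.trans_lt hP.1, hP.2.trans_le h2⟩

theorem restrict_slab (b c : ℝ) : (volume : Measure Pt).restrict (slab b c) =
    volume.prod (volume.prod (volume.restrict (Ioo b c))) := by
  have h : slab b c = univ ×ˢ (univ ×ˢ Ioo b c) := by ext P; simp [slab]
  rw [h]
  calc (volume : Measure Pt).restrict (univ ×ˢ (univ ×ˢ Ioo b c))
      = ((volume : Measure ℝ).restrict univ).prod (((volume : Measure ℝ).restrict univ).prod
          ((volume : Measure ℝ).restrict (Ioo b c))) := by
        rw [Measure.prod_restrict, Measure.prod_restrict]; rfl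
    _ = _ := by simp only [Measure.restrict_univ]

theorem setIntegral_eq_of_tsupport_subset {U : Set Pt} {E : Type*} [NormedAddCommGroup E]
    [NormedSpace ℝ E] {F : Pt → E} (hF : Function.support F ⊆ U) :
    ∫ P in U, F P = ∫ P, F P :=
  setIntegral_eq_integral_of_forall_compl_eq_zero fun P hP => by
    by_contra h; exact hP (hF h)

theorem support_mul_subset_of_tsupport {U : Set Pt} {R : Type*} [MulZeroClass R]
    {g φ : Pt → R} (h : tsupport φ ⊆ U) : (Function.support fun P => g P * φ P) ⊆ U := fun P hP =>
  h (subset_tsupport _ fun h0 => hP (by simp [h0]))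

theorem integrable_mul_of_tsupport_subset {R : Type*} [NormedRing R]
    {U : Set Pt} {g φ : Pt → R} (hg : LocallyIntegrableOn g U) (hφ : Continuous φ)
    (hc : HasCompactSupport φ) (hs : tsupport φ ⊆ U) :
    Integrable (fun P => g P * φ P) (volume.restrict U) := by
  have h1 : IntegrableOn g (tsupport φ) := hg.integrableOn_compact_subset hs hc
  have h2 : IntegrableOn (fun P => g P * φ P) (tsupport φ) := h1.mul_continuousOn hφ.continuousOn hc
  have h3 : Integrable (fun P => g P * φ P) :=
    (integrableOn_iff_integrable_of_support_subset (support_mul_subset_of_tsupport subset_rfl)).1 h2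
  exact h3.restrict

theorem hasCompactSupport_fderiv_apply {E : Type*} [NormedAddCommGroup E] [NormedSpace ℝ E]
    {φ : Pt → E} (hc : HasCompactSupport φ) (v : Pt) :
    HasCompactSupport (fun P => fderiv ℝ φ P v) :=
  hc.of_isClosed_subset (isClosed_tsupport _) (tsupport_fderiv_apply_subset ℝ v)

theorem continuous_fderiv_apply' {E : Type*} [NormedAddCommGroup E] [NormedSpace ℝ E]
    {φ : Pt → E} (hφ : ContDiff ℝ ∞ φ) (v : Pt) : Continuous (fun P => fderiv ℝ φ P v) :=
  (hφ.continuous_fderiv (by simp)).clm_apply continuous_const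

namespace NoisySmoothing.HasWeakPartial

variable {U V : Set Pt} {i : Fin 3} {w w' g g' : Pt → ℝ}

/-- The fundamental lemma of the calculus of variations. It makes the arbitrary choice in
`weakPartial` harmless: any explicit weak derivative may replace the chosen one up to a null set. -/
theorem ae_unique (hU : IsOpen U) (h : HasWeakPartial U i w g) (h' : HasWeakPartial U i w g') :
    g =ᵐ[volume.restrict U] g' := by
  have := hU.ae_eq_zero_of_integral_contDiff_smul_eq_zero (μ := volume) (h.2.1.sub h'.2.1) (by
    intro φ h1 h2 h3
    have e1 := h.2.2 φ h1 h2 h3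
    have e2 := h'.2.2 φ h1 h2 h3
    have i1 := integrable_mul_of_tsupport_subset h.2.1 h1.continuous h2 h3
    have i2 := integrable_mul_of_tsupport_subset h'.2.1 h1.continuous h2 h3
    have : ∀ P, φ P • (g - g') P = g P * φ P - g' P * φ P := fun P => by
      simp only [smul_eq_mul, Pi.sub_apply]; ring
    simp_rw [this]
    rw [← setIntegral_eq_of_tsupport_subset (U := U), integral_sub i1 i2]
    · linarith
    · intro P hP
      refine h3 (subset_tsupport _ fun h0 => hP (by simp [h0])))
  rw [Filter.EventuallyEq, ae_restrict_iff' hU.measurableSet]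
  filter_upwards [this] with P hP hPU
  exact sub_eq_zero.1 (hP hPU)

theorem congr (hU : IsOpen U) (h : HasWeakPartial U i w g) (hw : w =ᵐ[volume.restrict U] w')
    (hg : g =ᵐ[volume.restrict U] g') : HasWeakPartial U i w' g' := by
  have key : ∀ {a a' : Pt → ℝ}, a =ᵐ[volume.restrict U] a' → LocallyIntegrableOn a U →
      LocallyIntegrableOn a' U := by
    intro a a' ha hl
    rw [locallyIntegrableOn_iff hU.isLocallyClosed] at hl ⊢
    intro K hKU hK
    exact (hl K hKU hK).congr (ae_mono (Measure.restrict_mono hKU le_rfl) ha)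
  refine ⟨key hw h.1, key hg h.2.1, fun φ h1 h2 h3 => ?_⟩
  have e := h.2.2 φ h1 h2 h3
  have e1 : ∫ P in U, w P * fderiv ℝ φ P (dir i) = ∫ P in U, w' P * fderiv ℝ φ P (dir i) := by
    refine integral_congr_ae ?_
    filter_upwards [hw] with P hP
    rw [hP]
  have e2 : ∫ P in U, g P * φ P = ∫ P in U, g' P * φ P := by
    refine integral_congr_ae ?_
    filter_upwards [hg] with P hP
    rw [hP]
  rw [← e1, ← e2, e]

theorem mono (h : HasWeakPartial U i w g) (hVU : V ⊆ U) : HasWeakPartial V i w g := by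
  refine ⟨h.1.mono_set hVU, h.2.1.mono_set hVU, fun φ h1 h2 h3 => ?_⟩
  have e := h.2.2 φ h1 h2 (h3.trans hVU)
  rw [setIntegral_eq_of_tsupport_subset (support_mul_subset_of_tsupport (h3.trans hVU)),
    setIntegral_eq_of_tsupport_subset (support_mul_subset_of_tsupport
      ((tsupport_fderiv_apply_subset ℝ _).trans (h3.trans hVU)))] at e
  rw [setIntegral_eq_of_tsupport_subset (support_mul_subset_of_tsupport h3),
    setIntegral_eq_of_tsupport_subset (support_mul_subset_of_tsupport
      ((tsupport_fderiv_apply_subset ℝ _).trans h3)), e]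

theorem sub (h : HasWeakPartial U i w g) (h' : HasWeakPartial U i w' g') :
    HasWeakPartial U i (fun P => w P - w' P) (fun P => g P - g' P) := by
  refine ⟨h.1.sub h'.1, h.2.1.sub h'.2.1, fun φ h1 h2 h3 => ?_⟩
  have hc := hasCompactSupport_fderiv_apply h2 (dir i)
  have hs := (tsupport_fderiv_apply_subset ℝ (f := φ) (dir i)).trans h3
  have hd := continuous_fderiv_apply' h1 (dir i)
  simp_rw [sub_mul]
  rw [integral_sub (integrable_mul_of_tsupport_subset h.1 hd hc hs)
    (integrable_mul_of_tsupport_subset h'.1 hd hc hs),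
    integral_sub (integrable_mul_of_tsupport_subset h.2.1 h1.continuous h2 h3)
    (integrable_mul_of_tsupport_subset h'.2.1 h1.continuous h2 h3), h.2.2 φ h1 h2 h3,
    h'.2.2 φ h1 h2 h3]
  ring

theorem weakPartial_spec (h : HasWeakPartial U i w g) :
    HasWeakPartial U i w (weakPartial U i w) := by
  have hex : ∃ g, HasWeakPartial U i w g := ⟨g, h⟩
  rw [weakPartial, dif_pos hex]
  exact hex.choose_spec

theorem weakPartial_ae_eq (hU : IsOpen U) (h : HasWeakPartial U i w g) :
    weakPartial U i w =ᵐ[volume.restrict U] g :=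
  h.weakPartial_spec.ae_unique hU h

/-- The defining identity for complex-valued test functions. -/
theorem integral_complex (h : HasWeakPartial U i w g) {φ : Pt → ℂ} (h1 : ContDiff ℝ ∞ φ)
    (h2 : HasCompactSupport φ) (h3 : tsupport φ ⊆ U) :
    ∫ P in U, (w P : ℂ) * fderiv ℝ φ P (dir i) = -∫ P in U, (g P : ℂ) * φ P := by
  have cast : ∀ {a : Pt → ℝ}, LocallyIntegrableOn a U →
      LocallyIntegrableOn (fun P => (a P : ℂ)) U := fun ha P hP => by
    obtain ⟨s, hs, hi⟩ := ha P hP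
    exact ⟨s, hs, hi.ofReal⟩
  have hc := hasCompactSupport_fderiv_apply h2 (dir i)
  have hs := (tsupport_fderiv_apply_subset ℝ (f := φ) (dir i)).trans h3
  have hd := continuous_fderiv_apply' h1 (dir i)
  have i1 := integrable_mul_of_tsupport_subset (cast h.1) hd hc hs
  have i2 := integrable_mul_of_tsupport_subset (cast h.2.1) h1.continuous h2 h3
  have key : ∀ ℓ : ℂ →L[ℝ] ℝ, (∀ (r : ℝ) (z : ℂ), ℓ ((r : ℂ) * z) = r * ℓ z) →
      ℓ (∫ P in U, (w P : ℂ) * fderiv ℝ φ P (dir i)) = ℓ (-∫ P in U, (g P : ℂ) * φ P) := by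
    intro ℓ hℓ
    rw [map_neg, ← ℓ.integral_comp_comm i1, ← ℓ.integral_comp_comm i2]
    simp_rw [hℓ]
    have e := h.2.2 (fun P => ℓ (φ P)) (ℓ.contDiff.comp h1) (h2.comp_left (map_zero ℓ))
      ((tsupport_comp_subset (map_zero ℓ) φ).trans h3)
    rw [← e]
    congr 1
    funext P
    have : HasFDerivAt (fun P => ℓ (φ P)) (ℓ.comp (fderiv ℝ φ P)) P :=
      ℓ.hasFDerivAt.comp P ((h1.differentiable (by simp)) P).hasFDerivAt
    rw [this.fderiv]; rfl
  apply Complex.ext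
  · exact key Complex.reCLM fun r z => by simp
  · exact key Complex.imCLM fun r z => by simp

/-- The shift is moved onto the test function, which stays supported in the slab because the shift
is horizontal. This is how weak derivatives inherit periodicity. -/
theorem translate {b c : ℝ} (h : HasWeakPartial (slab b c) i w g) {v : Pt} (hv : v.2.2 = 0) :
    HasWeakPartial (slab b c) i (fun P => w (P + v)) (fun P => g (P + v)) := by
  have hmem : ∀ P, P + v ∈ slab b c ↔ P ∈ slab b c := fun P => by simp [slab, hv]
  have key : ∀ {a : Pt → ℝ}, LocallyIntegrableOn a (slab b c) →
      LocallyIntegrableOn (fun P => a (P + v)) (slab b c) := by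
    intro a hl
    rw [locallyIntegrableOn_iff (isOpen_slab b c).isLocallyClosed] at hl ⊢
    intro K hKU hK
    have := hl ((· + v) '' K) (by
      rintro _ ⟨P, hP, rfl⟩; exact (hmem P).2 (hKU hP)) (hK.image (by fun_prop))
    have e := (measurePreserving_add_right (volume : Measure Pt) v).integrableOn_comp_preimage
      (MeasurableEquiv.addRight v).measurableEmbedding (f := a) (s := (· + v) '' K)
    rw [preimage_image_eq _ (add_left_injective v)] at e
    exact e.2 this
  refine ⟨key h.1, key h.2.1, fun φ h1 h2 h3 => ?_⟩
  have hsub : ContDiff ℝ ∞ fun P : Pt => P - v := contDiff_id.sub contDiff_const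
  set φ' : Pt → ℝ := fun P => φ (P - v) with hφ'
  have hφ2 : HasCompactSupport φ' := h2.comp_homeomorph (Homeomorph.subRight v)
  have hφ3 : tsupport φ' ⊆ slab b c := by
    intro P hP
    have : P - v ∈ tsupport φ := by
      have := tsupport_comp_subset_preimage φ (f := fun P : Pt => P - v) (by fun_prop) hP
      exact this
    have := (hmem _).2 (h3 this)
    rwa [sub_add_cancel] at this
  have e := h.2.2 φ' (h1.comp hsub) hφ2 hφ3
  have hfd : ∀ P, fderiv ℝ φ' P = fderiv ℝ φ (P - v) := fun P => by
    exact fderiv_comp_sub v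
  rw [setIntegral_eq_of_tsupport_subset (support_mul_subset_of_tsupport hφ3),
    setIntegral_eq_of_tsupport_subset (support_mul_subset_of_tsupport
      ((tsupport_fderiv_apply_subset ℝ _).trans hφ3))] at e
  rw [setIntegral_eq_of_tsupport_subset (support_mul_subset_of_tsupport h3),
    setIntegral_eq_of_tsupport_subset (support_mul_subset_of_tsupport
      ((tsupport_fderiv_apply_subset ℝ _).trans h3))]
  rw [← integral_add_right_eq_self _ v, ← integral_add_right_eq_self (fun P => g P * φ' P) v] at e
  simp_rw [hfd] at e
  simpa only [hφ', add_sub_cancel_right] using e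

end NoisySmoothing.HasWeakPartial

/-! ### Periodization and unfolding of integrals from the slab to a period cell. -/

/-- The function that is periodic with periods `L`, `M` and agrees with `w` on
`(0, L] × (0, M] × ℝ`. -/
def periodize {L M : ℝ} (hL : 0 < L) (hM : 0 < M) (w : Pt → ℝ) : Pt → ℝ := fun P =>
  w (toIocMod hL 0 P.1, toIocMod hM 0 P.2.1, P.2.2)

section Periodize

variable {L M b c : ℝ} (hL : 0 < L) (hM : 0 < M) {w g : Pt → ℝ} {i : Fin 3}

theorem periodize_add_x (x y z : ℝ) :
    periodize hL hM w (x + L, y, z) = periodize hL hM w (x, y, z) := by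
  simp [periodize]

theorem periodize_add_y (x y z : ℝ) :
    periodize hL hM w (x, y + M, z) = periodize hL hM w (x, y, z) := by
  simp [periodize]

theorem periodize_eq_on_cell {P : Pt} (hP : P ∈ cell L M b c) : periodize hL hM w P = w P := by
  have h1 : toIocMod hL 0 P.1 = P.1 := (toIocMod_eq_self hL).2 (by simpa using hP.1)
  have h2 : toIocMod hM 0 P.2.1 = P.2.1 := (toIocMod_eq_self hM).2 (by simpa using hP.2.1)
  rw [periodize, h1, h2]

/-- `w` is invariant, up to null sets, under the translations by periods. -/
def AEPeriodic (L M b c : ℝ) (w : Pt → ℝ) : Prop :=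
  ∀ m n : ℤ, (fun P : Pt => w (P + (m * L, n * M, 0))) =ᵐ[volume.restrict (slab b c)] w

/-- The shift bringing a point into the cell depends on the point, but there are only countably many
shifts, so one null set serves all of them. -/
theorem AEPeriodic.periodize_ae_eq (h : AEPeriodic L M b c w) :
    periodize hL hM w =ᵐ[volume.restrict (slab b c)] w := by
  have : ∀ᵐ P ∂(volume.restrict (slab b c)), ∀ m n : ℤ, w (P + (m * L, n * M, 0)) = w P := by
    rw [ae_all_iff]; intro m
    rw [ae_all_iff]; intro n
    exact h m n
  filter_upwards [this] with P hP
  rw [periodize, ← hP (-toIocDiv hL 0 P.1) (-toIocDiv hM 0 P.2.1)]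
  congr 1
  have key : ∀ {p : ℝ} (hp : 0 < p) (x : ℝ),
      toIocMod hp 0 x = x + ((-toIocDiv hp 0 x : ℤ) : ℝ) * p := fun hp x => by
    rw [toIocMod, zsmul_eq_mul]; push_cast; ring
  rw [key, key]
  simp [Prod.ext_iff]

/-- A weak derivative is chosen only up to a null set and need not be periodic. Its translate is a
weak derivative of the translated function, which agrees almost everywhere with the original one, so
uniqueness applies. -/
theorem AEPeriodic.weakPartial (hw : AEPeriodic L M b c w) (h : HasWeakPartial (slab b c) i w g) :
    AEPeriodic L M b c g := fun m n =>
  ((h.translate (v := (m * L, n * M, 0)) rfl).congr (isOpen_slab b c) (hw m n)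
    Filter.EventuallyEq.rfl).ae_unique (isOpen_slab b c) h

theorem AEPeriodic.of_periodic {w : Pt → ℝ}
    (hx : ∀ x y z, z ∈ Ioo b c → w (x + L, y, z) = w (x, y, z))
    (hy : ∀ x y z, z ∈ Ioo b c → w (x, y + M, z) = w (x, y, z)) : AEPeriodic L M b c w := by
  intro m n
  refine ae_restrict_of_forall_mem (measurableSet_slab b c) fun P hP => ?_
  obtain ⟨x, y, z⟩ := P
  have hz : z ∈ Ioo b c := hP
  have h1 : ∀ y, Function.Periodic (fun x => w (x, y, z)) L := fun y x => hx x y z hz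
  have h2 : Function.Periodic (fun y => w (x, y, z)) M := fun y => hy x y z hz
  have e1 := (h1 (y + n * M)).int_mul m x
  have e2 := h2.int_mul n y
  simp only [Prod.mk_add_mk, add_zero]
  exact e1.trans e2

end Periodize

/-- `X` is supported on two periods `[0, 2L]`, and the sum of its translates by `ℤL` is `X'`. -/
structure Unfolds (L : ℝ) (X X' : ℝ → ℂ) : Prop where
  continuous : Continuous X
  continuous' : Continuous X'
  support : ∀ x, x ∉ Icc 0 (2 * L) → X x = 0
  sum_eq : ∀ x ∈ Ioo 0 L, X x + X (x + L) = X' x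

/-- The integral over `[L, 2L]` is shifted back to `[0, L]`; since `H` is periodic, the two copies
of `X` add up to `X'`. -/
theorem Unfolds.integral_mul {L : ℝ} (hL : 0 < L) {X X' H : ℝ → ℂ} (hX : Unfolds L X X')
    (hH : ∀ x, H (x + L) = H x) (hi : Integrable fun x => H x * X x) :
    ∫ x, H x * X x = ∫ x in Ioc 0 L, H x * X' x := by
  have e1 : ∫ x, H x * X x = ∫ x in 0..(2 * L), H x * X x := by
    rw [intervalIntegral.integral_of_le (by linarith), ← integral_Icc_eq_integral_Ioc]
    exact (setIntegral_eq_integral_of_forall_compl_eq_zero fun x hx => by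
      rw [hX.support x hx, mul_zero]).symm
  have e2 : ∫ x in L..(2 * L), H x * X x = ∫ x in 0..L, H x * X (x + L) := by
    have := intervalIntegral.integral_comp_add_right (a := 0) (b := L) (fun x => H x * X x) L
    rw [zero_add, ← two_mul] at this
    rw [← this]
    simp_rw [hH]
  have hi2 : Integrable fun x => H x * X (x + L) := by
    have := hi.comp_add_right L
    simpa only [hH] using this
  rw [e1, ← intervalIntegral.integral_add_adjacent_intervals (b := L) hi.intervalIntegrable
    hi.intervalIntegrable, e2, ← intervalIntegral.integral_add hi.intervalIntegrable
    hi2.intervalIntegrable, intervalIntegral.integral_of_le hL.le, integral_Ioc_eq_integral_Ioo,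
    integral_Ioc_eq_integral_Ioo]
  refine setIntegral_congr_fun measurableSet_Ioo fun x hx => ?_
  rw [← mul_add, hX.sum_eq x hx]

theorem Unfolds.integral_prod_mul {Y : Type*} [MeasurableSpace Y] {ν : Measure Y} [SFinite ν]
    {L : ℝ} (hL : 0 < L) {X X' : ℝ → ℂ} (hX : Unfolds L X X') {G : ℝ × Y → ℂ}
    (hG : ∀ x y, G (x + L, y) = G (x, y))
    (h1 : Integrable (fun P => G P * X P.1) (volume.prod ν))
    (h2 : Integrable (fun P => G P * X' P.1) ((volume.restrict (Ioc 0 L)).prod ν)) :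
    ∫ P, G P * X P.1 ∂(volume.prod ν) =
      ∫ P, G P * X' P.1 ∂((volume.restrict (Ioc 0 L)).prod ν) := by
  rw [integral_prod _ h1, integral_prod _ h2]
  have h3 := h1.integral_prod_left
  simp_rw [integral_mul_const] at h3 ⊢
  exact hX.integral_mul hL (fun x => by simp only [hG]) h3

theorem integrableOn_mul_of_box {b c : ℝ} {g h : Pt → ℂ} (hg : LocallyIntegrableOn g (slab b c))
    (hh : Continuous h) {S K : Set Pt} (hS : MeasurableSet S) (hK : IsCompact K)
    (hKs : K ⊆ slab b c) (hbox : ∀ P ∈ S, P ∉ K → h P = 0) :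
    IntegrableOn (fun P => g P * h P) S := by
  have h1 : IntegrableOn (fun P => g P * h P) K :=
    (hg.integrableOn_compact_subset hKs hK).mul_continuousOn hh.continuousOn hK
  exact h1.of_forall_sdiff_eq_zero hS fun P hP => by rw [hbox P hP.1 hP.2, mul_zero]

/-- Unfolding of an integral over a slab to an integral over a period cell. -/
theorem integral_slab_eq_integral_cell {L M b c : ℝ} (hL : 0 < L) (hM : 0 < M)
    {X X' Y Y' Z : ℝ → ℂ} (hX : Unfolds L X X') (hY : Unfolds M Y Y') (hZ : Continuous Z)
    (hZc : HasCompactSupport Z) (hZs : tsupport Z ⊆ Ioo b c) {g : Pt → ℂ}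
    (hg : LocallyIntegrableOn g (slab b c)) (hgx : ∀ x y z, g (x + L, y, z) = g (x, y, z))
    (hgy : ∀ x y z, g (x, y + M, z) = g (x, y, z)) :
    ∫ P in slab b c, g P * (X P.1 * Y P.2.1 * Z P.2.2) =
      ∫ P in cell L M b c, g P * (X' P.1 * Y' P.2.1 * Z P.2.2) := by
  set K : Set Pt := Icc 0 (2 * L) ×ˢ (Icc 0 (2 * M) ×ˢ tsupport Z) with hK
  have hKc : IsCompact K := isCompact_Icc.prod (isCompact_Icc.prod hZc)
  have hKs : K ⊆ slab b c := fun P hP => hZs hP.2.2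
  have zZ : ∀ z, z ∉ tsupport Z → Z z = 0 := fun z hz => image_eq_zero_of_notMem_tsupport hz
  have subI : ∀ {A x : ℝ}, x ∈ Ioc 0 A → x ∈ Icc 0 (2 * A) := fun hx =>
    ⟨hx.1.le, by linarith [hx.1, hx.2]⟩
  have cX := hX.continuous
  have cX' := hX.continuous'
  have cY := hY.continuous
  have cY' := hY.continuous'
  have i1 : IntegrableOn (fun P => g P * (X P.1 * Y P.2.1 * Z P.2.2)) (slab b c) := by
    refine integrableOn_mul_of_box hg (by fun_prop) (measurableSet_slab b c) hKc hKs fun P _ hPK => ?_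
    simp only [hK, mem_prod, not_and_or] at hPK
    rcases hPK with h | h | h
    · rw [hX.support _ h, zero_mul, zero_mul]
    · rw [hY.support _ h, mul_zero, zero_mul]
    · rw [zZ _ h, mul_zero]
  -- The intermediate stage: the integral is already folded in `x` but not yet in `y`.
  have i2 : IntegrableOn (fun P => g P * (X' P.1 * Y P.2.1 * Z P.2.2))
      (Ioc 0 L ×ˢ (univ ×ˢ Ioo b c)) := by
    refine integrableOn_mul_of_box hg (by fun_prop)
      (measurableSet_Ioc.prod (MeasurableSet.univ.prod measurableSet_Ioo)) hKc hKs fun P hP hPK => ?_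
    simp only [hK, mem_prod, not_and_or] at hPK
    rcases hPK with h | h | h
    · exact absurd (subI hP.1) h
    · rw [hY.support _ h, mul_zero, zero_mul]
    · rw [zZ _ h, mul_zero]
  have i3 : IntegrableOn (fun P => g P * (X' P.1 * Y' P.2.1 * Z P.2.2)) (cell L M b c) := by
    refine integrableOn_mul_of_box hg (by fun_prop) (measurableSet_cell L M b c) hKc hKs
      fun P hP hPK => ?_
    simp only [hK, mem_prod, not_and_or] at hPK
    rcases hPK with h | h | h
    · exact absurd (subI hP.1) h
    · exact absurd (subI hP.2.1) h
    · rw [zZ _ h, mul_zero]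
  have hr : (volume : Measure Pt).restrict (Ioc 0 L ×ˢ (univ ×ˢ Ioo b c)) =
      (volume.restrict (Ioc 0 L)).prod ((volume : Measure ℝ).prod (volume.restrict (Ioo b c))) := by
    calc _ = ((volume : Measure ℝ).restrict (Ioc 0 L)).prod
          (((volume : Measure ℝ).restrict univ).prod ((volume : Measure ℝ).restrict (Ioo b c))) := by
          rw [Measure.prod_restrict, Measure.prod_restrict]; rfl
      _ = _ := by simp only [Measure.restrict_univ]
  rw [IntegrableOn, restrict_slab] at i1
  rw [IntegrableOn, hr] at i2
  rw [IntegrableOn, restrict_cell] at i3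
  rw [restrict_slab, restrict_cell]
  have e1 : ∀ W : ℝ → ℂ, (fun P : Pt => g P * (W P.1 * Y P.2.1 * Z P.2.2)) =
      fun P : Pt => (g P * (Y P.2.1 * Z P.2.2)) * W P.1 := fun W => by funext P; ring
  rw [e1] at i1 i2 ⊢
  rw [hX.integral_prod_mul hL (G := fun P : Pt => g P * (Y P.2.1 * Z P.2.2))
    (fun x y => by simp only [hgx x y.1 y.2]) i1 i2, integral_prod _ i2, integral_prod _ i3]
  refine integral_congr_ae ?_
  filter_upwards [i2.prod_right_ae, i3.prod_right_ae] with x h2 h3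
  have e2 : ∀ W : ℝ → ℂ, (fun P : ℝ × ℝ => g (x, P) * (X' x * W P.1 * Z P.2)) =
      fun P => g (x, P) * (X' x * Z P.2) * W P.1 := fun W => by funext P; ring
  have e3 : (fun P : ℝ × ℝ => g (x, P) * (Y P.1 * Z P.2) * X' x) =
      fun P => g (x, P) * (X' x * Z P.2) * Y P.1 := by funext P; ring
  rw [e2] at h3 ⊢
  rw [e3] at h2 ⊢
  exact hY.integral_prod_mul hM (G := fun P : ℝ × ℝ => g (x, P) * (X' x * Z P.2))
    (fun y z => by simp only [hgy]) h2 h3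

/-- A smooth cutoff on two periods whose translates by the period sum up to one. -/
def cutoff (L x : ℝ) : ℝ := Real.smoothTransition (x / L) - Real.smoothTransition (x / L - 1)

theorem contDiff_cutoff (L : ℝ) : ContDiff ℝ ∞ (cutoff L) :=
  (Real.smoothTransition.contDiff.comp (contDiff_id.div_const L)).sub
    (Real.smoothTransition.contDiff.comp ((contDiff_id.div_const L).sub contDiff_const))

theorem cutoff_eq_zero {L : ℝ} (hL : 0 < L) {x : ℝ} (hx : x ∉ Icc 0 (2 * L)) : cutoff L x = 0 := by
  rw [mem_Icc, not_and_or, not_le, not_le] at hx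
  rcases hx with hx | hx
  · have : x / L ≤ 0 := div_nonpos_of_nonpos_of_nonneg hx.le hL.le
    rw [cutoff, Real.smoothTransition.zero_of_nonpos this,
      Real.smoothTransition.zero_of_nonpos (by linarith), sub_zero]
  · have : 2 ≤ x / L := by rw [le_div_iff₀ hL]; exact hx.le
    rw [cutoff, Real.smoothTransition.one_of_one_le (by linarith),
      Real.smoothTransition.one_of_one_le (by linarith), sub_self]

theorem cutoff_add {L : ℝ} (hL : 0 < L) {x : ℝ} (hx : x ∈ Ioo 0 L) :
    cutoff L x + cutoff L (x + L) = 1 := by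
  have h1 : 0 < x / L := div_pos hx.1 hL
  have h2 : x / L < 1 := by rw [div_lt_one hL]; exact hx.2
  have h3 : (x + L) / L = x / L + 1 := by rw [add_div, div_self hL.ne']
  rw [cutoff, cutoff, h3, Real.smoothTransition.zero_of_nonpos (x := x / L - 1) (by linarith),
    Real.smoothTransition.one_of_one_le (x := x / L + 1) (by linarith), add_sub_cancel_right]
  ring

/-- A compactly supported function whose periodization is the character. -/
def charTest (L : ℝ) (m : ℤ) (x : ℝ) : ℂ := (cutoff L x : ℂ) * char L m x

theorem contDiff_charTest (L : ℝ) (m : ℤ) : ContDiff ℝ ∞ (charTest L m) :=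
  (Complex.ofRealCLM.contDiff.comp (contDiff_cutoff L)).mul (contDiff_char L m)

theorem unfolds_charTest {L : ℝ} (hL : 0 < L) (m : ℤ) : Unfolds L (charTest L m) (char L m) where
  continuous := (contDiff_charTest L m).continuous
  continuous' := continuous_char L m
  support x hx := by rw [charTest, cutoff_eq_zero hL hx]; simp
  sum_eq x hx := by
    rw [charTest, charTest, char_add, ← add_mul, ← Complex.ofReal_add, cutoff_add hL hx]; simp

/-- Differentiation of the unfolding identity for the character. The identity is only needed on the
open period, where it holds near every point. -/
theorem unfolds_deriv_charTest {L : ℝ} (hL : 0 < L) (m : ℤ) :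
    Unfolds L (deriv (charTest L m)) (fun x => 2 * Real.pi * Complex.I * m / L * char L m x) where
  continuous := (contDiff_charTest L m).continuous_deriv (by simp)
  continuous' := continuous_const.mul (continuous_char L m)
  support x hx := by
    have : charTest L m =ᶠ[nhds x] fun _ => 0 := by
      filter_upwards [isClosed_Icc.isOpen_compl.mem_nhds hx] with y hy
      exact (unfolds_charTest hL m).support y hy
    rw [this.deriv_eq, deriv_const]
  sum_eq x hx := by
    have hd : Differentiable ℝ (charTest L m) := (contDiff_charTest L m).differentiable (by simp)
    have h1 : HasDerivAt (fun x => charTest L m x + charTest L m (x + L))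
        (deriv (charTest L m) x + deriv (charTest L m) (x + L)) x := by
      refine (hd x).hasDerivAt.add ?_
      exact (hd (x + L)).hasDerivAt.comp_add_const x L
    have h2 : (fun x => charTest L m x + charTest L m (x + L)) =ᶠ[nhds x] char L m := by
      filter_upwards [isOpen_Ioo.mem_nhds hx] with y hy
      exact (unfolds_charTest hL m).sum_eq y hy
    exact (h1.congr_of_eventuallyEq h2.symm).unique (hasDerivAt_char L m x)

/-! ### Products of cut-off characters as test functions. -/

section ProductTest

variable {L M b c : ℝ} {m n : ℤ} {ψ : ℝ → ℝ}

/-- The product test function with horizontal frequencies `m`, `n`. -/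
def prodTest (L M : ℝ) (m n : ℤ) (ψ : ℝ → ℝ) (P : Pt) : ℂ :=
  charTest L m P.1 * charTest M n P.2.1 * (ψ P.2.2 : ℂ)

theorem contDiff_prodTest (hψ : ContDiff ℝ ∞ ψ) : ContDiff ℝ ∞ (prodTest L M m n ψ) :=
  (((contDiff_charTest L m).comp contDiff_fst).mul
    ((contDiff_charTest M n).comp (contDiff_fst.comp contDiff_snd))).mul
    (Complex.ofRealCLM.contDiff.comp (hψ.comp (contDiff_snd.comp contDiff_snd)))

theorem tsupport_prodTest_subset (hL : 0 < L) (hM : 0 < M) :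
    tsupport (prodTest L M m n ψ) ⊆ Icc 0 (2 * L) ×ˢ (Icc 0 (2 * M) ×ˢ tsupport ψ) := by
  refine closure_minimal (fun P hP => ?_)
    (isClosed_Icc.prod (isClosed_Icc.prod (isClosed_tsupport _)))
  by_contra h
  apply hP
  simp only [mem_prod, not_and_or] at h
  rcases h with h | h | h
  · simp [prodTest, (unfolds_charTest hL m).support _ h]
  · simp [prodTest, (unfolds_charTest hM n).support _ h]
  · simp [prodTest, image_eq_zero_of_notMem_tsupport h]

theorem fderiv_prodTest (hψ : ContDiff ℝ ∞ ψ) (P : Pt) :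
    fderiv ℝ (prodTest L M m n ψ) P (dir 0) =
        deriv (charTest L m) P.1 * charTest M n P.2.1 * (ψ P.2.2 : ℂ) ∧
      fderiv ℝ (prodTest L M m n ψ) P (dir 1) =
        charTest L m P.1 * deriv (charTest M n) P.2.1 * (ψ P.2.2 : ℂ) ∧
      fderiv ℝ (prodTest L M m n ψ) P (dir 2) =
        charTest L m P.1 * charTest M n P.2.1 * ((deriv ψ P.2.2 : ℝ) : ℂ) := by
  have hd : ∀ {L : ℝ} {m : ℤ} (x : ℝ), HasDerivAt (charTest L m) (deriv (charTest L m) x) x :=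
    fun x => (((contDiff_charTest _ _).differentiable (by simp)) x).hasDerivAt
  have h1 : HasFDerivAt (fun P : Pt => charTest L m P.1) _ P :=
    (hd P.1).hasFDerivAt.comp P hasFDerivAt_fst
  have p2 : HasFDerivAt (fun P : Pt => P.2.1)
      ((ContinuousLinearMap.fst ℝ ℝ ℝ).comp (ContinuousLinearMap.snd ℝ ℝ (ℝ × ℝ))) P :=
    ((ContinuousLinearMap.fst ℝ ℝ ℝ).comp (ContinuousLinearMap.snd ℝ ℝ (ℝ × ℝ))).hasFDerivAt
  have p3 : HasFDerivAt (fun P : Pt => P.2.2)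
      ((ContinuousLinearMap.snd ℝ ℝ ℝ).comp (ContinuousLinearMap.snd ℝ ℝ (ℝ × ℝ))) P :=
    ((ContinuousLinearMap.snd ℝ ℝ ℝ).comp (ContinuousLinearMap.snd ℝ ℝ (ℝ × ℝ))).hasFDerivAt
  have h2 : HasFDerivAt (fun P : Pt => charTest M n P.2.1) _ P :=
    HasFDerivAt.comp (g := charTest M n) P (hd P.2.1).hasFDerivAt p2
  have hψ' : HasDerivAt (fun z => (ψ z : ℂ)) ((deriv ψ P.2.2 : ℝ) : ℂ) P.2.2 :=
    ((hψ.differentiable (by simp)) P.2.2).hasDerivAt.ofReal_comp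
  have h3 : HasFDerivAt (fun P : Pt => (ψ P.2.2 : ℂ)) _ P :=
    HasFDerivAt.comp (g := fun z => (ψ z : ℂ)) P hψ'.hasFDerivAt p3
  have h : HasFDerivAt (prodTest L M m n ψ) _ P := (h1.mul h2).mul h3
  rw [h.fderiv]
  refine ⟨?_, ?_, ?_⟩ <;> simp [dir] <;> ring

end ProductTest
end

noncomputable section

/-! ### Fourier coefficients of weak derivatives. -/

theorem LocallyIntegrableOn.complex_ofReal {U : Set Pt} {g : Pt → ℝ} (hg : LocallyIntegrableOn g U) :
    LocallyIntegrableOn (fun P => (g P : ℂ)) U := fun P hP => by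
  obtain ⟨s, hs, hi⟩ := hg P hP
  exact ⟨s, hs, hi.ofReal⟩

theorem integrableOn_complex_ofReal {U : Set Pt} {g : Pt → ℝ} (hg : IntegrableOn g U) :
    IntegrableOn (fun P => (g P : ℂ)) U := hg.ofReal

theorem ae_eq_of_integral_test {b c : ℝ} {F H : ℝ → ℂ} (hF : IntegrableOn F (Ioo b c))
    (hH : IntegrableOn H (Ioo b c))
    (h : ∀ ψ : ℝ → ℝ, ContDiff ℝ ∞ ψ → HasCompactSupport ψ → tsupport ψ ⊆ Ioo b c →
      ∫ z in Ioo b c, F z * (ψ z : ℂ) = ∫ z in Ioo b c, H z * (ψ z : ℂ)) :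
    F =ᵐ[volume.restrict (Ioo b c)] H := by
  have := isOpen_Ioo.ae_eq_zero_of_integral_contDiff_smul_eq_zero (μ := volume)
    (hF.sub hH).locallyIntegrableOn (by
    intro ψ h1 h2 h3
    have mulc : ∀ {F : ℝ → ℂ}, IntegrableOn F (Ioo b c) →
        IntegrableOn (fun z => F z * (ψ z : ℂ)) (Ioo b c) := fun hF => by
      obtain ⟨C, hC⟩ := h2.exists_bound_of_continuous h1.continuous
      exact hF.mul_bdd (c := C) (Complex.continuous_ofReal.comp h1.continuous).aestronglyMeasurable
        (Filter.Eventually.of_forall fun z => by simpa using hC z)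
    have e : ∀ z, ψ z • (F - H) z = F z * (ψ z : ℂ) - H z * (ψ z : ℂ) := fun z => by
      rw [Complex.real_smul, Pi.sub_apply]; ring
    have e0 : ∫ z in Ioo b c, ψ z • (F - H) z = ∫ z, ψ z • (F - H) z :=
      setIntegral_eq_integral_of_forall_compl_eq_zero fun z hz => by
        rw [image_eq_zero_of_notMem_tsupport fun h => hz (h3 h), zero_smul]
    rw [← e0]
    simp_rw [e]
    rw [integral_sub (mulc hF) (mulc hH), h ψ h1 h2 h3, sub_self])
  rw [Filter.EventuallyEq, ae_restrict_iff' measurableSet_Ioo]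
  filter_upwards [this] with z hz hzm
  exact sub_eq_zero.1 (hz hzm)

theorem integrableOn_coef {L M b c : ℝ} {k : ℤ × ℤ} {G : Pt → ℂ}
    (hG : IntegrableOn G (cell L M b c)) : IntegrableOn (coef L M k G) (Ioo b c) := by
  rw [IntegrableOn, restrict_cell] at hG
  have h1 : Integrable (fun P : ℝ × ℝ => fc L k.1 fun x => G (x, P)) _ := integrable_fc hG
  exact integrable_fc (G := fun P : ℝ × ℝ => fc L k.1 fun x => G (x, P)) h1

/-- Additivity holds only for almost every `z`, since a slice at an exceptional height need not be
integrable. It is obtained by testing in `z`, where the integrals are over the whole cell. -/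
theorem coef_add_ae {L M b c : ℝ} {k : ℤ × ℤ} {G H : Pt → ℂ} (hG : IntegrableOn G (cell L M b c))
    (hH : IntegrableOn H (cell L M b c)) :
    coef L M k (fun P => G P + H P) =ᵐ[volume.restrict (Ioo b c)]
      fun z => coef L M k G z + coef L M k H z := by
  refine ae_eq_of_integral_test (integrableOn_coef (hG.add hH))
    ((integrableOn_coef hG).add (integrableOn_coef hH)) fun ψ h1 h2 h3 => ?_
  have cψ : Continuous fun z => (ψ z : ℂ) := Complex.continuous_ofReal.comp h1.continuous
  obtain ⟨C, hC⟩ := h2.exists_bound_of_continuous h1.continuous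
  have mulc : ∀ {F : ℝ → ℂ}, IntegrableOn F (Ioo b c) →
      IntegrableOn (fun z => F z * (ψ z : ℂ)) (Ioo b c) := fun hF =>
    hF.mul_bdd (c := C) cψ.aestronglyMeasurable
      (Filter.Eventually.of_forall fun z => by simpa using hC z)
  have mulc' : ∀ {F : Pt → ℂ}, IntegrableOn F (cell L M b c) →
      IntegrableOn (fun P => F P * (char L (-k.1) P.1 * char M (-k.2) P.2.1 * (ψ P.2.2 : ℂ)))
        (cell L M b c) := fun hF => by
    refine hF.mul_bdd (c := C) ?_ (Filter.Eventually.of_forall fun P => ?_)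
    · exact ((((continuous_char L _).comp continuous_fst).mul
        ((continuous_char M _).comp (continuous_fst.comp continuous_snd))).mul
        (cψ.comp (continuous_snd.comp continuous_snd))).aestronglyMeasurable
    · rw [norm_mul, norm_mul, norm_char, norm_char, one_mul, one_mul]
      simpa using hC P.2.2
  simp_rw [add_mul]
  rw [integral_add (mulc (integrableOn_coef hG)) (mulc (integrableOn_coef hH)),
    integral_coef_mul (G := fun P => G P + H P) cψ (hG.add hH), integral_coef_mul cψ hG, integral_coef_mul cψ hH]
  simp_rw [add_mul]
  rw [integral_add (mulc' hG) (mulc' hH), mul_add]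

section CoefWeakPartial

variable {L M b c : ℝ} {w g : Pt → ℝ} {i : Fin 3}

/-- Testing a weak derivative of a periodic function with a product of characters. -/
theorem integral_cell_weakPartial (hL : 0 < L) (hM : 0 < M) (hw : AEPeriodic L M b c w)
    (h : HasWeakPartial (slab b c) i w g) {m n : ℤ} {ψ : ℝ → ℝ} (h1 : ContDiff ℝ ∞ ψ) (h2 : HasCompactSupport ψ)
    (h3 : tsupport ψ ⊆ Ioo b c) {X X' Y Y' Z : ℝ → ℂ} (hX : Unfolds L X X') (hY : Unfolds M Y Y')
    (hZ : Continuous Z) (hZs : tsupport Z ⊆ tsupport ψ)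
    (hd : ∀ P : Pt, fderiv ℝ (prodTest L M m n ψ) P (dir i) = X P.1 * Y P.2.1 * Z P.2.2) :
    ∫ P in cell L M b c, (w P : ℂ) * (X' P.1 * Y' P.2.1 * Z P.2.2) =
      -∫ P in cell L M b c, (g P : ℂ) * (char L m P.1 * char M n P.2.1 * (ψ P.2.2 : ℂ)) := by
  have hwp := hw.periodize_ae_eq hL hM
  have hgp := (hw.weakPartial h).periodize_ae_eq hL hM
  have h' := h.congr (isOpen_slab b c) hwp.symm hgp.symm
  have hts := tsupport_prodTest_subset (m := m) (n := n) (ψ := ψ) hL hM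
  have hc : HasCompactSupport (prodTest L M m n ψ) :=
    (isCompact_Icc.prod (isCompact_Icc.prod h2)).of_isClosed_subset (isClosed_tsupport _) hts
  have e := h'.integral_complex (contDiff_prodTest (L := L) (M := M) (m := m) (n := n) h1) hc
    (fun P hP => h3 (hts hP).2.2)
  simp_rw [hd] at e
  have hψs : tsupport (fun z => (ψ z : ℂ)) ⊆ tsupport ψ :=
    tsupport_comp_subset Complex.ofReal_zero ψ
  have hx : ∀ {w : Pt → ℝ} x y z, (periodize hL hM w (x + L, y, z) : ℂ) =
      periodize hL hM w (x, y, z) := fun x y z => by rw [periodize_add_x]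
  have hy : ∀ {w : Pt → ℝ} x y z, (periodize hL hM w (x, y + M, z) : ℂ) =
      periodize hL hM w (x, y, z) := fun x y z => by rw [periodize_add_y]
  simp only [prodTest] at e
  have cψ : Continuous fun z => (ψ z : ℂ) := Complex.continuous_ofReal.comp h1.continuous
  rw [integral_slab_eq_integral_cell hL hM hX hY hZ
      (h2.of_isClosed_subset (isClosed_tsupport _) hZs) (hZs.trans h3)
      (LocallyIntegrableOn.complex_ofReal h'.1) hx hy,
    integral_slab_eq_integral_cell hL hM (unfolds_charTest hL m) (unfolds_charTest hM n) cψ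
      (h2.of_isClosed_subset (isClosed_tsupport _) hψs) (hψs.trans h3)
      (LocallyIntegrableOn.complex_ofReal h'.2.1) hx hy] at e
  have per : ∀ {w : Pt → ℝ} {H : Pt → ℂ}, ∫ P in cell L M b c, (periodize hL hM w P : ℂ) * H P =
      ∫ P in cell L M b c, (w P : ℂ) * H P := fun {w H} =>
    setIntegral_congr_fun (measurableSet_cell L M b c) fun P hP => by
      simp only [periodize_eq_on_cell hL hM hP]
  rw [per, per] at e
  exact e

/-- The derivative falls on the character of frequency `-k.1`; its factor and the minus sign of the
weak derivative together give `2πi k.1 / L`. -/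
theorem coef_weakPartial_zero (hL : 0 < L) (hM : 0 < M) (hw : AEPeriodic L M b c w) (h : HasWeakPartial (slab b c) 0 w g)
    (iw : IntegrableOn w (cell L M b c)) (ig : IntegrableOn g (cell L M b c)) (k : ℤ × ℤ) :
    coef L M k (fun P => (g P : ℂ)) =ᵐ[volume.restrict (Ioo b c)]
      fun z => (2 * Real.pi * Complex.I * k.1 / L) * coef L M k (fun P => (w P : ℂ)) z := by
  refine ae_eq_of_integral_test (integrableOn_coef (integrableOn_complex_ofReal ig))
    ((integrableOn_coef (integrableOn_complex_ofReal iw)).const_mul _) fun ψ h1 h2 h3 => ?_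
  have cψ : Continuous fun z => (ψ z : ℂ) := Complex.continuous_ofReal.comp h1.continuous
  have e := integral_cell_weakPartial hL hM hw h h1 h2 h3 (unfolds_deriv_charTest hL (-k.1))
    (unfolds_charTest hM (-k.2)) cψ (tsupport_comp_subset Complex.ofReal_zero ψ)
    (fun P => (fderiv_prodTest h1 P).1)
  simp_rw [mul_assoc (2 * (Real.pi : ℂ) * Complex.I * k.1 / L) (coef L M k _ _)]
  rw [integral_const_mul, integral_coef_mul cψ (integrableOn_complex_ofReal ig), integral_coef_mul cψ (integrableOn_complex_ofReal iw),
    ← neg_eq_iff_eq_neg.2 e, ← mul_left_comm, ← integral_const_mul, ← integral_neg]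
  congr 2
  funext P
  push_cast
  ring

theorem coef_weakPartial_one (hL : 0 < L) (hM : 0 < M) (hw : AEPeriodic L M b c w) (h : HasWeakPartial (slab b c) 1 w g)
    (iw : IntegrableOn w (cell L M b c)) (ig : IntegrableOn g (cell L M b c)) (k : ℤ × ℤ) :
    coef L M k (fun P => (g P : ℂ)) =ᵐ[volume.restrict (Ioo b c)]
      fun z => (2 * Real.pi * Complex.I * k.2 / M) * coef L M k (fun P => (w P : ℂ)) z := by
  refine ae_eq_of_integral_test (integrableOn_coef (integrableOn_complex_ofReal ig))
    ((integrableOn_coef (integrableOn_complex_ofReal iw)).const_mul _) fun ψ h1 h2 h3 => ?_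
  have cψ : Continuous fun z => (ψ z : ℂ) := Complex.continuous_ofReal.comp h1.continuous
  have e := integral_cell_weakPartial hL hM hw h h1 h2 h3 (unfolds_charTest hL (-k.1))
    (unfolds_deriv_charTest hM (-k.2)) cψ (tsupport_comp_subset Complex.ofReal_zero ψ)
    (fun P => (fderiv_prodTest h1 P).2.1)
  simp_rw [mul_assoc (2 * (Real.pi : ℂ) * Complex.I * k.2 / M) (coef L M k _ _)]
  rw [integral_const_mul, integral_coef_mul cψ (integrableOn_complex_ofReal ig), integral_coef_mul cψ (integrableOn_complex_ofReal iw),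
    ← neg_eq_iff_eq_neg.2 e, ← mul_left_comm, ← integral_const_mul, ← integral_neg]
  congr 2
  funext P
  push_cast
  ring

/-- With product test functions the vertical derivative falls on the factor `ψ(z)` alone. Thus the
coefficient of `g` is the weak derivative of the coefficient of `w`, and a function with an
integrable weak derivative is a primitive. -/
theorem coef_weakPartial_two (hL : 0 < L) (hM : 0 < M) (hbc : b < c) (hw : AEPeriodic L M b c w)
    (h : HasWeakPartial (slab b c) 2 w g)
    (iw : IntegrableOn w (cell L M b c)) (ig : IntegrableOn g (cell L M b c)) (k : ℤ × ℤ) :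
    ∃ C : ℂ, ∀ᵐ z, z ∈ Ioo b c → coef L M k (fun P => (w P : ℂ)) z =
      C + ∫ t in b..z, coef L M k (fun P => (g P : ℂ)) t := by
  refine ae_eq_primitive_of_weak_deriv hbc
    ((intervalIntegrable_iff_integrableOn_Ioo_of_le hbc.le).2 (integrableOn_coef (integrableOn_complex_ofReal iw)))
    ((intervalIntegrable_iff_integrableOn_Ioo_of_le hbc.le).2 (integrableOn_coef (integrableOn_complex_ofReal ig)))
    fun ψ h1 h2 h3 => ?_
  have cψ : Continuous fun z => (ψ z : ℂ) := Complex.continuous_ofReal.comp h1.continuous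
  have cψ' : Continuous fun z => ((deriv ψ z : ℝ) : ℂ) :=
    Complex.continuous_ofReal.comp (h1.continuous_deriv (by simp))
  have e := integral_cell_weakPartial hL hM hw h h1 h2 h3 (unfolds_charTest hL (-k.1))
    (unfolds_charTest hM (-k.2)) cψ'
    ((tsupport_comp_subset Complex.ofReal_zero (deriv ψ)).trans
      (closure_minimal (support_deriv_subset) (isClosed_tsupport _)))
    (fun P => (fderiv_prodTest h1 P).2.2)
  rw [intervalIntegral.integral_of_le hbc.le, intervalIntegral.integral_of_le hbc.le,
    integral_Ioc_eq_integral_Ioo, integral_Ioc_eq_integral_Ioo, integral_coef_mul cψ' (integrableOn_complex_ofReal iw),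
    integral_coef_mul cψ (integrableOn_complex_ofReal ig), e, mul_neg]

end CoefWeakPartial
end

noncomputable section

/-! ### The Fourier data of a periodic `H²` function. -/

theorem isCompact_closedCell (L M b c : ℝ) :
    IsCompact (Icc 0 L ×ˢ (Icc 0 M ×ˢ Icc b c) : Set Pt) :=
  isCompact_Icc.prod (isCompact_Icc.prod isCompact_Icc)

theorem cell_subset_closedCell (L M b c : ℝ) :
    cell L M b c ⊆ Icc 0 L ×ˢ (Icc 0 M ×ˢ Icc b c) :=
  prod_mono Ioc_subset_Icc_self (prod_mono Ioc_subset_Icc_self Ioo_subset_Icc_self)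

theorem volume_cell_lt_top (L M b c : ℝ) : volume (cell L M b c) < ⊤ :=
  (measure_mono (cell_subset_closedCell L M b c)).trans_lt (isCompact_closedCell L M b c).measure_lt_top

instance isFiniteMeasure_cell (L M b c : ℝ) :
    IsFiniteMeasure ((volume : Measure Pt).restrict (cell L M b c)) :=
  ⟨by rw [Measure.restrict_apply_univ]; exact volume_cell_lt_top L M b c⟩

theorem memLp_cell_of_continuousOn {L M b c : ℝ} {w : Pt → ℝ}
    (hw : ContinuousOn w (closedSlab b c)) : MemLp w 2 (volume.restrict (cell L M b c)) := by
  have hsub : (Icc 0 L ×ˢ (Icc 0 M ×ˢ Icc b c) : Set Pt) ⊆ closedSlab b c := fun P hP => hP.2.2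
  obtain ⟨C, hC⟩ := (isCompact_closedCell L M b c).exists_bound_of_continuousOn (hw.mono hsub)
  refine MemLp.of_bound ?_ C (ae_restrict_of_forall_mem (measurableSet_cell L M b c)
    fun P hP => hC P (cell_subset_closedCell L M b c hP))
  exact (hw.mono ((cell_subset_closedCell L M b c).trans hsub)).aestronglyMeasurable
    (measurableSet_cell L M b c)

theorem ae_restrict_Ioo_of_cell {L M b c : ℝ} {w g : Pt → ℝ}
    (h : w =ᵐ[volume.restrict (slab b c)] g) : w =ᵐ[volume.restrict (cell L M b c)] g :=
  ae_mono (Measure.restrict_mono (cell_subset_slab L M b c) le_rfl) h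

theorem l2NormSq_nonneg (L M b c : ℝ) (g : Pt → ℝ) : 0 ≤ l2NormSq L M b c g :=
  integral_nonneg fun _ => sq_nonneg _

theorem l2NormSq_congr {L M b c : ℝ} {w g : Pt → ℝ} (h : w =ᵐ[volume.restrict (slab b c)] g) :
    l2NormSq L M b c w = l2NormSq L M b c g := by
  refine integral_congr_ae ?_
  filter_upwards [ae_restrict_Ioo_of_cell h] with P hP
  rw [hP]

theorem hasSum_coef_sq {L M b c : ℝ} (hL : 0 < L) (hM : 0 < M) {g : Pt → ℝ}
    (hg : MemLp g 2 (volume.restrict (cell L M b c))) {F : ℤ × ℤ → ℝ → ℂ}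
    (hF : ∀ k, coef L M k (fun P => (g P : ℂ)) =ᵐ[volume.restrict (Ioo b c)] F k) (hbc : b ≤ c) :
    HasSum (fun k => ∫ z in b..c, ‖F k z‖ ^ 2) ((L * M)⁻¹ * l2NormSq L M b c g) := by
  have h := (parseval_cell hL hM (G := fun P => (g P : ℂ)) hg.ofReal).2
  have e : ∀ k, ∫ z in Ioo b c, ‖coef L M k (fun P => (g P : ℂ)) z‖ ^ 2 =
      ∫ z in b..c, ‖F k z‖ ^ 2 := fun k => by
    rw [intervalIntegral.integral_of_le hbc, integral_Ioc_eq_integral_Ioo]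
    refine integral_congr_ae ?_
    filter_upwards [hF k] with z hz
    rw [hz]
  simp_rw [e] at h
  convert h using 3
  simp
  rfl

theorem integrableOn_of_memLp {L M b c : ℝ} {g : Pt → ℝ}
    (hg : MemLp g 2 (volume.restrict (cell L M b c))) : IntegrableOn g (cell L M b c) :=
  hg.integrable (by norm_num)

theorem norm_freq_mul_sq (r : ℝ) (m : ℤ) (z : ℂ) :
    ‖2 * (Real.pi : ℂ) * Complex.I * m / r * z‖ ^ 2 = (2 * Real.pi * m / r) ^ 2 * ‖z‖ ^ 2 := by
  rw [norm_mul, mul_pow]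
  congr 1
  have : 2 * (Real.pi : ℂ) * Complex.I * m / r = ((2 * Real.pi * m / r : ℝ) : ℂ) * Complex.I := by
    push_cast; ring
  rw [this, norm_mul, Complex.norm_I, mul_one, Complex.norm_real, Real.norm_eq_abs, sq_abs]

/-- The Fourier data of a periodic `H²` function on a slab: the coefficients are `H²` curves, and
Parseval's identity holds for the function and its derivatives. -/
structure FourierData (L M b c : ℝ) (w : Pt → ℝ) (f p q : ℤ × ℤ → ℝ → ℂ) : Prop where
  curve : ∀ k, IsH2Curve b c (f k) (p k) (q k)
  sum_f : HasSum (fun k => ∫ z in b..c, ‖f k z‖ ^ 2) ((L * M)⁻¹ * l2NormSq L M b c w)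
  sum_x : HasSum (fun k : ℤ × ℤ => (2 * Real.pi * k.1 / L) ^ 2 * ∫ z in b..c, ‖f k z‖ ^ 2)
    ((L * M)⁻¹ * l2NormSq L M b c (weakPartial (slab b c) 0 w))
  sum_y : HasSum (fun k : ℤ × ℤ => (2 * Real.pi * k.2 / M) ^ 2 * ∫ z in b..c, ‖f k z‖ ^ 2)
    ((L * M)⁻¹ * l2NormSq L M b c (weakPartial (slab b c) 1 w))
  sum_z : HasSum (fun k => ∫ z in b..c, ‖p k z‖ ^ 2)
    ((L * M)⁻¹ * l2NormSq L M b c (weakPartial (slab b c) 2 w))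
  sum_xx : HasSum (fun k : ℤ × ℤ => (2 * Real.pi * k.1 / L) ^ 4 * ∫ z in b..c, ‖f k z‖ ^ 2)
    ((L * M)⁻¹ * l2NormSq L M b c (weakPartial (slab b c) 0 (weakPartial (slab b c) 0 w)))
  sum_yy : HasSum (fun k : ℤ × ℤ => (2 * Real.pi * k.2 / M) ^ 4 * ∫ z in b..c, ‖f k z‖ ^ 2)
    ((L * M)⁻¹ * l2NormSq L M b c (weakPartial (slab b c) 1 (weakPartial (slab b c) 1 w)))
  sum_zz : HasSum (fun k => ∫ z in b..c, ‖q k z‖ ^ 2)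
    ((L * M)⁻¹ * l2NormSq L M b c (weakPartial (slab b c) 2 (weakPartial (slab b c) 2 w)))
  sum_laplacian : HasSum (fun k : ℤ × ℤ => ∫ z in b..c,
      ‖q k z - (((2 * Real.pi * k.1 / L) ^ 2 + (2 * Real.pi * k.2 / M) ^ 2 : ℝ) : ℂ) * f k z‖ ^ 2)
    ((L * M)⁻¹ * l2NormSq L M b c (weakLaplacian (slab b c) w))

namespace NoisySmoothing.MemH2

variable {L M b c : ℝ} {w : Pt → ℝ}

theorem hasWeakPartial (hw : MemH2 L M b c w) (i : Fin 3) :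
    HasWeakPartial (slab b c) i w (weakPartial (slab b c) i w) :=
  (hw.exists_first i).choose_spec.weakPartial_spec

theorem hasWeakPartial₂ (hw : MemH2 L M b c w) (i j : Fin 3) :
    HasWeakPartial (slab b c) j (weakPartial (slab b c) i w)
      (weakPartial (slab b c) j (weakPartial (slab b c) i w)) :=
  (hw.exists_second i j).choose_spec.weakPartial_spec

theorem aePeriodic (hw : MemH2 L M b c w) : AEPeriodic L M b c w :=
  AEPeriodic.of_periodic (fun x y z hz => hw.periodic_x x y z (Ioo_subset_Icc_self hz))
    (fun x y z hz => hw.periodic_y x y z (Ioo_subset_Icc_self hz))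

theorem memLp (hw : MemH2 L M b c w) : MemLp w 2 (volume.restrict (cell L M b c)) :=
  memLp_cell_of_continuousOn hw.continuousOn

/-- Clamping `z` to `[b, c]` extends the function continuously and periodically to the whole space,
where the results on Fourier series of continuous functions apply. -/
theorem exists_continuous (hw : MemH2 L M b c w) (hbc : b ≤ c) :
    ∃ w' : Pt → ℝ, Continuous w' ∧ (∀ x y z, w' (x + L, y, z) = w' (x, y, z)) ∧
      (∀ x y z, w' (x, y + M, z) = w' (x, y, z)) ∧
      ∀ x y z, z ∈ Icc b c → w' (x, y, z) = w (x, y, z) := by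
  have hm : ∀ z, (projIcc b c hbc z : ℝ) ∈ Icc b c := fun z => (projIcc b c hbc z).2
  refine ⟨fun P => w (P.1, P.2.1, projIcc b c hbc P.2.2), ?_, fun x y z => ?_, fun x y z => ?_,
    fun x y z hz => ?_⟩
  · exact hw.continuousOn.comp_continuous (by fun_prop) fun P => hm P.2.2
  · exact hw.periodic_x x y _ (hm z)
  · exact hw.periodic_y x y _ (hm z)
  · simp only [projIcc_of_mem hbc hz]

theorem continuousOn_coef (hL : 0 < L) (hM : 0 < M) (hw : MemH2 L M b c w) (hbc : b ≤ c)
    (k : ℤ × ℤ) : ContinuousOn (coef L M k (fun P => (w P : ℂ))) (Icc b c) := by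
  obtain ⟨w', h1, -, -, h4⟩ := hw.exists_continuous hbc
  refine (continuous_coef (k := k) hL hM (Complex.continuous_ofReal.comp h1)).continuousOn.congr ?_
  intro z hz
  exact coef_congr fun x y => by simp only [Function.comp, h4 x y z hz]

/-- Horizontal derivatives multiply a coefficient by its frequency and vertical ones differentiate
it, so Parseval's identity for each derivative is a sum over modes of integrals of one curve. -/
theorem fourierData (hL : 0 < L) (hM : 0 < M) (hbc : b < c) (hw : MemH2 L M b c w) :
    ∃ p q, FourierData L M b c w (fun k => coef L M k (fun P => (w P : ℂ))) p q := by
  set f : ℤ × ℤ → ℝ → ℂ := fun k => coef L M k (fun P => (w P : ℂ)) with hf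
  set W : Fin 3 → Pt → ℝ := fun i => weakPartial (slab b c) i w with hW
  set WW : Fin 3 → Pt → ℝ := fun i => weakPartial (slab b c) i (weakPartial (slab b c) i w) with hWW
  have iw := integrableOn_of_memLp hw.memLp
  have iW : ∀ i, IntegrableOn (W i) (cell L M b c) := fun i =>
    integrableOn_of_memLp (hw.memLp_first i)
  have iWW : ∀ i, IntegrableOn (WW i) (cell L M b c) := fun i =>
    integrableOn_of_memLp (hw.memLp_second i i)
  have pw := hw.aePeriodic
  have pW : ∀ i, AEPeriodic L M b c (W i) := fun i => pw.weakPartial (hw.hasWeakPartial i)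
  set q : ℤ × ℤ → ℝ → ℂ := fun k => coef L M k (fun P => (WW 2 P : ℂ)) with hq
  have hqi : ∀ k, IntervalIntegrable (q k) volume b c := fun k =>
    (intervalIntegrable_iff_integrableOn_Ioo_of_le hbc.le).2
      (integrableOn_coef (integrableOn_complex_ofReal (iWW 2)))
  have hz2 := fun k => coef_weakPartial_two hL hM hbc (pW 2) (hw.hasWeakPartial₂ 2 2) (iW 2) (iWW 2) k
  have hz1 := fun k => coef_weakPartial_two hL hM hbc pw (hw.hasWeakPartial 2) iw (iW 2) k
  choose C₂ hC₂ using hz2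
  choose C₁ hC₁ using hz1
  -- The continuous representative of the coefficient of the vertical derivative, which itself is
  -- determined only almost everywhere.
  set p : ℤ × ℤ → ℝ → ℂ := fun k z => C₂ k + ∫ t in b..z, q k t with hp
  have hpW : ∀ k, coef L M k (fun P => (W 2 P : ℂ)) =ᵐ[volume.restrict (Ioo b c)] p k := fun k => by
    rw [Filter.EventuallyEq, ae_restrict_iff' measurableSet_Ioo]
    exact hC₂ k
  have hpc : ∀ k, ContinuousOn (p k) (Icc b c) := fun k => by
    have := intervalIntegral.continuousOn_primitive_interval (μ := volume) (f := q k)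
      (a := b) (b := c) (by
        rw [uIcc_of_le hbc.le]
        exact (intervalIntegrable_iff_integrableOn_Icc_of_le hbc.le).1 (hqi k))
    rw [uIcc_of_le hbc.le] at this
    exact continuousOn_const.add this
  have hpi : ∀ k, IntervalIntegrable (p k) volume b c := fun k =>
    (hpc k).intervalIntegrable_of_Icc hbc.le
  -- Both sides are continuous on the closed interval, so equality almost everywhere becomes
  -- equality up to the endpoints, which the boundary conditions require.
  have hfp : ∀ k, ∀ z ∈ Icc b c, f k z = C₁ k + ∫ t in b..z, p k t := fun k => by
    refine Measure.eqOn_Icc_of_ae_eq volume hbc.ne ?_ (hw.continuousOn_coef hL hM hbc.le k) ?_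
    · rw [← Measure.restrict_congr_set Ioo_ae_eq_Icc, Filter.EventuallyEq,
        ae_restrict_iff' measurableSet_Ioo]
      filter_upwards [hC₁ k] with z hz hzm
      refine (hz hzm).trans ?_
      congr 1
      rw [intervalIntegral.integral_of_le hzm.1.le, intervalIntegral.integral_of_le hzm.1.le]
      refine integral_congr_ae (ae_mono (Measure.restrict_mono ?_ le_rfl) (hpW k))
      exact fun t ht => ⟨ht.1, ht.2.trans_lt hzm.2⟩
    · have := intervalIntegral.continuousOn_primitive_interval (μ := volume) (f := p k)
        (a := b) (b := c) (by
          rw [uIcc_of_le hbc.le]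
          exact (intervalIntegrable_iff_integrableOn_Icc_of_le hbc.le).1 (hpi k))
      rw [uIcc_of_le hbc.le] at this
      exact continuousOn_const.add this
  have hx1 := fun k => coef_weakPartial_zero hL hM pw (hw.hasWeakPartial 0) iw (iW 0) k
  have hx2 := fun k => coef_weakPartial_zero hL hM (pW 0) (hw.hasWeakPartial₂ 0 0) (iW 0) (iWW 0) k
  have hy1 := fun k => coef_weakPartial_one hL hM pw (hw.hasWeakPartial 1) iw (iW 1) k
  have hy2 := fun k => coef_weakPartial_one hL hM (pW 1) (hw.hasWeakPartial₂ 1 1) (iW 1) (iWW 1) k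
  have hxx : ∀ k, coef L M k (fun P => (WW 0 P : ℂ)) =ᵐ[volume.restrict (Ioo b c)] fun z =>
      2 * Real.pi * Complex.I * k.1 / L * (2 * Real.pi * Complex.I * k.1 / L * f k z) := fun k => by
    filter_upwards [hx1 k, hx2 k] with z h1 h2
    rw [h2, h1]
  have hyy : ∀ k, coef L M k (fun P => (WW 1 P : ℂ)) =ᵐ[volume.restrict (Ioo b c)] fun z =>
      2 * Real.pi * Complex.I * k.2 / M * (2 * Real.pi * Complex.I * k.2 / M * f k z) := fun k => by
    filter_upwards [hy1 k, hy2 k] with z h1 h2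
    rw [h2, h1]
  have hlap : ∀ k, coef L M k (fun P => (weakLaplacian (slab b c) w P : ℂ))
      =ᵐ[volume.restrict (Ioo b c)] fun z => q k z -
        (((2 * Real.pi * k.1 / L) ^ 2 + (2 * Real.pi * k.2 / M) ^ 2 : ℝ) : ℂ) * f k z := fun k => by
    have c0 := integrableOn_complex_ofReal (iWW 0)
    have c1 := integrableOn_complex_ofReal (iWW 1)
    have c2 := integrableOn_complex_ofReal (iWW 2)
    have e : (fun P => (weakLaplacian (slab b c) w P : ℂ)) =
        fun P => ((WW 0 P : ℂ) + (WW 1 P : ℂ)) + (WW 2 P : ℂ) := by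
      funext P; simp [weakLaplacian, Fin.sum_univ_three, hWW]
    rw [e]
    filter_upwards [coef_add_ae (k := k) (G := fun P => (WW 0 P : ℂ) + (WW 1 P : ℂ))
      (c0.add c1) c2, coef_add_ae (k := k) c0 c1, hxx k, hyy k]
      with z h1 h2 h3 h4
    rw [h1, h2, h3, h4]
    have : Complex.I ^ 2 = -1 := Complex.I_sq
    push_cast
    linear_combination ((2 * Real.pi * k.1 / L) ^ 2 + (2 * Real.pi * k.2 / M) ^ 2) * f k z * this
  have mlap : MemLp (weakLaplacian (slab b c) w) 2 (volume.restrict (cell L M b c)) := by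
    have := ((hw.memLp_second 0 0).add (hw.memLp_second 1 1)).add (hw.memLp_second 2 2)
    refine this.congr_norm ?_ (Filter.Eventually.of_forall fun P => ?_)
    · have e : weakLaplacian (slab b c) w = weakPartial (slab b c) 0 (weakPartial (slab b c) 0 w) +
        weakPartial (slab b c) 1 (weakPartial (slab b c) 1 w) +
        weakPartial (slab b c) 2 (weakPartial (slab b c) 2 w) := by
        funext P; simp [weakLaplacian, Fin.sum_univ_three]
      rw [e]; exact this.1
    · simp [weakLaplacian, Fin.sum_univ_three]
  have sx := hasSum_coef_sq hL hM (hw.memLp_first 0) hx1 hbc.le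
  have sy := hasSum_coef_sq hL hM (hw.memLp_first 1) hy1 hbc.le
  have sxx := hasSum_coef_sq hL hM (hw.memLp_second 0 0) hxx hbc.le
  have syy := hasSum_coef_sq hL hM (hw.memLp_second 1 1) hyy hbc.le
  have szz := hasSum_coef_sq hL hM (hw.memLp_second 2 2) (F := q)
    (fun k => Filter.EventuallyEq.rfl) hbc.le
  have e4 : ∀ a I : ℝ, a ^ 2 * (a ^ 2 * I) = a ^ 4 * I := fun a I => by ring
  simp only [norm_freq_mul_sq, intervalIntegral.integral_const_mul, e4] at sx sy sxx syy
  have hp0 : ∀ k, p k b = C₂ k := fun k => by simp [hp]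
  have hf0 : ∀ k, f k b = C₁ k := fun k => by
    rw [hfp k b (left_mem_Icc.2 hbc.le)]; simp
  refine ⟨p, q, ⟨fun k => ⟨hqi k, ?_, fun z hz => by rw [hf0]; exact hfp k z hz,
    fun z _ => by rw [hp0]⟩,
    hasSum_coef_sq hL hM hw.memLp (fun k => Filter.EventuallyEq.rfl) hbc.le, sx, sy,
    hasSum_coef_sq hL hM (hw.memLp_first 2) hpW hbc.le, sxx, syy, szz,
    hasSum_coef_sq hL hM mlap hlap hbc.le⟩⟩
  have := (parseval_cell hL hM (G := fun P => (WW 2 P : ℂ)) (hw.memLp_second 2 2).ofReal).1 k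
  exact (intervalIntegrable_iff_integrableOn_Ioo_of_le hbc.le).2
    (this.integrable_norm_pow (by norm_num))

end NoisySmoothing.MemH2
end

/-! ### The a priori bound on second derivatives from the Laplacian and the boundary data. -/

noncomputable section

namespace NoisySmoothing

theorem hasWeakPartial_of_contDiff {U : Set Pt} {w : Pt → ℝ} (hw : ContDiff ℝ 1 w)
    (i : Fin 3) : HasWeakPartial U i w (fun P => fderiv ℝ w P (dir i)) := by
  have hd : Continuous fun P => fderiv ℝ w P (dir i) :=
    (hw.continuous_fderiv (by simp)).clm_apply continuous_const
  refine ⟨hw.continuous.locallyIntegrable.locallyIntegrableOn U,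
    hd.locallyIntegrable.locallyIntegrableOn U, fun φ h1 h2 h3 => ?_⟩
  have hc := hasCompactSupport_fderiv_apply h2 (dir i)
  have hφ := continuous_fderiv_apply' h1 (dir i)
  rw [setIntegral_eq_of_tsupport_subset (support_mul_subset_of_tsupport h3),
    setIntegral_eq_of_tsupport_subset (support_mul_subset_of_tsupport
      ((tsupport_fderiv_apply_subset ℝ _).trans h3))]
  refine integral_mul_fderiv_eq_neg_fderiv_mul_of_integrable ?_ ?_ ?_
    (fun x _ => hw.differentiable (by simp) x) (fun x _ => h1.differentiable (by simp) x)
  · exact (hd.mul h1.continuous).integrable_of_hasCompactSupport h2.mul_left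
  · exact (hw.continuous.mul hφ).integrable_of_hasCompactSupport hc.mul_left
  · exact (hw.continuous.mul h1.continuous).integrable_of_hasCompactSupport h2.mul_left

theorem memH2_of_contDiff {L M b c : ℝ} {w : Pt → ℝ} (hw : ContDiff ℝ 2 w)
    (hx : ∀ x y z, w (x + L, y, z) = w (x, y, z)) (hy : ∀ x y z, w (x, y + M, z) = w (x, y, z)) :
    MemH2 L M b c w := by
  have h1 : ContDiff ℝ 1 w := hw.of_le (by norm_num)
  have h2 : ∀ i, ContDiff ℝ 1 fun P => fderiv ℝ w P (dir i) := fun i =>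
    (hw.fderiv_right (m := 1) (by norm_num)).clm_apply contDiff_const
  have e1 : ∀ i, weakPartial (slab b c) i w =ᵐ[volume.restrict (slab b c)]
      fun P => fderiv ℝ w P (dir i) := fun i =>
    (hasWeakPartial_of_contDiff h1 i).weakPartial_ae_eq (isOpen_slab b c)
  have e2 : ∀ i j, HasWeakPartial (slab b c) j (weakPartial (slab b c) i w)
      (fun P => fderiv ℝ (fun P => fderiv ℝ w P (dir i)) P (dir j)) := fun i j =>
    (hasWeakPartial_of_contDiff (h2 i) j).congr (isOpen_slab b c) (e1 i).symm
      Filter.EventuallyEq.rfl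
  have mem : ∀ {g g' : Pt → ℝ}, g =ᵐ[volume.restrict (slab b c)] g' → Continuous g' →
      MemLp g 2 (volume.restrict (cell L M b c)) := fun h hc =>
    (memLp_cell_of_continuousOn hc.continuousOn).ae_eq (ae_restrict_Ioo_of_cell h).symm
  exact
    { continuousOn := hw.continuous.continuousOn
      periodic_x := fun x y z _ => hx x y z
      periodic_y := fun x y z _ => hy x y z
      exists_first := fun i => ⟨_, hasWeakPartial_of_contDiff h1 i⟩
      exists_second := fun i j => ⟨_, e2 i j⟩
      memLp_first := fun i => mem (e1 i) (h2 i).continuous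
      memLp_second := fun i j => mem ((e2 i j).weakPartial_ae_eq (isOpen_slab b c))
        (((h2 i).continuous_fderiv (by simp)).clm_apply continuous_const) }

end NoisySmoothing

/-- The angular frequency in `x` of the `k`-th Fourier mode. -/
def freqX (L : ℝ) (k : ℤ × ℤ) : ℝ := 2 * Real.pi * k.1 / L

/-- The angular frequency in `y` of the `k`-th Fourier mode. -/
def freqY (M : ℝ) (k : ℤ × ℤ) : ℝ := 2 * Real.pi * k.2 / M

/-- The boundary datum, extended independently of `z` to a slab of height one, is a periodic `H²`
function, so Parseval's identity for its second derivatives applies. -/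
theorem summable_coef_of_contDiff {L M : ℝ} (hL : 0 < L) (hM : 0 < M) {g : ℝ × ℝ → ℝ}
    (hg : ContDiff ℝ 2 g)
    (hper : ∀ x y, g (x + L, y) = g (x, y) ∧ g (x, y + M) = g (x, y)) :
    Summable fun k : ℤ × ℤ => (freqX L k ^ 4 + freqY M k ^ 4) *
      ‖coef L M k (fun P => (g (P.1, P.2.1) : ℂ)) 0‖ ^ 2 := by
  have hw : MemH2 L M 0 1 (fun P : Pt => g (P.1, P.2.1)) :=
    memH2_of_contDiff (hg.comp (by fun_prop)) (fun x y _ => (hper x y).1) (fun x y _ => (hper x y).2)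
  obtain ⟨p, q, h⟩ := hw.fourierData hL hM one_pos
  have e : ∀ k, ∫ z in (0 : ℝ)..1, ‖coef L M k (fun P => (g (P.1, P.2.1) : ℂ)) z‖ ^ 2 =
      ‖coef L M k (fun P => (g (P.1, P.2.1) : ℂ)) 0‖ ^ 2 := fun k => by
    have : ∀ z, coef L M k (fun P => (g (P.1, P.2.1) : ℂ)) z =
      coef L M k (fun P => (g (P.1, P.2.1) : ℂ)) 0 := fun z => rfl
    simp [this]
  have := h.sum_xx.summable.add h.sum_yy.summable
  simp_rw [e] at this
  exact this.congr fun k => by rw [freqX, freqY]; ring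

theorem complex_norm_add_sq_le (a b : ℂ) : ‖a + b‖ ^ 2 ≤ 2 * ‖a‖ ^ 2 + 2 * ‖b‖ ^ 2 := by
  have := norm_add_le a b
  nlinarith [norm_nonneg (a + b), sq_nonneg (‖a‖ - ‖b‖), norm_nonneg a, norm_nonneg b]

theorem complex_norm_sub_sq_le (a b : ℂ) : ‖a - b‖ ^ 2 ≤ 2 * ‖a‖ ^ 2 + 2 * ‖b‖ ^ 2 := by
  simpa [sub_eq_add_neg] using complex_norm_add_sq_le a (-b)

namespace IsH2Curve

variable {b c : ℝ} {f p q : ℝ → ℂ}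

/-- Subtraction of an affine function. -/
theorem sub_affine (h : IsH2Curve b c f p q) (hbc : b ≤ c) (α β : ℂ) :
    IsH2Curve b c (fun z => f z - (α + (z - b : ℝ) * β)) (fun z => p z - β) q := by
  refine ⟨h.integrable, h.sq_integrable, fun z hz => ?_, fun z hz => ?_⟩
  · have hi : IntervalIntegrable p volume b z :=
      (h.intervalIntegrable_p hbc).mono_Icc le_rfl hz.1 hz.2
    rw [intervalIntegral.integral_sub hi intervalIntegrable_const, h.f_eq z hz,
      intervalIntegral.integral_const, Complex.real_smul]
    simp only [sub_self, Complex.ofReal_zero]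
    ring
  · rw [h.p_eq z hz]; ring

/-- The affine interpolant `l` of the boundary values has no second derivative, so `f - l` satisfies
the Dirichlet energy inequality with the same `q`. Restoring `l` costs `6 Λ² ∫ ‖l‖²`, and `‖l‖² ≤ 2
(‖f b‖² + ‖f c‖²)`. -/
theorem integral_sq_add_le_boundary (h : IsH2Curve b c f p q) (hbc : b < c) {Λ : ℝ} (hΛ : 0 ≤ Λ) :
    (∫ z in b..c, ‖q z‖ ^ 2) + Λ ^ 2 * ∫ z in b..c, ‖f z‖ ^ 2 ≤
      4 * (∫ z in b..c, ‖q z - (Λ : ℂ) * f z‖ ^ 2) +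
        12 * (c - b) * Λ ^ 2 * (‖f b‖ ^ 2 + ‖f c‖ ^ 2) := by
  have hcb : (0 : ℝ) < c - b := sub_pos.2 hbc
  set β : ℂ := (f c - f b) / (c - b : ℝ) with hβ
  set l : ℝ → ℂ := fun z => f b + (z - b : ℝ) * β with hl
  have hr := h.sub_affine hbc.le (f b) β
  have key := hr.integral_sq_add_le hbc.le hΛ (by simp) (by
    have : ((c - b : ℝ) : ℂ) ≠ 0 := by exact_mod_cast hcb.ne'
    rw [hβ]; field_simp; ring)
  change (∫ z in b..c, ‖q z‖ ^ 2) + Λ ^ 2 * (∫ z in b..c, ‖f z - l z‖ ^ 2) ≤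
    ∫ z in b..c, ‖q z - Λ * (f z - l z)‖ ^ 2 at key
  have hlb : ∀ z ∈ Icc b c, ‖l z‖ ^ 2 ≤ 2 * (‖f b‖ ^ 2 + ‖f c‖ ^ 2) := fun z hz => by
    set θ : ℝ := (z - b) / (c - b) with hθ
    have h0 : 0 ≤ θ := div_nonneg (by linarith [hz.1]) hcb.le
    have h1 : θ ≤ 1 := (div_le_one hcb).2 (by linarith [hz.2])
    have e : l z = (1 - θ : ℝ) * f b + (θ : ℝ) * f c := by
      have : ((c - b : ℝ) : ℂ) ≠ 0 := by exact_mod_cast hcb.ne'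
      simp only [hl, hβ, hθ]
      push_cast at this ⊢
      field_simp
      ring
    rw [e]
    refine (complex_norm_add_sq_le _ _).trans ?_
    rw [norm_mul, norm_mul, Complex.norm_real, Complex.norm_real, Real.norm_of_nonneg h0,
      Real.norm_of_nonneg (by linarith : 0 ≤ 1 - θ)]
    have : (1 - θ) ^ 2 ≤ 1 := by nlinarith
    have : θ ^ 2 ≤ 1 := by nlinarith
    nlinarith [sq_nonneg ‖f b‖, sq_nonneg ‖f c‖]
  have cf := h.continuousOn_f hbc.le
  have cl : ContinuousOn l (Icc b c) := by fun_prop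
  have iq2 := h.sq_integrable
  have i_f2 : IntervalIntegrable (fun z => ‖f z‖ ^ 2) volume b c :=
    (cf.norm.pow 2).intervalIntegrable_of_Icc hbc.le
  have i_l2 : IntervalIntegrable (fun z => ‖l z‖ ^ 2) volume b c :=
    (cl.norm.pow 2).intervalIntegrable_of_Icc hbc.le
  have i_r2 : IntervalIntegrable (fun z => ‖f z - l z‖ ^ 2) volume b c :=
    ((cf.sub cl).norm.pow 2).intervalIntegrable_of_Icc hbc.le
  have comb : ∀ {g : ℝ → ℂ}, ContinuousOn g (Icc b c) →
      IntervalIntegrable (fun z => ‖q z - Λ * g z‖ ^ 2) volume b c := by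
    intro g hg
    have ig : IntervalIntegrable g volume b c := hg.intervalIntegrable_of_Icc hbc.le
    have ms : AEStronglyMeasurable (fun z => q z - Λ * g z) (volume.restrict (uIoc b c)) :=
      (h.integrable.sub (ig.const_mul _)).aestronglyMeasurable_restrict_uIoc
    refine IntervalIntegrable.mono_fun
      ((iq2.const_mul 2).add (((hg.norm.pow 2).intervalIntegrable_of_Icc hbc.le).const_mul
        (2 * Λ ^ 2))) (ms.norm.pow 2) (Filter.Eventually.of_forall fun z => ?_)
    have := complex_norm_sub_sq_le (q z) (Λ * g z)
    rw [norm_mul, Complex.norm_real, mul_pow, Real.norm_eq_abs, sq_abs] at this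
    simp only [Real.norm_eq_abs, Pi.pow_apply]
    rw [abs_of_nonneg (sq_nonneg _), abs_of_nonneg (by positivity)]
    linarith
  have I1 : ∫ z in b..c, ‖q z - Λ * (f z - l z)‖ ^ 2 ≤
      2 * (∫ z in b..c, ‖q z - Λ * f z‖ ^ 2) + 2 * Λ ^ 2 * ∫ z in b..c, ‖l z‖ ^ 2 := by
    rw [← intervalIntegral.integral_const_mul, ← intervalIntegral.integral_const_mul,
      ← intervalIntegral.integral_add ((comb cf).const_mul _) (i_l2.const_mul _)]
    refine intervalIntegral.integral_mono_on hbc.le (comb (cf.sub cl))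
      (((comb cf).const_mul _).add (i_l2.const_mul _)) fun z _ => ?_
    have := complex_norm_add_sq_le (q z - Λ * f z) (Λ * l z)
    rw [norm_mul, Complex.norm_real, mul_pow, Real.norm_eq_abs, sq_abs] at this
    rw [show q z - Λ * (f z - l z) = q z - Λ * f z + Λ * l z by ring]
    linarith
  have I2 : ∫ z in b..c, ‖f z‖ ^ 2 ≤
      2 * (∫ z in b..c, ‖f z - l z‖ ^ 2) + 2 * ∫ z in b..c, ‖l z‖ ^ 2 := by
    rw [← intervalIntegral.integral_const_mul, ← intervalIntegral.integral_const_mul,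
      ← intervalIntegral.integral_add (i_r2.const_mul _) (i_l2.const_mul _)]
    refine intervalIntegral.integral_mono_on hbc.le i_f2
      ((i_r2.const_mul _).add (i_l2.const_mul _)) fun z _ => ?_
    have := complex_norm_add_sq_le (f z - l z) (l z)
    rwa [sub_add_cancel] at this
  have I3 : ∫ z in b..c, ‖l z‖ ^ 2 ≤ (c - b) * (2 * (‖f b‖ ^ 2 + ‖f c‖ ^ 2)) := by
    have := intervalIntegral.integral_mono_on hbc.le i_l2 intervalIntegrable_const hlb
    rwa [intervalIntegral.integral_const, smul_eq_mul] at this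
  have hq0 : 0 ≤ ∫ z in b..c, ‖q z‖ ^ 2 :=
    intervalIntegral.integral_nonneg hbc.le fun _ _ => sq_nonneg _
  have hΛ2 := sq_nonneg Λ
  have J2 := mul_le_mul_of_nonneg_left I2 hΛ2
  have J3 := mul_le_mul_of_nonneg_left I3 hΛ2
  nlinarith

end IsH2Curve

/-- The `L²` norms of the pure second derivatives of a periodic `H²` function are controlled by
its Laplacian and by the Fourier coefficients of its boundary values. -/
theorem FourierData.sum_second_le {L M b c : ℝ} (hL : 0 < L) (hM : 0 < M) (hbc : b < c)
    {w : Pt → ℝ} {f p q : ℤ × ℤ → ℝ → ℂ} (h : FourierData L M b c w f p q)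
    (hB : Summable fun k => (freqX L k ^ 4 + freqY M k ^ 4) * ‖f k b‖ ^ 2)
    (hT : Summable fun k => (freqX L k ^ 4 + freqY M k ^ 4) * ‖f k c‖ ^ 2) :
    ∑ i : Fin 3, l2NormSq L M b c (weakPartial (slab b c) i (weakPartial (slab b c) i w)) ≤
      4 * l2NormSq L M b c (weakLaplacian (slab b c) w) +
        24 * (c - b) * (L * M) * ((∑' k, (freqX L k ^ 4 + freqY M k ^ 4) * ‖f k b‖ ^ 2) +
          ∑' k, (freqX L k ^ 4 + freqY M k ^ 4) * ‖f k c‖ ^ 2) := by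
  have hcb : (0 : ℝ) < c - b := sub_pos.2 hbc
  have S1 := (h.sum_xx.add h.sum_yy).add h.sum_zz
  have S2 := (h.sum_laplacian.mul_left 4).add ((hB.hasSum.add hT.hasSum).mul_left (24 * (c - b)))
  have key := hasSum_le (fun k => ?_) S1 S2
  · have hLM : 0 < L * M := mul_pos hL hM
    have := mul_le_mul_of_nonneg_left key hLM.le
    rw [Fin.sum_univ_three]
    have e : L * M * (L * M)⁻¹ = 1 := mul_inv_cancel₀ hLM.ne'
    generalize l2NormSq L M b c (weakPartial (slab b c) 0 (weakPartial (slab b c) 0 w)) = a0 at *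
    generalize l2NormSq L M b c (weakPartial (slab b c) 1 (weakPartial (slab b c) 1 w)) = a1 at *
    generalize l2NormSq L M b c (weakPartial (slab b c) 2 (weakPartial (slab b c) 2 w)) = a2 at *
    generalize l2NormSq L M b c (weakLaplacian (slab b c) w) = r at *
    have e1 : L * M * ((L * M)⁻¹ * a0 + (L * M)⁻¹ * a1 + (L * M)⁻¹ * a2) = a0 + a1 + a2 := by
      linear_combination (a0 + a1 + a2) * e
    rw [e1] at this
    refine this.trans (le_of_eq ?_)
    linear_combination 4 * r * e
  · have hx : freqX L k = 2 * Real.pi * k.1 / L := rfl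
    have hy : freqY M k = 2 * Real.pi * k.2 / M := rfl
    rw [← hx, ← hy]
    set X := freqX L k
    set Y := freqY M k
    have := (h.curve k).integral_sq_add_le_boundary hbc (Λ := X ^ 2 + Y ^ 2) (by positivity)
    have hf0 : 0 ≤ ∫ z in b..c, ‖f k z‖ ^ 2 :=
      intervalIntegral.integral_nonneg hbc.le fun _ _ => sq_nonneg _
    have h1 : X ^ 4 + Y ^ 4 ≤ (X ^ 2 + Y ^ 2) ^ 2 := by nlinarith [mul_nonneg (sq_nonneg X) (sq_nonneg Y)]
    -- Comparing `Λ²` with the symbols of the pure second derivatives doubles the constant `12` of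
    -- the single-mode estimate to `24`.
    have h2 : (X ^ 2 + Y ^ 2) ^ 2 ≤ 2 * (X ^ 4 + Y ^ 4) := by nlinarith [sq_nonneg (X ^ 2 - Y ^ 2)]
    have j1 := mul_le_mul_of_nonneg_right h1 hf0
    have j2 := mul_le_mul_of_nonneg_right h2
      (mul_nonneg (mul_nonneg (by norm_num : (0:ℝ) ≤ 12) hcb.le)
        (add_nonneg (sq_nonneg ‖f k b‖) (sq_nonneg ‖f k c‖)))
    nlinarith

/-- The sum of the squares of the `L²` norms of the pure second derivatives. -/
def secondNormSq (L M b c : ℝ) (w : Pt → ℝ) : ℝ :=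
  ∑ i : Fin 3, l2NormSq L M b c (weakPartial (slab b c) i (weakPartial (slab b c) i w))

theorem secondNormSq_nonneg (L M b c : ℝ) (w : Pt → ℝ) : 0 ≤ secondNormSq L M b c w :=
  Finset.sum_nonneg fun _ _ => l2NormSq_nonneg _ _ _ _ _

theorem l2NormSq_mono {L M b b' c c' : ℝ} (h1 : b ≤ b') (h2 : c' ≤ c) {g : Pt → ℝ}
    (hg : MemLp g 2 (volume.restrict (cell L M b c))) :
    l2NormSq L M b' c' g ≤ l2NormSq L M b c g :=
  setIntegral_mono_set hg.integrable_sq (Filter.Eventually.of_forall fun _ => sq_nonneg _)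
    (prod_mono le_rfl (prod_mono le_rfl (Ioo_subset_Ioo h1 h2))).eventuallyLE

theorem l2NormSq_sub_le {L M b c : ℝ} {g g' : Pt → ℝ}
    (hg : MemLp g 2 (volume.restrict (cell L M b c)))
    (hg' : MemLp g' 2 (volume.restrict (cell L M b c))) :
    l2NormSq L M b c (fun P => g P - g' P) ≤ 2 * l2NormSq L M b c g + 2 * l2NormSq L M b c g' := by
  unfold l2NormSq
  rw [← integral_const_mul, ← integral_const_mul,
    ← integral_add (hg.integrable_sq.const_mul _) (hg'.integrable_sq.const_mul _)]
  refine integral_mono (hg.sub hg').integrable_sq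
    ((hg.integrable_sq.const_mul _).add (hg'.integrable_sq.const_mul _)) fun P => ?_
  have := sq_nonneg (g P + g' P)
  dsimp only
  nlinarith

namespace NoisySmoothing.MemH2

variable {L M b b' c c' : ℝ} {w w' : Pt → ℝ}

theorem weakPartial_restrict (hw : MemH2 L M b c w) (h1 : b ≤ b') (h2 : c' ≤ c) (i : Fin 3) :
    weakPartial (slab b' c') i w =ᵐ[volume.restrict (slab b' c')] weakPartial (slab b c) i w :=
  ((hw.hasWeakPartial i).mono (slab_mono h1 h2)).weakPartial_ae_eq (isOpen_slab b' c')

theorem hasWeakPartial₂_restrict (hw : MemH2 L M b c w) (h1 : b ≤ b') (h2 : c' ≤ c) (i j : Fin 3) :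
    HasWeakPartial (slab b' c') j (weakPartial (slab b' c') i w)
      (weakPartial (slab b c) j (weakPartial (slab b c) i w)) :=
  ((hw.hasWeakPartial₂ i j).mono (slab_mono h1 h2)).congr (isOpen_slab b' c')
    (hw.weakPartial_restrict h1 h2 i).symm Filter.EventuallyEq.rfl

theorem restrict (hw : MemH2 L M b c w) (h1 : b ≤ b') (h2 : c' ≤ c) : MemH2 L M b' c' w := by
  have hsub : Icc b' c' ⊆ Icc b c := Icc_subset_Icc h1 h2
  have hμ : (volume : Measure Pt).restrict (cell L M b' c') ≤ volume.restrict (cell L M b c) :=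
    Measure.restrict_mono (prod_mono le_rfl (prod_mono le_rfl (Ioo_subset_Ioo h1 h2))) le_rfl
  exact
    { continuousOn := hw.continuousOn.mono fun P hP => hsub hP
      periodic_x := fun x y z hz => hw.periodic_x x y z (hsub hz)
      periodic_y := fun x y z hz => hw.periodic_y x y z (hsub hz)
      exists_first := fun i => ⟨_, (hw.hasWeakPartial i).mono (slab_mono h1 h2)⟩
      exists_second := fun i j => ⟨_, hw.hasWeakPartial₂_restrict h1 h2 i j⟩
      memLp_first := fun i => ((hw.memLp_first i).mono_measure hμ).ae_eq
        (ae_restrict_Ioo_of_cell (hw.weakPartial_restrict h1 h2 i)).symm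
      memLp_second := fun i j => ((hw.memLp_second i j).mono_measure hμ).ae_eq
        (ae_restrict_Ioo_of_cell ((hw.hasWeakPartial₂_restrict h1 h2 i j).weakPartial_ae_eq
          (isOpen_slab b' c'))).symm }

theorem secondNormSq_restrict_le (hw : MemH2 L M b c w) (h1 : b ≤ b') (h2 : c' ≤ c) :
    secondNormSq L M b' c' w ≤ secondNormSq L M b c w := by
  refine Finset.sum_le_sum fun i _ => ?_
  rw [l2NormSq_congr ((hw.hasWeakPartial₂_restrict h1 h2 i i).weakPartial_ae_eq
    (isOpen_slab b' c'))]
  exact l2NormSq_mono h1 h2 (hw.memLp_second i i)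

theorem weakPartial_sub (hw : MemH2 L M b c w) (hw' : MemH2 L M b c w') (i : Fin 3) :
    weakPartial (slab b c) i (fun P => w P - w' P) =ᵐ[volume.restrict (slab b c)]
      fun P => weakPartial (slab b c) i w P - weakPartial (slab b c) i w' P :=
  ((hw.hasWeakPartial i).sub (hw'.hasWeakPartial i)).weakPartial_ae_eq (isOpen_slab b c)

theorem hasWeakPartial₂_sub (hw : MemH2 L M b c w) (hw' : MemH2 L M b c w') (i j : Fin 3) :
    HasWeakPartial (slab b c) j (weakPartial (slab b c) i (fun P => w P - w' P))
      (fun P => weakPartial (slab b c) j (weakPartial (slab b c) i w) P -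
        weakPartial (slab b c) j (weakPartial (slab b c) i w') P) :=
  ((hw.hasWeakPartial₂ i j).sub (hw'.hasWeakPartial₂ i j)).congr (isOpen_slab b c)
    (hw.weakPartial_sub hw' i).symm Filter.EventuallyEq.rfl

theorem sub (hw : MemH2 L M b c w) (hw' : MemH2 L M b c w') :
    MemH2 L M b c (fun P => w P - w' P) where
  continuousOn := hw.continuousOn.sub hw'.continuousOn
  periodic_x x y z hz := by rw [hw.periodic_x x y z hz, hw'.periodic_x x y z hz]
  periodic_y x y z hz := by rw [hw.periodic_y x y z hz, hw'.periodic_y x y z hz]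
  exists_first i := ⟨_, (hw.hasWeakPartial i).sub (hw'.hasWeakPartial i)⟩
  exists_second i j := ⟨_, hw.hasWeakPartial₂_sub hw' i j⟩
  memLp_first i := ((hw.memLp_first i).sub (hw'.memLp_first i)).ae_eq
    (ae_restrict_Ioo_of_cell (hw.weakPartial_sub hw' i)).symm
  memLp_second i j := ((hw.memLp_second i j).sub (hw'.memLp_second i j)).ae_eq
    (ae_restrict_Ioo_of_cell ((hw.hasWeakPartial₂_sub hw' i j).weakPartial_ae_eq
      (isOpen_slab b c))).symm

theorem secondNormSq_sub_le (hw : MemH2 L M b c w) (hw' : MemH2 L M b c w') :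
    secondNormSq L M b c (fun P => w P - w' P) ≤
      2 * secondNormSq L M b c w + 2 * secondNormSq L M b c w' := by
  unfold secondNormSq
  rw [Finset.mul_sum, Finset.mul_sum, ← Finset.sum_add_distrib]
  refine Finset.sum_le_sum fun i _ => ?_
  rw [l2NormSq_congr ((hw.hasWeakPartial₂_sub hw' i i).weakPartial_ae_eq (isOpen_slab b c))]
  exact l2NormSq_sub_le (hw.memLp_second i i) (hw'.memLp_second i i)

end NoisySmoothing.MemH2

/-- An a priori bound for periodic `H²` functions with given `C²` boundary values. -/
theorem exists_secondNormSq_le {L M b c : ℝ} (hL : 0 < L) (hM : 0 < M) (hbc : b < c)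
    {uBot uTop : ℝ × ℝ → ℝ} (hBot : ContDiff ℝ 2 uBot) (hTop : ContDiff ℝ 2 uTop)
    (hBotPer : ∀ x y, uBot (x + L, y) = uBot (x, y) ∧ uBot (x, y + M) = uBot (x, y))
    (hTopPer : ∀ x y, uTop (x + L, y) = uTop (x, y) ∧ uTop (x, y + M) = uTop (x, y)) :
    ∃ B, ∀ w, MemH2 L M b c w → (∀ x y, w (x, y, b) = uBot (x, y) ∧ w (x, y, c) = uTop (x, y)) →
      secondNormSq L M b c w ≤ 4 * laplacianNorm L M b c w ^ 2 + B := by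
  have hB := summable_coef_of_contDiff hL hM hBot hBotPer
  have hT := summable_coef_of_contDiff hL hM hTop hTopPer
  refine ⟨24 * (c - b) * (L * M) * ((∑' k, (freqX L k ^ 4 + freqY M k ^ 4) *
      ‖coef L M k (fun P => (uBot (P.1, P.2.1) : ℂ)) 0‖ ^ 2) +
    ∑' k, (freqX L k ^ 4 + freqY M k ^ 4) *
      ‖coef L M k (fun P => (uTop (P.1, P.2.1) : ℂ)) 0‖ ^ 2), fun w hw hbd => ?_⟩
  obtain ⟨p, q, h⟩ := hw.fourierData hL hM hbc
  have eB : ∀ k, coef L M k (fun P => (w P : ℂ)) b =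
      coef L M k (fun P => (uBot (P.1, P.2.1) : ℂ)) 0 := fun k => by
    have : coef L M k (fun P => (uBot (P.1, P.2.1) : ℂ)) 0 =
      coef L M k (fun P => (uBot (P.1, P.2.1) : ℂ)) b := rfl
    rw [this]
    exact coef_congr fun x y => by simp only [(hbd x y).1]
  have eT : ∀ k, coef L M k (fun P => (w P : ℂ)) c =
      coef L M k (fun P => (uTop (P.1, P.2.1) : ℂ)) 0 := fun k => by
    have : coef L M k (fun P => (uTop (P.1, P.2.1) : ℂ)) 0 =
      coef L M k (fun P => (uTop (P.1, P.2.1) : ℂ)) c := rfl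
    rw [this]
    exact coef_congr fun x y => by simp only [(hbd x y).2]
  have := h.sum_second_le hL hM hbc (by simpa only [eB] using hB) (by simpa only [eT] using hT)
  simp only [eB, eT] at this
  rw [laplacianNorm, Real.sq_sqrt (l2NormSq_nonneg _ _ _ _ _)]
  exact this

/-! ### Decay of the modes, and the sup and Hölder estimates. -/

/-- The sup norm of a Fourier mode. -/
def modeSize (k : ℤ × ℤ) : ℕ := max k.1.natAbs k.2.natAbs

theorem modeSize_pos {k : ℤ × ℤ} (hk : k ≠ 0) : 0 < modeSize k := by
  rw [modeSize, Nat.pos_iff_ne_zero]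
  intro h
  exact hk (Prod.ext (by simp; omega) (by simp; omega))

theorem abs_fst_le_modeSize (k : ℤ × ℤ) : |(k.1 : ℝ)| ≤ modeSize k := by
  rw [← Int.cast_abs, Int.abs_eq_natAbs, Int.cast_natCast, Nat.cast_le]
  exact le_max_left _ _

theorem abs_snd_le_modeSize (k : ℤ × ℤ) : |(k.2 : ℝ)| ≤ modeSize k := by
  rw [← Int.cast_abs, Int.abs_eq_natAbs, Int.cast_natCast, Nat.cast_le]
  exact le_max_right _ _

/-- The sphere of radius `n + 1` for the sup norm on `ℤ²` has `8 (n + 1)` points. -/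
theorem sum_comp_modeSize_le {G : ℕ → ℝ} (hG : ∀ n, 0 ≤ G n) (F : Finset (ℤ × ℤ))
    (hF : ∀ k ∈ F, k ≠ 0) :
    ∃ N : ℕ, ∑ k ∈ F, G (modeSize k) ≤ ∑ n ∈ Finset.range N, 8 * ((n : ℝ) + 1) * G (n + 1) := by
  refine ⟨F.sup modeSize, ?_⟩
  have hmaps : ∀ k ∈ F, modeSize k - 1 ∈ Finset.range (F.sup modeSize) := fun k hk => by
    have h1 := modeSize_pos (hF k hk)
    have h2 : modeSize k ≤ F.sup modeSize := Finset.le_sup hk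
    rw [Finset.mem_range]; omega
  rw [← Finset.sum_fiberwise_of_maps_to hmaps]
  refine Finset.sum_le_sum fun n _ => ?_
  have hb : ∀ k ∈ F.filter (fun k => modeSize k - 1 = n), k ∈ (Finset.box (n + 1) : Finset (ℤ × ℤ)) ∧
      G (modeSize k) = G (n + 1) := fun k hk => by
    obtain ⟨hk, hkn⟩ := Finset.mem_filter.1 hk
    have h1 := modeSize_pos (hF k hk)
    have : modeSize k = n + 1 := by omega
    exact ⟨Int.mem_box.2 this, by rw [this]⟩
  rw [Finset.sum_congr rfl fun k hk => (hb k hk).2, Finset.sum_const, nsmul_eq_mul]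
  refine mul_le_mul_of_nonneg_right ?_ (hG _)
  have := Finset.card_le_card fun k hk => (hb k hk).1
  rw [Int.card_box (Nat.succ_ne_zero n)] at this
  exact_mod_cast this

/-- The weights `min (1, n h)² / n³` occurring in Hölder estimates. -/
def holderWeight (h : ℝ) (n : ℕ) : ℝ := min 1 (n * h) ^ 2 / (n : ℝ) ^ 3

theorem holderWeight_nonneg (h : ℝ) (n : ℕ) : 0 ≤ holderWeight h n := by
  unfold holderWeight; positivity

/-- Counting modes turns the sum into one of `8 min(1, n h)² / n²`. As `min(1, t) ≤ 2t/(1 + t)`, its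
terms are dominated by `32 h` times the increments of `n h / (1 + n h)`, and these telescope to at
most one. The linear growth in `h` is the source of the Hölder exponent `1/2`. -/
theorem sum_holderWeight_le {h : ℝ} (hh : 0 < h) (F : Finset (ℤ × ℤ)) (hF : ∀ k ∈ F, k ≠ 0) :
    ∑ k ∈ F, holderWeight h (modeSize k) ≤ 32 * h := by
  obtain ⟨N, hN⟩ := sum_comp_modeSize_le (holderWeight_nonneg h) F hF
  refine hN.trans ?_
  set g : ℕ → ℝ := fun n => n * h / (1 + n * h) with hg
  have step : ∀ n : ℕ, 8 * ((n : ℝ) + 1) * holderWeight h (n + 1) ≤ 32 * h * (g (n + 1) - g n) := by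
    intro n
    have hn : (0 : ℝ) ≤ n := Nat.cast_nonneg n
    have e : g (n + 1) - g n = h / ((1 + (n + 1) * h) * (1 + n * h)) := by
      simp only [hg]; push_cast
      have h1 : 1 + (n + 1) * h ≠ 0 := by positivity
      have h2 : 1 + n * h ≠ 0 := by positivity
      field_simp; ring
    have l1 : h / (1 + (n + 1) * h) ^ 2 ≤ g (n + 1) - g n := by
      rw [e, sq]
      gcongr
      linarith
    refine le_trans ?_ (mul_le_mul_of_nonneg_left l1 (by positivity))
    have e2 : 8 * ((n : ℝ) + 1) * holderWeight h (n + 1) =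
        8 * (min 1 ((n + 1) * h) / (n + 1)) ^ 2 := by
      unfold holderWeight; push_cast; field_simp
    have e3 : 32 * h * (h / (1 + (n + 1) * h) ^ 2) = 8 * (2 * h / (1 + (n + 1) * h)) ^ 2 := by
      field_simp; ring
    have e4 : min 1 ((n + 1) * h) / (n + 1) ≤ 2 * h / (1 + (n + 1) * h) := by
      rw [div_le_div_iff₀ (by positivity) (by positivity)]
      rcases le_total 1 ((n + 1) * h) with h1 | h1
      · rw [min_eq_left h1]; linarith
      · rw [min_eq_right h1]
        nlinarith [mul_pos (by positivity : (0 : ℝ) < (n + 1)) hh]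
    have h0 : 0 ≤ min 1 ((n + 1) * h) / (n + 1) := by positivity
    rw [e2, e3]
    linarith [pow_le_pow_left₀ h0 e4 2]
  refine (Finset.sum_le_sum fun n _ => step n).trans ?_
  rw [← Finset.mul_sum, Finset.sum_range_sub]
  have hgN : g N ≤ 1 := by
    simp only [hg]
    rw [div_le_one (by positivity)]
    linarith
  have hg0 : g 0 = 0 := by simp [hg]
  rw [hg0, sub_zero]
  nlinarith

/-- The contribution of a Fourier mode to the squared `L²` norms of the pure second derivatives. -/
def modeEnergy (L M b c : ℝ) (f q : ℤ × ℤ → ℝ → ℂ) (k : ℤ × ℤ) : ℝ :=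
  (∫ z in b..c, ‖q k z‖ ^ 2) + (freqX L k ^ 4 + freqY M k ^ 4) * ∫ z in b..c, ‖f k z‖ ^ 2

theorem modeEnergy_nonneg {L M b c : ℝ} (hbc : b ≤ c) (f q : ℤ × ℤ → ℝ → ℂ) (k : ℤ × ℤ) :
    0 ≤ modeEnergy L M b c f q k := by
  have h1 : 0 ≤ ∫ z in b..c, ‖q k z‖ ^ 2 :=
    intervalIntegral.integral_nonneg hbc fun _ _ => sq_nonneg _
  have h2 : 0 ≤ ∫ z in b..c, ‖f k z‖ ^ 2 :=
    intervalIntegral.integral_nonneg hbc fun _ _ => sq_nonneg _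
  unfold modeEnergy
  positivity

theorem FourierData.hasSum_modeEnergy {L M b c : ℝ} {w : Pt → ℝ} {f p q : ℤ × ℤ → ℝ → ℂ}
    (h : FourierData L M b c w f p q) :
    HasSum (modeEnergy L M b c f q) ((L * M)⁻¹ * secondNormSq L M b c w) := by
  have := (h.sum_xx.add h.sum_yy).add h.sum_zz
  convert this using 1
  · funext k; simp only [modeEnergy, freqX, freqY]; ring
  · rw [secondNormSq, Fin.sum_univ_three]; ring

theorem le_freq_pow_four {L M : ℝ} (hL : 0 < L) (hM : 0 < M) (k : ℤ × ℤ) :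
    (2 * Real.pi / max L M) ^ 4 * (modeSize k : ℝ) ^ 4 ≤ freqX L k ^ 4 + freqY M k ^ 4 := by
  have hm : 0 < max L M := lt_max_of_lt_left hL
  have hpi := Real.pi_pos
  have aux : ∀ {l : ℝ} {m : ℤ}, 0 < l → l ≤ max L M →
      (2 * Real.pi / max L M) ^ 4 * (m.natAbs : ℝ) ^ 4 ≤ (2 * Real.pi * m / l) ^ 4 := by
    intro l m hl hlm
    have e : (2 * Real.pi * m / l) ^ 4 = (2 * Real.pi / l) ^ 4 * (m.natAbs : ℝ) ^ 4 := by
      have : (m.natAbs : ℝ) = |(m : ℝ)| := by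
        rw [← Int.cast_abs, Int.abs_eq_natAbs, Int.cast_natCast]
      rw [this, Even.pow_abs (by decide)]
      ring
    rw [e]
    gcongr
  have hX : 0 ≤ freqX L k ^ 4 := by positivity
  have hY : 0 ≤ freqY M k ^ 4 := by positivity
  have h1 := aux (m := k.1) hL (le_max_left _ _)
  have h2 := aux (m := k.2) hM (le_max_right _ _)
  rcases max_choice k.1.natAbs k.2.natAbs with h | h <;> rw [modeSize, h]
  · exact h1.trans (le_add_of_nonneg_right hY)
  · exact h2.trans (le_add_of_nonneg_left hX)

/-- Decay of the Fourier coefficients of a periodic `H²` function. -/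
theorem exists_sq_norm_coef_le {L M : ℝ} (hL : 0 < L) (hM : 0 < M) {ρ : ℝ} (hρ : 0 < ρ) :
    ∃ C, 0 ≤ C ∧ ∀ {b c : ℝ}, ρ ≤ c - b → ∀ {f p q : ℤ × ℤ → ℝ → ℂ} {k : ℤ × ℤ}, k ≠ 0 →
      IsH2Curve b c (f k) (p k) (q k) → ∀ z ∈ Icc b c,
        (modeSize k : ℝ) ^ 3 * ‖f k z‖ ^ 2 ≤ C * modeEnergy L M b c f q k ∧
        (modeSize k : ℝ) * ‖p k z‖ ^ 2 ≤ C * modeEnergy L M b c f q k := by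
  set γ := 2 * Real.pi / max L M with hγ
  have hγ0 : 0 < γ := div_pos (by positivity) (lt_max_of_lt_left hL)
  set s := min 1 ρ with hs
  have hs0 : 0 < s := lt_min one_pos hρ
  refine ⟨(326 / s / γ ^ 4 + 4 * s ^ 3) + (162 / s ^ 3 / γ ^ 4 + 2 * s), by positivity, ?_⟩
  intro b c hbc f p q k hk h z hz
  set n : ℝ := (modeSize k : ℝ) with hn
  have hn1 : 1 ≤ n := Nat.one_le_cast.2 (modeSize_pos hk)
  have hn0 : 0 < n := by linarith
  -- The curve bounds are used at length `s / n`, where `n⁴ ∫ ‖f‖²` and `∫ ‖q‖²`, both bounded by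
  -- the mode energy, balance.
  have hsn : s / n ≤ c - b := (div_le_self hs0.le hn1).trans ((min_le_right _ _).trans hbc)
  have hF := le_freq_pow_four hL hM k
  have hbc' : b ≤ c := hz.1.trans hz.2
  set I := ∫ z in b..c, ‖f k z‖ ^ 2 with hI
  set J := ∫ z in b..c, ‖q k z‖ ^ 2 with hJ
  have hI0 : 0 ≤ I := intervalIntegral.integral_nonneg hbc' fun _ _ => sq_nonneg _
  have hJ0 : 0 ≤ J := intervalIntegral.integral_nonneg hbc' fun _ _ => sq_nonneg _
  set A := modeEnergy L M b c f q k with hA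
  have hA0 : 0 ≤ A := modeEnergy_nonneg hbc' f q k
  have hJA : J ≤ A := by
    simp only [hA, modeEnergy]
    have : 0 ≤ (freqX L k ^ 4 + freqY M k ^ 4) * I := by positivity
    linarith
  have hIA : n ^ 4 * I ≤ A / γ ^ 4 := by
    rw [le_div_iff₀ (by positivity)]
    have := mul_le_mul_of_nonneg_right hF hI0
    simp only [hA, modeEnergy]
    linarith
  have h1 := h.sq_norm_f_le (div_pos hs0 hn0) hsn hz
  have h2 := h.sq_norm_p_le (div_pos hs0 hn0) hsn hz
  have r1 : n ^ 3 * ‖f k z‖ ^ 2 ≤ (326 / s / γ ^ 4 + 4 * s ^ 3) * A := by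
    calc n ^ 3 * ‖f k z‖ ^ 2 ≤ n ^ 3 * (326 / (s / n) * I + 4 * (s / n) ^ 3 * J) := by gcongr
      _ = 326 / s * (n ^ 4 * I) + 4 * s ^ 3 * J := by field_simp
      _ ≤ 326 / s * (A / γ ^ 4) + 4 * s ^ 3 * A := by gcongr
      _ = _ := by ring
  have r2 : n * ‖p k z‖ ^ 2 ≤ (162 / s ^ 3 / γ ^ 4 + 2 * s) * A := by
    calc n * ‖p k z‖ ^ 2 ≤ n * (162 / (s / n) ^ 3 * I + 2 * (s / n) * J) := by gcongr
      _ = 162 / s ^ 3 * (n ^ 4 * I) + 2 * s * J := by field_simp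
      _ ≤ 162 / s ^ 3 * (A / γ ^ 4) + 2 * s * A := by gcongr
      _ = _ := by ring
  have p1 : 0 ≤ (326 / s / γ ^ 4 + 4 * s ^ 3) * A := by positivity
  have p2 : 0 ≤ (162 / s ^ 3 / γ ^ 4 + 2 * s) * A := by positivity
  constructor <;> rw [add_mul] <;> linarith

theorem IsH2Curve.norm_f_sub_le {b c : ℝ} {f p q : ℝ → ℂ} (h : IsH2Curve b c f p q) {B : ℝ}
    (hB : ∀ z ∈ Icc b c, ‖p z‖ ≤ B) {x y : ℝ} (hx : x ∈ Icc b c) (hy : y ∈ Icc b c) :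
    ‖f x - f y‖ ≤ B * |x - y| := by
  wlog hxy : y ≤ x generalizing x y
  · rw [norm_sub_rev, abs_sub_comm]
    exact this hy hx (le_of_not_ge hxy)
  rw [h.f_sub hy.1 hxy hx.2]
  refine intervalIntegral.norm_integral_le_of_norm_le_const fun t ht => hB t ?_
  rw [uIoc_of_le hxy] at ht
  exact ⟨hy.1.trans ht.1.le, ht.2.trans hx.2⟩

/-- The `k`-th term of the Fourier series of a function with coefficients `f`. -/
def modeTerm (L M : ℝ) (f : ℤ × ℤ → ℝ → ℂ) (k : ℤ × ℤ) (P : Pt) : ℂ :=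
  f k P.2.2 * (char L k.1 P.1 * char M k.2 P.2.1)

theorem norm_modeTerm (L M : ℝ) (f : ℤ × ℤ → ℝ → ℂ) (k : ℤ × ℤ) (P : Pt) :
    ‖modeTerm L M f k P‖ = ‖f k P.2.2‖ := by
  rw [modeTerm, norm_mul, norm_mul, norm_char, norm_char, mul_one, mul_one]

theorem modeTerm_zero (L M : ℝ) (f : ℤ × ℤ → ℝ → ℂ) (P : Pt) :
    modeTerm L M f 0 P = f 0 P.2.2 := by
  simp [modeTerm, char]

theorem norm_char_mul_char_sub_le {L M : ℝ} (hL : 0 < L) (hM : 0 < M) (k : ℤ × ℤ) {x x' y y' h : ℝ}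
    (hx : |x - x'| ≤ h) (hy : |y - y'| ≤ h) :
    ‖char L k.1 x * char M k.2 y - char L k.1 x' * char M k.2 y'‖ ≤
      (2 * Real.pi / L + 2 * Real.pi / M) * (modeSize k * h) := by
  have hh : 0 ≤ h := (abs_nonneg _).trans hx
  have hpi := Real.pi_pos
  have e : char L k.1 x * char M k.2 y - char L k.1 x' * char M k.2 y' =
      (char L k.1 x - char L k.1 x') * char M k.2 y +
        char L k.1 x' * (char M k.2 y - char M k.2 y') := by ring
  rw [e]
  refine (norm_add_le _ _).trans ?_
  rw [norm_mul, norm_mul, norm_char, norm_char, mul_one, one_mul]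
  refine (add_le_add (norm_char_sub_le hL _ _ _) (norm_char_sub_le hM _ _ _)).trans ?_
  calc 2 * Real.pi * |(k.1 : ℝ)| / L * |x - x'| + 2 * Real.pi * |(k.2 : ℝ)| / M * |y - y'|
      ≤ 2 * Real.pi * modeSize k / L * h + 2 * Real.pi * modeSize k / M * h := by
        gcongr
        · exact abs_fst_le_modeSize k
        · exact abs_snd_le_modeSize k
    _ = _ := by ring

/-- For `n h ≥ 1` the two terms are bounded separately, by `energy / n³`. For `n h ≤ 1` the mean
value theorem is used in `z`, with `‖p‖² ≲ energy / n`, and on the characters, whose Lipschitz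
constants are of order `n`; either way the bound is `energy · h² / n`. -/
theorem exists_sq_norm_modeTerm_sub_le {L M : ℝ} (hL : 0 < L) (hM : 0 < M) {ρ : ℝ} (hρ : 0 < ρ) :
    ∃ C, 0 ≤ C ∧ ∀ {b c : ℝ}, ρ ≤ c - b → ∀ {f p q : ℤ × ℤ → ℝ → ℂ} {k : ℤ × ℤ}, k ≠ 0 →
      IsH2Curve b c (f k) (p k) (q k) →
        (∀ P ∈ closedSlab b c, ‖modeTerm L M f k P‖ ^ 2 ≤
          C * modeEnergy L M b c f q k * holderWeight 1 (modeSize k)) ∧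
        ∀ P ∈ closedSlab b c, ∀ P' ∈ closedSlab b c, ∀ h, 0 < h → |P.1 - P'.1| ≤ h →
          |P.2.1 - P'.2.1| ≤ h → |P.2.2 - P'.2.2| ≤ h →
          ‖modeTerm L M f k P - modeTerm L M f k P'‖ ^ 2 ≤
            C * modeEnergy L M b c f q k * holderWeight h (modeSize k) := by
  obtain ⟨C, hC, H⟩ := exists_sq_norm_coef_le hL hM hρ
  set Γ := 2 * Real.pi / L + 2 * Real.pi / M with hΓ
  have hpi := Real.pi_pos
  have hΓ0 : 0 < Γ := by positivity
  refine ⟨4 * (1 + Γ ^ 2) * C, by positivity, ?_⟩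
  intro b c hbc f p q k hk hcurve
  have hn1 : (1 : ℝ) ≤ modeSize k := Nat.one_le_cast.2 (modeSize_pos hk)
  have hn0 : (0 : ℝ) < modeSize k := by linarith
  have hbc' : b ≤ c := by linarith
  have hA0 : 0 ≤ modeEnergy L M b c f q k := modeEnergy_nonneg hbc' f q k
  have hCA : 0 ≤ C * modeEnergy L M b c f q k := mul_nonneg hC hA0
  have bf : ∀ z ∈ Icc b c, ‖f k z‖ ^ 2 ≤ C * modeEnergy L M b c f q k / (modeSize k : ℝ) ^ 3 :=
    fun z hz => by
      rw [le_div_iff₀ (by positivity), mul_comm]; exact (H hbc hk hcurve z hz).1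
  have bp : ∀ z ∈ Icc b c, ‖p k z‖ ^ 2 ≤ C * modeEnergy L M b c f q k / (modeSize k : ℝ) :=
    fun z hz => by
      rw [le_div_iff₀ (by positivity), mul_comm]; exact (H hbc hk hcurve z hz).2
  constructor
  · intro P hP
    rw [norm_modeTerm, holderWeight, mul_one, min_eq_left hn1, one_pow]
    refine (bf _ hP).trans ?_
    rw [mul_one_div]
    gcongr
    rw [mul_assoc]
    nlinarith [sq_nonneg Γ]
  intro P hP P' hP' h hh hx hy hz
  rw [holderWeight]
  rcases le_total 1 (modeSize k * h) with h1 | h1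
  · rw [min_eq_left h1, one_pow, mul_one_div]
    refine (complex_norm_sub_sq_le _ _).trans ?_
    rw [norm_modeTerm, norm_modeTerm]
    have a1 := bf _ hP
    have a2 := bf _ hP'
    set X := C * modeEnergy L M b c f q k / (modeSize k : ℝ) ^ 3 with hX
    have hX0 : 0 ≤ X := by positivity
    have e : 4 * (1 + Γ ^ 2) * C * modeEnergy L M b c f q k / (modeSize k : ℝ) ^ 3 =
        4 * (1 + Γ ^ 2) * X := by rw [hX]; ring
    rw [e]
    nlinarith [mul_nonneg hX0 (sq_nonneg Γ)]
  · rw [min_eq_right h1]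
    have e : modeTerm L M f k P - modeTerm L M f k P' =
        (f k P.2.2 - f k P'.2.2) * (char L k.1 P.1 * char M k.2 P.2.1) +
        f k P'.2.2 * (char L k.1 P.1 * char M k.2 P.2.1 - char L k.1 P'.1 * char M k.2 P'.2.1) := by
      simp only [modeTerm]; ring
    have hB := hcurve.norm_f_sub_le (B := Real.sqrt (C * modeEnergy L M b c f q k / modeSize k))
      (fun z hz => Real.le_sqrt_of_sq_le (bp z hz)) hP hP'
    have t1 : ‖(f k P.2.2 - f k P'.2.2) * (char L k.1 P.1 * char M k.2 P.2.1)‖ ^ 2 ≤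
        C * modeEnergy L M b c f q k / modeSize k * h ^ 2 := by
      rw [norm_mul, norm_mul, norm_char, norm_char, mul_one, mul_one]
      calc _ ≤ (Real.sqrt (C * modeEnergy L M b c f q k / modeSize k) * h) ^ 2 := by
            gcongr
            exact hB.trans (by gcongr)
        _ = _ := by rw [mul_pow, Real.sq_sqrt (by positivity)]
    have t2 : ‖f k P'.2.2 * (char L k.1 P.1 * char M k.2 P.2.1 -
        char L k.1 P'.1 * char M k.2 P'.2.1)‖ ^ 2 ≤
        C * modeEnergy L M b c f q k / (modeSize k : ℝ) ^ 3 * (Γ * (modeSize k * h)) ^ 2 := by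
      rw [norm_mul, mul_pow]
      gcongr
      · exact bf _ hP'
      · exact norm_char_mul_char_sub_le hL hM k hx hy
    rw [e]
    refine (complex_norm_add_sq_le _ _).trans ?_
    have e2 : 4 * (1 + Γ ^ 2) * C * modeEnergy L M b c f q k *
        ((modeSize k * h) ^ 2 / (modeSize k : ℝ) ^ 3) =
        4 * (C * modeEnergy L M b c f q k / modeSize k * h ^ 2) +
        4 * (C * modeEnergy L M b c f q k / (modeSize k : ℝ) ^ 3 * (Γ * (modeSize k * h)) ^ 2) := by
      field_simp
    rw [e2]
    have p1 : 0 ≤ C * modeEnergy L M b c f q k / modeSize k * h ^ 2 := by positivity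
    have p2 : 0 ≤ C * modeEnergy L M b c f q k / (modeSize k : ℝ) ^ 3 *
      (Γ * (modeSize k * h)) ^ 2 := by positivity
    linarith

/-- Serves to split off the zero mode, to which the frequency estimates do not apply, from the
Fourier series. -/
theorem norm_sub_le_of_sum_le {ι : Type*} [DecidableEq ι] {D : ι → ℂ} {S : ℂ} (hD : HasSum D S)
    (i : ι) {B : ℝ} (hB : ∀ F : Finset ι, (∀ k ∈ F, k ≠ i) → ∑ k ∈ F, ‖D k‖ ≤ B) :
    ‖S - D i‖ ≤ B := by
  have h := hD.update i 0
  have e : (0 : ℂ) - D i + S = S - D i := by ring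
  rw [e] at h
  refine le_of_tendsto h.norm (Filter.Eventually.of_forall fun F => ?_)
  refine (norm_sum_le _ _).trans ?_
  refine le_trans (le_of_eq ?_) (hB (F.erase i) fun k hk => Finset.ne_of_mem_erase hk)
  rw [← Finset.sum_erase F (a := i) (by simp)]
  exact Finset.sum_congr rfl fun k hk => by
    rw [Function.update_of_ne (Finset.ne_of_mem_erase hk)]

/-- Sup and Hölder bounds for periodic `H²` functions, up to an affine function of `z`. -/
theorem exists_sup_holder {L M : ℝ} (hL : 0 < L) (hM : 0 < M) {ρ H : ℝ} (hρ : 0 < ρ) (hH : 0 < H) :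
    ∃ C, 0 ≤ C ∧ ∀ {b c : ℝ}, ρ ≤ c - b → c - b ≤ H → ∀ {w : Pt → ℝ}, MemH2 L M b c w →
      ∃ α β : ℂ,
        (∀ P ∈ closedSlab b c, ‖(w P : ℂ) - (α + (P.2.2 - b : ℝ) * β)‖ ^ 2 ≤
          C * secondNormSq L M b c w) ∧
        ∀ P ∈ closedSlab b c, ∀ P' ∈ closedSlab b c, ∀ h, 0 < h → h ≤ H → |P.1 - P'.1| ≤ h →
          |P.2.1 - P'.2.1| ≤ h → |P.2.2 - P'.2.2| ≤ h →
          (w P - w P') ^ 2 ≤ C * (secondNormSq L M b c w + ‖β‖ ^ 2) * h := by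
  obtain ⟨C, hC, hT⟩ := exists_sq_norm_modeTerm_sub_le hL hM hρ
  have hLM : 0 < (L * M)⁻¹ := inv_pos.2 (mul_pos hL hM)
  refine ⟨(64 * C + 2 * H ^ 3) * (L * M)⁻¹ + (64 * C + 4 * H ^ 2) * (L * M)⁻¹ + 4 * H,
    by positivity, ?_⟩
  intro b c hbc hcH w hw
  have hlt : b < c := by linarith
  obtain ⟨p, q, hd⟩ := hw.fourierData hL hM hlt
  set f : ℤ × ℤ → ℝ → ℂ := fun k => coef L M k (fun P => (w P : ℂ)) with hf
  set S := secondNormSq L M b c w with hS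
  have hS0 : 0 ≤ S := secondNormSq_nonneg _ _ _ _ _
  set E := (L * M)⁻¹ * S with hE
  have hE0 : 0 ≤ E := mul_nonneg hLM.le hS0
  have hA := hd.hasSum_modeEnergy
  have hA0 := modeEnergy_nonneg (L := L) (M := M) hlt.le f q
  -- Cauchy's inequality for the sum over the nonzero modes
  have cauchy : ∀ (D : ℤ × ℤ → ℂ) (h : ℝ), 0 < h →
      (∀ k, k ≠ 0 → ‖D k‖ ^ 2 ≤ C * modeEnergy L M b c f q k * holderWeight h (modeSize k)) →
      ∀ F : Finset (ℤ × ℤ), (∀ k ∈ F, k ≠ 0) → ∑ k ∈ F, ‖D k‖ ≤ Real.sqrt (32 * C * E * h) := by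
    intro D h hh hD F hF
    refine Real.le_sqrt_of_sq_le ?_
    refine (Finset.sum_sq_le_sum_mul_sum_of_sq_le_mul F
      (fun k _ => mul_nonneg hC (hA0 k)) (fun k _ => holderWeight_nonneg h (modeSize k))
      fun k hk => hD k (hF k hk)).trans ?_
    rw [← Finset.mul_sum]
    have h1 := sum_le_hasSum F (fun k _ => hA0 k) hA
    have h2 := sum_holderWeight_le hh F hF
    calc _ ≤ C * E * (32 * h) := by
          gcongr
          exact Finset.sum_nonneg fun k _ => holderWeight_nonneg h _
      _ = _ := by ring
  obtain ⟨w', w'c, w'x, w'y, w'eq⟩ := hw.exists_continuous hlt.le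
  have hseries : ∀ P ∈ closedSlab b c, HasSum (fun k => modeTerm L M f k P) (w P : ℂ) := by
    rintro ⟨x, y, z⟩ hP
    have hz : z ∈ Icc b c := hP
    have e : ∀ k, coef L M k (fun P => (w' P : ℂ)) z = f k z := fun k =>
      coef_congr fun x y => by simp only [w'eq x y z hz]
    -- The case `h = 1` of Cauchy's inequality; setting the zero mode to `0` and putting it back
    -- does not affect summability.
    have hsum : Summable fun k => ‖coef L M k (fun P => (w' P : ℂ)) z‖ := by
      have h1 : Summable fun k => ‖Function.update (fun k => modeTerm L M f k (x, y, z)) 0 0 k‖ := by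
        refine summable_of_sum_le (c := Real.sqrt (32 * C * E * 1)) (fun k => norm_nonneg _)
          fun F => ?_
        rw [← Finset.sum_erase F (a := 0) (by simp)]
        refine cauchy _ 1 one_pos (fun k hk => ?_) _ fun k hk => Finset.ne_of_mem_erase hk
        rw [Function.update_of_ne hk]
        exact (hT hbc hk (hd.curve k)).1 _ hP
      have h2 : Summable fun k => ‖modeTerm L M f k (x, y, z)‖ := by
        have h3 : Function.update (fun k => ‖modeTerm L M f k (x, y, z)‖) 0 0 =
            fun k => ‖Function.update (fun k => modeTerm L M f k (x, y, z)) 0 0 k‖ := by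
          funext k
          by_cases hk : k = 0
          · subst hk; simp
          · simp [Function.update_of_ne hk]
        rw [← h3] at h1
        have := h1.update 0 ‖modeTerm L M f 0 (x, y, z)‖
        simpa using this
      refine h2.congr fun k => ?_
      rw [e, norm_modeTerm]
    have := hasSum_coef_mul_char hL hM (Complex.continuous_ofReal.comp w'c)
      (fun x y z => by simp only [Function.comp, w'x]) (fun x y z => by simp only [Function.comp, w'y])
      hsum x y
    simp only [Function.comp_def, e, w'eq x y z hz] at this
    exact this
  have hq0 : ∫ t in b..c, ‖q 0 t‖ ^ 2 ≤ E := by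
    have h1 := le_hasSum hA 0 fun k _ => hA0 k
    have h2 : modeEnergy L M b c f q 0 = ∫ t in b..c, ‖q 0 t‖ ^ 2 := by
      simp [modeEnergy, freqX, freqY]
    rwa [h2] at h1
  have hq0' : (c - b) * ∫ t in b..c, ‖q 0 t‖ ^ 2 ≤ H * E := by
    have : 0 ≤ ∫ t in b..c, ‖q 0 t‖ ^ 2 :=
      intervalIntegral.integral_nonneg hlt.le fun _ _ => sq_nonneg _
    gcongr
  have hzero : ∀ x ∈ Icc b c, ∀ y ∈ Icc b c, ‖f 0 x - f 0 y - (x - y : ℝ) * p 0 b‖ ≤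
      |x - y| * Real.sqrt (H * E) := fun x hx y hy => by
    have h1 := (hd.curve 0).norm_f_sub_sub_le hlt hx hy
    push_cast
    refine h1.trans ?_
    gcongr
  -- The affine function is the tangent of the zero mode at `b`. At zero frequency the energy
  -- reduces to `∫ ‖q‖²`, which controls only the deviation from the tangent.
  refine ⟨f 0 b, p 0 b, fun P hP => ?_, fun P hP P' hP' h hh hhH hx hy hz => ?_⟩
  · have h1 := norm_sub_le_of_sum_le (hseries P hP) 0
      (cauchy _ 1 one_pos fun k hk => (hT hbc hk (hd.curve k)).1 P hP)
    rw [modeTerm_zero] at h1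
    have h2 := hzero _ hP b (left_mem_Icc.2 hlt.le)
    have h3 : |P.2.2 - b| * Real.sqrt (H * E) ≤ H * Real.sqrt (H * E) := by
      gcongr
      rw [abs_of_nonneg (by linarith [hP.1])]
      linarith [hP.2]
    have e : (w P : ℂ) - (f 0 b + (P.2.2 - b : ℝ) * p 0 b) =
        ((w P : ℂ) - f 0 P.2.2) + (f 0 P.2.2 - f 0 b - (P.2.2 - b : ℝ) * p 0 b) := by ring
    rw [e]
    refine (complex_norm_add_sq_le _ _).trans ?_
    have s1 := pow_le_pow_left₀ (norm_nonneg _) h1 2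
    have s2 := pow_le_pow_left₀ (norm_nonneg _) (h2.trans h3) 2
    rw [Real.sq_sqrt (by positivity)] at s1
    rw [mul_pow, Real.sq_sqrt (by positivity)] at s2
    have : 0 ≤ (64 * C + 4 * H ^ 2) * (L * M)⁻¹ * S + 4 * H * S := by positivity
    have e3 : 64 * C * E + 2 * (H ^ 2 * (H * E)) = (64 * C + 2 * H ^ 3) * (L * M)⁻¹ * S := by
      rw [hE]; ring
    rw [add_mul, add_mul]
    linarith
  · have hD : HasSum (fun k => modeTerm L M f k P - modeTerm L M f k P') ((w P : ℂ) - w P') :=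
      (hseries P hP).sub (hseries P' hP')
    have h1 := norm_sub_le_of_sum_le hD 0 (cauchy _ h hh fun k hk =>
      (hT hbc hk (hd.curve k)).2 P hP P' hP' h hh hx hy hz)
    rw [modeTerm_zero, modeTerm_zero] at h1
    have h2 := hzero _ hP _ hP'
    have h3 : ‖f 0 P.2.2 - f 0 P'.2.2‖ ≤ h * Real.sqrt (H * E) + h * ‖p 0 b‖ := by
      have e : f 0 P.2.2 - f 0 P'.2.2 = (f 0 P.2.2 - f 0 P'.2.2 - (P.2.2 - P'.2.2 : ℝ) * p 0 b) +
        (P.2.2 - P'.2.2 : ℝ) * p 0 b := by ring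
      rw [e]
      refine (norm_add_le _ _).trans (add_le_add (h2.trans (by gcongr)) ?_)
      rw [norm_mul, Complex.norm_real, Real.norm_eq_abs]
      gcongr
    have e : (w P : ℂ) - w P' = ((w P : ℂ) - w P' - (f 0 P.2.2 - f 0 P'.2.2)) +
      (f 0 P.2.2 - f 0 P'.2.2) := by ring
    have e1 : (w P - w P') ^ 2 = ‖(w P : ℂ) - w P'‖ ^ 2 := by
      rw [← Complex.ofReal_sub, Complex.norm_real, Real.norm_eq_abs, sq_abs]
    rw [e1, e]
    refine (complex_norm_add_sq_le _ _).trans ?_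
    have s1 := pow_le_pow_left₀ (norm_nonneg _) h1 2
    have s2 := pow_le_pow_left₀ (norm_nonneg _) h3 2
    rw [Real.sq_sqrt (by positivity)] at s1
    have s3 : (h * Real.sqrt (H * E) + h * ‖p 0 b‖) ^ 2 ≤ h * (2 * H ^ 2 * E + 2 * H * ‖p 0 b‖ ^ 2) := by
      have r := Real.sq_sqrt (by positivity : 0 ≤ H * E)
      have : (h * Real.sqrt (H * E) + h * ‖p 0 b‖) ^ 2 ≤
          h * (h * (2 * (H * E) + 2 * ‖p 0 b‖ ^ 2)) := by
        generalize Real.sqrt (H * E) = a at r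
        rw [← r]
        linarith [sq_nonneg (h * (a - ‖p 0 b‖))]
      refine this.trans ?_
      have : h * (2 * (H * E) + 2 * ‖p 0 b‖ ^ 2) ≤ H * (2 * (H * E) + 2 * ‖p 0 b‖ ^ 2) := by gcongr
      calc _ ≤ h * (H * (2 * (H * E) + 2 * ‖p 0 b‖ ^ 2)) := by gcongr
        _ = _ := by ring
    have e3 : 64 * C * E * h + 4 * H ^ 2 * E * h = (64 * C + 4 * H ^ 2) * (L * M)⁻¹ * S * h := by
      rw [hE]; ring
    have r1 : 0 ≤ (64 * C + 2 * H ^ 3) * (L * M)⁻¹ * (S + ‖p 0 b‖ ^ 2) * h := by positivity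
    have r2 : 0 ≤ (64 * C + 4 * H ^ 2) * (L * M)⁻¹ * ‖p 0 b‖ ^ 2 * h := by positivity
    have r3 : 0 ≤ 4 * H * S * h := by positivity
    linarith

/-! ### Quasi-uniform nodes. -/

section Nodes

variable {κ ℓ : ℝ} {n : ℕ} {s : ℕ → ℝ}

theorem step_le_maxStep {i : ℕ} (hi : i < n) : s (i + 1) - s i ≤ maxStep n s :=
  le_ciSup (f := fun i : Fin n => s (i + 1) - s i) (Set.finite_range _).bddAbove ⟨i, hi⟩

theorem maxStep_le {D : ℝ} (hn : 0 < n) (h : ∀ i < n, s (i + 1) - s i ≤ D) : maxStep n s ≤ D := by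
  have : Nonempty (Fin n) := ⟨⟨0, hn⟩⟩
  exact ciSup_le fun i => h i i.2

namespace NoisySmoothing.QuasiUniform

theorem monotone (h : QuasiUniform κ n s) {i j : ℕ} (hij : i ≤ j) (hj : j ≤ n) : s i ≤ s j := by
  induction j, hij using Nat.le_induction with
  | base => exact le_rfl
  | succ j _ ih => exact (ih (by omega)).trans (h j (by omega)).1.le

theorem maxStep_pos (h : QuasiUniform κ n s) (hn : 0 < n) : 0 < maxStep n s :=
  (sub_pos.2 (h 0 hn).1).trans_le (step_le_maxStep hn)

theorem one_le (h : QuasiUniform κ n s) (hn : 0 < n) : 1 ≤ κ := by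
  have h1 := (h 0 hn).2
  have h2 : s (0 + 1) - s 0 ≤ maxStep n s := step_le_maxStep hn
  have h3 := sub_pos.2 (h 0 hn).1
  by_contra! hκ
  nlinarith

theorem mul_maxStep_le (h : QuasiUniform κ n s) {i j : ℕ} (hij : i ≤ j) (hj : j ≤ n) :
    ((j : ℝ) - i) * maxStep n s ≤ κ * (s j - s i) := by
  induction j, hij using Nat.le_induction with
  | base => simp
  | succ j _ ih =>
    have h1 := ih (by omega)
    have h2 := (h j (by omega)).2
    push_cast
    linarith

theorem sub_le_mul_maxStep {i j : ℕ} (hij : i ≤ j) (hj : j ≤ n) :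
    s j - s i ≤ ((j : ℝ) - i) * maxStep n s := by
  induction j, hij using Nat.le_induction with
  | base => simp
  | succ j _ ih =>
    have h1 := ih (by omega)
    have h2 := step_le_maxStep (s := s) (show j < n by omega)
    push_cast
    linarith

theorem maxStep_le_sub (h : QuasiUniform κ n s) (hn : 0 < n) : maxStep n s ≤ s n - s 0 :=
  maxStep_le hn fun i hi => by
    have h1 := h.monotone (show i + 1 ≤ n by omega) le_rfl
    have h2 := h.monotone (Nat.zero_le i) hi.le
    linarith

end NoisySmoothing.QuasiUniform

theorem NoisySmoothing.FillsPeriod.pos (h : FillsPeriod ℓ n s) (hℓ : 0 < ℓ) : 0 < n := by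
  rcases Nat.eq_zero_or_pos n with rfl | hn
  · have h2 := h.2
    -- The supremum over the empty family is `0`, so a single node cannot satisfy the condition on
    -- the gap to the next period.
    have : maxStep 0 s = 0 := by simp [maxStep]
    linarith
  · exact hn

end Nodes

theorem sum_range_sub_two_mul_sq (m : ℕ) :
    ∑ j ∈ Finset.range (m + 1), ((m : ℝ) - 2 * j) ^ 2 = (m : ℝ) * (m + 1) * (m + 2) / 3 := by
  have : ∀ N : ℕ, ∀ a : ℝ, ∑ j ∈ Finset.range (N + 1), (a - 2 * j) ^ 2 =
      (N + 1) * (a ^ 2 - 2 * a * N + 2 * N * (2 * N + 1) / 3) := by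
    intro N a
    induction N with
    | zero => simp
    | succ N ih => rw [Finset.sum_range_succ, ih]; push_cast; ring
  rw [this]; ring

/-- An affine function is controlled by its values at quasi-uniform nodes. -/
theorem sq_norm_le_mean_affine {κ b : ℝ} {v : ℕ} {z : ℕ → ℝ} (h : QuasiUniform κ v z)
    {k₀ k₁ : ℕ} (h0 : k₀ < k₁) (h1 : k₁ ≤ v) (α β : ℂ) :
    ‖β‖ ^ 2 * (z k₁ - z k₀) ^ 2 ≤ 12 * κ ^ 2 * (1 / ((k₁ : ℝ) - k₀ + 1) *
      ∑ k ∈ Finset.Icc k₀ k₁, ‖α + (z k - b : ℝ) * β‖ ^ 2) := by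
  obtain ⟨m, rfl⟩ := Nat.exists_eq_add_of_lt h0
  have hv : 0 < v := by omega
  have hκ := h.one_le hv
  set D := maxStep v z with hD
  have hD0 : 0 < D := h.maxStep_pos hv
  set n := m + 1 with hn
  have e : ∑ k ∈ Finset.Icc k₀ (k₀ + m + 1), ‖α + (z k - b : ℝ) * β‖ ^ 2 =
      ∑ j ∈ Finset.range (n + 1), ‖α + (z (k₀ + j) - b : ℝ) * β‖ ^ 2 := by
    rw [show Finset.Icc k₀ (k₀ + m + 1) = Finset.Ico k₀ (k₀ + m + 1 + 1) by ext; simp,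
      Finset.sum_Ico_eq_sum_range, show k₀ + m + 1 + 1 - k₀ = n + 1 by omega]
  rw [e]
  set F : ℕ → ℝ := fun j => ‖α + (z (k₀ + j) - b : ℝ) * β‖ ^ 2 with hF
  -- Node `j` is paired with its mirror image `n - j`, at distance at least `|n - 2j| D / κ`.
  -- Summing `(n - 2j)²` over all pairs gives order `n³`, so the constant is independent of `n`; the
  -- two end nodes alone would lose a factor of order `n` against the mean.
  have hrefl : ∑ j ∈ Finset.range (n + 1), F (n - j) = ∑ j ∈ Finset.range (n + 1), F j :=
    Finset.sum_range_reflect F (n + 1)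
  have gap : ∀ i j, i ≤ j → j ≤ n → ((j : ℝ) - i) * D ≤ κ * (z (k₀ + j) - z (k₀ + i)) := by
    intro i j hij hj
    have := h.mul_maxStep_le (i := k₀ + i) (j := k₀ + j) (by omega) (by omega)
    push_cast at this
    linarith
  have term : ∀ j ∈ Finset.range (n + 1),
      (D ^ 2 * ‖β‖ ^ 2) * ((n : ℝ) - 2 * j) ^ 2 ≤ 2 * κ ^ 2 * (F j + F (n - j)) := by
    intro j hj
    have hj' : j ≤ n := by rw [Finset.mem_range] at hj; omega
    have t1 := complex_norm_sub_sq_le (α + (z (k₀ + j) - b : ℝ) * β)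
      (α + (z (k₀ + (n - j)) - b : ℝ) * β)
    have e2 : (α + (z (k₀ + j) - b : ℝ) * β) - (α + (z (k₀ + (n - j)) - b : ℝ) * β) =
        (z (k₀ + j) - z (k₀ + (n - j)) : ℝ) * β := by push_cast; ring
    rw [e2, norm_mul, mul_pow, Complex.norm_real, Real.norm_eq_abs, sq_abs] at t1
    have t2 : (((n : ℝ) - 2 * j) * D) ^ 2 ≤ (κ * (z (k₀ + j) - z (k₀ + (n - j)))) ^ 2 := by
      rw [sq_le_sq]
      rcases le_total j (n - j) with hle | hle
      · have := gap j (n - j) hle (by omega)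
        rw [Nat.cast_sub hj'] at this
        have p : 0 ≤ ((n : ℝ) - 2 * j) * D := by
          have : (j : ℝ) ≤ ((n - j : ℕ) : ℝ) := by exact_mod_cast hle
          rw [Nat.cast_sub hj'] at this
          exact mul_nonneg (by linarith) hD0.le
        rw [abs_of_nonneg p]
        refine le_trans ?_ (neg_le_abs _)
        linarith
      · have := gap (n - j) j hle hj'
        rw [Nat.cast_sub hj'] at this
        have p : ((n : ℝ) - 2 * j) * D ≤ 0 := by
          have : ((n - j : ℕ) : ℝ) ≤ (j : ℝ) := by exact_mod_cast hle
          rw [Nat.cast_sub hj'] at this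
          exact mul_nonpos_of_nonpos_of_nonneg (by linarith) hD0.le
        rw [abs_of_nonpos p]
        refine le_trans ?_ (le_abs_self _)
        linarith
    calc (D ^ 2 * ‖β‖ ^ 2) * ((n : ℝ) - 2 * j) ^ 2 = (((n : ℝ) - 2 * j) * D) ^ 2 * ‖β‖ ^ 2 := by ring
      _ ≤ (κ * (z (k₀ + j) - z (k₀ + (n - j)))) ^ 2 * ‖β‖ ^ 2 := by gcongr
      _ = κ ^ 2 * ((z (k₀ + j) - z (k₀ + (n - j))) ^ 2 * ‖β‖ ^ 2) := by ring
      _ ≤ κ ^ 2 * (2 * F j + 2 * F (n - j)) := by gcongr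
      _ = _ := by ring
  have tot := Finset.sum_le_sum term
  rw [← Finset.mul_sum, ← Finset.mul_sum, Finset.sum_add_distrib, hrefl,
    sum_range_sub_two_mul_sq] at tot
  have len := QuasiUniform.sub_le_mul_maxStep (s := z) (n := v) (i := k₀) (j := k₀ + m + 1)
    (by omega) h1
  have mono := h.monotone (i := k₀) (j := k₀ + m + 1) (by omega) h1
  have hn0 : (0 : ℝ) < n := by rw [hn]; positivity
  have hcast : ((k₀ + m + 1 : ℕ) : ℝ) - k₀ = n := by rw [hn]; push_cast; ring
  rw [hcast] at len ⊢
  have hlen : (z (k₀ + m + 1) - z k₀) ^ 2 ≤ (n * D) ^ 2 := by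
    gcongr
  refine (mul_le_mul_of_nonneg_left hlen (sq_nonneg ‖β‖)).trans ?_
  rw [one_div_mul_eq_div, ← mul_div_assoc, le_div_iff₀ (by positivity)]
  have : ‖β‖ ^ 2 * (n * D) ^ 2 * (n + 1) ≤ 3 * (D ^ 2 * ‖β‖ ^ 2 * (n * (n + 1) * (n + 2) / 3)) := by
    have : 0 ≤ ‖β‖ ^ 2 * D ^ 2 * (n + 1) * n := by positivity
    nlinarith
  linarith

/-! ### Node averages and the sampling inequality. -/

/-- The average over the nodes of the grid. -/
def nodeAvg (p q k₀ k₁ : ℕ) (g : ℕ → ℕ → ℕ → ℝ) : ℝ :=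
  1 / ((p : ℝ) + 1) * (1 / ((q : ℝ) + 1)) * (1 / ((k₁ : ℝ) - (k₀ : ℝ) + 1)) *
    ∑ i ∈ Finset.range (p + 1), ∑ j ∈ Finset.range (q + 1), ∑ k ∈ Finset.Icc k₀ k₁, g i j k

section NodeAvg

variable {p q k₀ k₁ : ℕ} {g g' : ℕ → ℕ → ℕ → ℝ}

theorem nodeAvg_weight_pos (hk : k₀ ≤ k₁) :
    0 < 1 / ((p : ℝ) + 1) * (1 / ((q : ℝ) + 1)) * (1 / ((k₁ : ℝ) - (k₀ : ℝ) + 1)) := by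
  have : (k₀ : ℝ) ≤ k₁ := by exact_mod_cast hk
  have : 0 < (k₁ : ℝ) - k₀ + 1 := by linarith
  positivity

theorem nodeAvg_mono (hk : k₀ ≤ k₁)
    (h : ∀ i j k, i ≤ p → j ≤ q → k₀ ≤ k → k ≤ k₁ → g i j k ≤ g' i j k) :
    nodeAvg p q k₀ k₁ g ≤ nodeAvg p q k₀ k₁ g' := by
  refine mul_le_mul_of_nonneg_left ?_ (nodeAvg_weight_pos hk).le
  refine Finset.sum_le_sum fun i hi => Finset.sum_le_sum fun j hj => Finset.sum_le_sum fun k hk => ?_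
  rw [Finset.mem_range] at hi hj
  rw [Finset.mem_Icc] at hk
  exact h i j k (by omega) (by omega) hk.1 hk.2

theorem nodeAvg_nonneg (hk : k₀ ≤ k₁) (h : ∀ i j k, 0 ≤ g i j k) : 0 ≤ nodeAvg p q k₀ k₁ g :=
  mul_nonneg (nodeAvg_weight_pos hk).le (Finset.sum_nonneg fun i _ => Finset.sum_nonneg fun j _ =>
    Finset.sum_nonneg fun k _ => h i j k)

theorem nodeAvg_add : nodeAvg p q k₀ k₁ (fun i j k => g i j k + g' i j k) =
    nodeAvg p q k₀ k₁ g + nodeAvg p q k₀ k₁ g' := by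
  simp only [nodeAvg, Finset.sum_add_distrib, mul_add]

theorem nodeAvg_const_mul (r : ℝ) : nodeAvg p q k₀ k₁ (fun i j k => r * g i j k) =
    r * nodeAvg p q k₀ k₁ g := by
  simp only [nodeAvg, ← Finset.mul_sum]; ring

theorem nodeAvg_of_z (g : ℕ → ℝ) : nodeAvg p q k₀ k₁ (fun _ _ k => g k) =
    1 / ((k₁ : ℝ) - k₀ + 1) * ∑ k ∈ Finset.Icc k₀ k₁, g k := by
  have hp : (p : ℝ) + 1 ≠ 0 := by positivity
  have hq : (q : ℝ) + 1 ≠ 0 := by positivity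
  simp only [nodeAvg, Finset.sum_const, Finset.card_range, nsmul_eq_mul]
  push_cast
  field_simp

theorem nodeAvg_const (hk : k₀ ≤ k₁) (r : ℝ) : nodeAvg p q k₀ k₁ (fun _ _ _ => r) = r := by
  rw [nodeAvg_of_z]
  have : (k₀ : ℝ) ≤ k₁ := by exact_mod_cast hk
  have : (k₁ : ℝ) - k₀ + 1 ≠ 0 := by linarith
  simp only [Finset.sum_const, Nat.card_Icc, nsmul_eq_mul]
  rw [Nat.cast_sub (by omega)]
  push_cast
  have e : (k₁ : ℝ) + 1 - k₀ = k₁ - k₀ + 1 := by ring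
  rw [e]
  field_simp

end NodeAvg

theorem intervalIntegral_le_of_nodes {s : ℕ → ℝ} {D : ℝ} {g : ℝ → ℝ} (hg : Continuous g)
    {N : ℕ} {B : ℕ → ℝ} (hs : ∀ i < N, s i ≤ s (i + 1) ∧ s (i + 1) - s i ≤ D)
    (hB : ∀ i < N, 0 ≤ B i) (h : ∀ i < N, ∀ x ∈ Icc (s i) (s (i + 1)), g x ≤ B i) :
    ∫ x in s 0..s N, g x ≤ D * ∑ i ∈ Finset.range N, B i := by
  induction N with
  | zero => simp
  | succ N ih =>
    have h1 := ih (fun i hi => hs i (by omega)) (fun i hi => hB i (by omega))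
      (fun i hi => h i (by omega))
    rw [← intervalIntegral.integral_add_adjacent_intervals (b := s N)
      (hg.intervalIntegrable _ _) (hg.intervalIntegrable _ _), Finset.sum_range_succ, mul_add]
    refine add_le_add h1 ?_
    obtain ⟨h2, h3⟩ := hs N (by omega)
    have h4 := intervalIntegral.integral_mono_on (μ := volume) h2 (hg.intervalIntegrable _ _)
      intervalIntegrable_const (h N (by omega))
    rw [intervalIntegral.integral_const, smul_eq_mul] at h4
    exact h4.trans (mul_le_mul_of_nonneg_right h3 (hB N (by omega)))

/-- The upper Riemann sum over the boxes, obtained by using the one-dimensional estimate in each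
variable in turn. -/
theorem tripleIntegral_le_of_nodes {x y z : ℕ → ℝ} {D₁ D₂ D₃ : ℝ} (hD₂ : 0 ≤ D₂) (hD₃ : 0 ≤ D₃)
    {G : Pt → ℝ} (hG : Continuous G) {p q m : ℕ} {B : ℕ → ℕ → ℕ → ℝ}
    (hx : ∀ i < p, x i ≤ x (i + 1) ∧ x (i + 1) - x i ≤ D₁)
    (hy : ∀ i < q, y i ≤ y (i + 1) ∧ y (i + 1) - y i ≤ D₂)
    (hz : ∀ i < m, z i ≤ z (i + 1) ∧ z (i + 1) - z i ≤ D₃)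
    (hB : ∀ i j k, 0 ≤ B i j k)
    (h : ∀ i < p, ∀ j < q, ∀ k < m, ∀ X ∈ Icc (x i) (x (i + 1)), ∀ Y ∈ Icc (y j) (y (j + 1)),
      ∀ Z ∈ Icc (z k) (z (k + 1)), G (X, Y, Z) ≤ B i j k) :
    ∫ X in x 0..x p, ∫ Y in y 0..y q, ∫ Z in z 0..z m, G (X, Y, Z) ≤
      D₁ * (D₂ * (D₃ * ∑ i ∈ Finset.range p, ∑ j ∈ Finset.range q, ∑ k ∈ Finset.range m,
        B i j k)) := by
  have c1 : Continuous fun XY : ℝ × ℝ => ∫ Z in z 0..z m, G (XY.1, XY.2, Z) :=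
    intervalIntegral.continuous_parametric_intervalIntegral_of_continuous' (by
      exact hG.comp (by fun_prop)) _ _
  have c2 : Continuous fun X : ℝ => ∫ Y in y 0..y q, ∫ Z in z 0..z m, G (X, Y, Z) :=
    intervalIntegral.continuous_parametric_intervalIntegral_of_continuous' (by exact c1) _ _
  simp_rw [Finset.mul_sum]
  have e : D₁ * ∑ i ∈ Finset.range p, (D₂ * ∑ j ∈ Finset.range q, (D₃ * ∑ k ∈ Finset.range m,
      B i j k)) = ∑ i ∈ Finset.range p, ∑ j ∈ Finset.range q, ∑ k ∈ Finset.range m,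
        D₁ * (D₂ * (D₃ * B i j k)) := by
    simp_rw [Finset.mul_sum]
  rw [← e]
  have s3 : ∀ i j, 0 ≤ D₃ * ∑ k ∈ Finset.range m, B i j k := fun i j =>
    mul_nonneg hD₃ (Finset.sum_nonneg fun k _ => hB i j k)
  refine intervalIntegral_le_of_nodes c2 hx (fun i _ => mul_nonneg hD₂
    (Finset.sum_nonneg fun j _ => s3 i j)) fun i hi X hX => ?_
  refine intervalIntegral_le_of_nodes (c1.comp (by fun_prop : Continuous fun Y => (X, Y))) hy
    (fun j _ => s3 i j) fun j hj Y hY => ?_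
  exact intervalIntegral_le_of_nodes (hG.comp (by fun_prop : Continuous fun Z => (X, Y, Z))) hz
    (fun k _ => hB i j k) fun k hk Z hZ => h i hi j hj k hk X hX Y hY Z hZ

/-- By periodicity the cell may start at any point, in particular at the first nodes of the grid. -/
theorem l2NormSq_eq_intervalIntegral {L M b c : ℝ} (hL : 0 < L) (hM : 0 < M) (hbc : b ≤ c)
    {w : Pt → ℝ} (hw : Continuous w) (hx : ∀ x y z, w (x + L, y, z) = w (x, y, z))
    (hy : ∀ x y z, w (x, y + M, z) = w (x, y, z)) (x₀ y₀ : ℝ) :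
    l2NormSq L M b c w =
      ∫ x in x₀..x₀ + L, ∫ y in y₀..y₀ + M, ∫ z in b..c, w (x, y, z) ^ 2 := by
  have hi : Integrable (fun P => w P ^ 2) (volume.restrict (cell L M b c)) :=
    (memLp_cell_of_continuousOn hw.continuousOn).integrable_sq
  unfold l2NormSq
  have px : Function.Periodic (fun x => ∫ y in y₀..y₀ + M, ∫ z in b..c, w (x, y, z) ^ 2) L :=
    fun x => by simp only [hx]
  have py : ∀ x, Function.Periodic (fun y => ∫ z in b..c, w (x, y, z) ^ 2) M :=
    fun x y => by simp only [hy]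
  rw [px.intervalIntegral_add_eq x₀ 0]
  simp_rw [fun x => (py x).intervalIntegral_add_eq y₀ 0]
  rw [zero_add, zero_add]
  rw [restrict_cell] at hi ⊢
  rw [integral_prod _ hi, intervalIntegral.integral_of_le hL.le]
  refine integral_congr_ae ?_
  filter_upwards [hi.prod_right_ae] with x hx
  rw [integral_prod _ hx, intervalIntegral.integral_of_le hM.le]
  refine integral_congr_ae (Filter.Eventually.of_forall fun y => ?_)
  simp only
  rw [intervalIntegral.integral_of_le hbc, integral_Ioc_eq_integral_Ioo]

/-- The nodes `s 0 < ⋯ < s n`, followed by the end `s 0 + ℓ` of the period. -/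
def periodNodes (ℓ : ℝ) (n : ℕ) (s : ℕ → ℝ) (i : ℕ) : ℝ := if i ≤ n then s i else s 0 + ℓ

theorem periodNodes_zero (ℓ : ℝ) (n : ℕ) (s : ℕ → ℝ) : periodNodes ℓ n s 0 = s 0 := by
  simp [periodNodes]

theorem periodNodes_last (ℓ : ℝ) (n : ℕ) (s : ℕ → ℝ) : periodNodes ℓ n s (n + 1) = s 0 + ℓ := by
  simp [periodNodes]

theorem periodNodes_of_lt {ℓ : ℝ} {n : ℕ} {s : ℕ → ℝ} {i : ℕ} (hi : i < n + 1) :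
    periodNodes ℓ n s i = s i := by
  rw [periodNodes, if_pos (by omega)]

theorem periodNodes_step {ℓ κ : ℝ} {n : ℕ} {s : ℕ → ℝ} (h : QuasiUniform κ n s)
    (hf : FillsPeriod ℓ n s) : ∀ i < n + 1, periodNodes ℓ n s i ≤ periodNodes ℓ n s (i + 1) ∧
      periodNodes ℓ n s (i + 1) - periodNodes ℓ n s i ≤ maxStep n s := by
  intro i hi
  rw [periodNodes_of_lt hi]
  rcases Nat.lt_succ_iff_lt_or_eq.1 hi with h1 | rfl
  · rw [periodNodes_of_lt (by omega)]
    exact ⟨(h i h1).1.le, step_le_maxStep h1⟩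
  · rw [periodNodes_last]
    exact ⟨hf.1, hf.2⟩

/-- The number of nodes times the mesh size is comparable to the period, so the weights of a Riemann
sum are bounded by those of a node average. The factor two absorbs `n + 1 ≤ 2n`. -/
theorem succ_mul_maxStep_le {ℓ κ : ℝ} (hℓ : 0 < ℓ) {n : ℕ} {s : ℕ → ℝ} (h : QuasiUniform κ n s)
    (hf : FillsPeriod ℓ n s) : ((n : ℝ) + 1) * maxStep n s ≤ 2 * κ * ℓ := by
  have hn := hf.pos hℓ
  have h1 := h.mul_maxStep_le (Nat.zero_le n) le_rfl
  have h2 := h.maxStep_pos hn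
  have h3 := h.one_le hn
  have h4 : (1 : ℝ) ≤ n := by exact_mod_cast hn
  rw [Nat.cast_zero, sub_zero] at h1
  have h5 : κ * (s n - s 0) ≤ κ * ℓ := by
    gcongr
    linarith [hf.1]
  nlinarith

theorem nodeAvg_weight_mul {p q k₀ k₁ : ℕ} (hk : k₀ ≤ k₁) (g : ℕ → ℕ → ℕ → ℝ) :
    ∑ i ∈ Finset.range (p + 1), ∑ j ∈ Finset.range (q + 1), ∑ k ∈ Finset.Icc k₀ k₁, g i j k =
      ((p : ℝ) + 1) * ((q : ℝ) + 1) * ((k₁ : ℝ) - k₀ + 1) * nodeAvg p q k₀ k₁ g := by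
  have : (k₀ : ℝ) ≤ k₁ := by exact_mod_cast hk
  have : (k₁ : ℝ) - k₀ + 1 ≠ 0 := by linarith
  unfold nodeAvg
  field_simp

/-- At the nodes the affine part is the function minus a remainder of square at most `K`, so its
mean square is at most `2 E + 2 K`; the bound for affine functions then yields the slope. -/
theorem sq_norm_slope_le {κ ρ b c K : ℝ} (hρ : 0 < ρ) (hbc : ρ ≤ c - b) {p q v k₀ k₁ : ℕ}
    {x y z : ℕ → ℝ} (qz : QuasiUniform κ v z) (hk : k₀ < k₁) (hkv : k₁ ≤ v)
    (hzb : z k₀ = b) (hzc : z k₁ = c) {w : Pt → ℝ} {α β : ℂ}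
    (hsup : ∀ P ∈ closedSlab b c, ‖(w P : ℂ) - (α + (P.2.2 - b : ℝ) * β)‖ ^ 2 ≤ K) :
    ‖β‖ ^ 2 ≤ 24 * κ ^ 2 / ρ ^ 2 *
      (nodeAvg p q k₀ k₁ (fun i j k => w (x i, y j, z k) ^ 2) + K) := by
  set E := nodeAvg p q k₀ k₁ (fun i j k => w (x i, y j, z k) ^ 2) with hE
  have hmem : ∀ k, k₀ ≤ k → k ≤ k₁ → z k ∈ Icc b c := fun k h1 h2 =>
    ⟨hzb ▸ qz.monotone h1 (h2.trans hkv), hzc ▸ qz.monotone h2 hkv⟩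
  have h1 := sq_norm_le_mean_affine (b := b) qz hk hkv α β
  rw [← nodeAvg_of_z (p := p) (q := q)] at h1
  have h2 : nodeAvg p q k₀ k₁ (fun _ _ k => ‖α + (z k - b : ℝ) * β‖ ^ 2) ≤ 2 * E + 2 * K := by
    rw [hE, ← nodeAvg_const_mul, ← nodeAvg_const (p := p) (q := q) hk.le (2 * K), ← nodeAvg_add]
    refine nodeAvg_mono hk.le fun i j k _ _ hk1 hk2 => ?_
    have h3 := hsup (x i, y j, z k) (hmem k hk1 hk2)
    have h4 := complex_norm_sub_sq_le (w (x i, y j, z k) : ℂ)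
      ((w (x i, y j, z k) : ℂ) - (α + (z k - b : ℝ) * β))
    rw [sub_sub_cancel, Complex.norm_real, Real.norm_eq_abs, sq_abs] at h4
    linarith
  have h5 : ‖β‖ ^ 2 * ρ ^ 2 ≤ ‖β‖ ^ 2 * (z k₁ - z k₀) ^ 2 := by
    rw [hzb, hzc]; gcongr
  have h6 : ‖β‖ ^ 2 * ρ ^ 2 ≤ 24 * κ ^ 2 * (E + K) := by
    refine (h5.trans h1).trans ?_
    calc _ ≤ 12 * κ ^ 2 * (2 * E + 2 * K) := by gcongr
      _ = _ := by ring
  rw [div_mul_eq_mul_div, le_div_iff₀ (by positivity)]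
  exact h6

/-- The integral of the square of a function that varies little over the boxes of a grid. -/
theorem l2NormSq_le_sum_boxes {L M κ b c Q : ℝ} (hL : 0 < L) (hM : 0 < M) (hbc : b < c)
    {p q v k₀ m : ℕ} {x y z : ℕ → ℝ} (qx : QuasiUniform κ p x) (fx : FillsPeriod L p x)
    (qy : QuasiUniform κ q y) (fy : FillsPeriod M q y) (qz : QuasiUniform κ v z) (hv : 0 < v)
    (hkv : k₀ + m ≤ v) (hzb : z k₀ = b) (hzc : z (k₀ + m) = c) {w : Pt → ℝ}
    (hw : MemH2 L M b c w) (hQ : 0 ≤ Q)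
    (hosc : ∀ P ∈ closedSlab b c, ∀ P' ∈ closedSlab b c, |P.1 - P'.1| ≤ meshSize p q v x y z →
      |P.2.1 - P'.2.1| ≤ meshSize p q v x y z → |P.2.2 - P'.2.2| ≤ meshSize p q v x y z →
      (w P - w P') ^ 2 ≤ Q) :
    l2NormSq L M b c w ≤ maxStep p x * (maxStep q y * (maxStep v z *
      ∑ i ∈ Finset.range (p + 1), ∑ j ∈ Finset.range (q + 1), ∑ k ∈ Finset.range m,
        (2 * w (x i, y j, z (k₀ + k)) ^ 2 + 2 * Q))) := by
  have hdx : maxStep p x ≤ meshSize p q v x y z := le_max_left _ _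
  have hdy : maxStep q y ≤ meshSize p q v x y z := (le_max_left _ _).trans (le_max_right _ _)
  have hdz : maxStep v z ≤ meshSize p q v x y z := (le_max_right _ _).trans (le_max_right _ _)
  have hmem : ∀ k ≤ m, z (k₀ + k) ∈ Icc b c := fun k h2 =>
    ⟨hzb ▸ qz.monotone (Nat.le_add_right _ _) (by omega),
      hzc ▸ qz.monotone (Nat.add_le_add_left h2 _) hkv⟩
  obtain ⟨w', w'c, w'x, w'y, w'eq⟩ := hw.exists_continuous hbc.le
  have hl2 : l2NormSq L M b c w = l2NormSq L M b c w' := by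
    refine setIntegral_congr_fun (measurableSet_cell L M b c) fun P hP => ?_
    have := w'eq P.1 P.2.1 P.2.2 (Ioo_subset_Icc_self hP.2.2)
    change w P ^ 2 = w' P ^ 2
    rw [← this]
  -- Each box is represented by its lower corner. Horizontally the gap to the next period gives as
  -- many boxes as nodes; vertically the last node is the corner of no box.
  have hbox := tripleIntegral_le_of_nodes (x := periodNodes L p x) (y := periodNodes M q y)
    (z := fun k => z (k₀ + k)) (G := fun P => w' P ^ 2) (p := p + 1) (q := q + 1) (m := m)
    (qy.maxStep_pos (fy.pos hM)).le (qz.maxStep_pos hv).le (w'c.pow 2)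
    (periodNodes_step qx fx) (periodNodes_step qy fy)
    (fun k hk => ⟨(qz (k₀ + k) (by omega)).1.le,
      step_le_maxStep (s := z) (i := k₀ + k) (by omega)⟩)
    (B := fun i j k => 2 * w (x i, y j, z (k₀ + k)) ^ 2 + 2 * Q) (fun i j k => by positivity) (by
      intro i hi j hj k hk X hX Y hY Z hZ
      have sx := (periodNodes_step qx fx i hi).2
      have sy := (periodNodes_step qy fy j hj).2
      have sz : z (k₀ + (k + 1)) - z (k₀ + k) ≤ maxStep v z :=
        step_le_maxStep (s := z) (i := k₀ + k) (by omega)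
      rw [periodNodes_of_lt hi] at hX sx
      rw [periodNodes_of_lt hj] at hY sy
      have m1 := hmem k hk.le
      have m2 := hmem (k + 1) hk
      have hZ' : Z ∈ Icc b c := ⟨m1.1.trans hZ.1, hZ.2.trans m2.2⟩
      have h1 := hosc (X, Y, Z) hZ' (x i, y j, z (k₀ + k)) m1
        (by rw [abs_of_nonneg (sub_nonneg.2 hX.1)]; linarith [hX.2])
        (by rw [abs_of_nonneg (sub_nonneg.2 hY.1)]; linarith [hY.2])
        (by rw [abs_of_nonneg (sub_nonneg.2 hZ.1)]; linarith [hZ.2])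
      rw [w'eq X Y Z hZ']
      linarith [sq_nonneg (w (X, Y, Z) - 2 * w (x i, y j, z (k₀ + k)))])
  rw [periodNodes_zero, periodNodes_last, periodNodes_zero, periodNodes_last] at hbox
  change (∫ X in x 0..x 0 + L, ∫ Y in y 0..y 0 + M, ∫ Z in z k₀..z (k₀ + m),
    w' (X, Y, Z) ^ 2) ≤ _ at hbox
  rwa [hzb, hzc, ← l2NormSq_eq_intervalIntegral hL hM hbc.le w'c w'x w'y, ← hl2] at hbox

/-- A sampling inequality: the `L²` norm of a periodic `H²` function is controlled by its mean square
over the nodes of a quasi-uniform grid, up to the mesh size. -/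
theorem exists_l2NormSq_le_nodeAvg {L M : ℝ} (hL : 0 < L) (hM : 0 < M) {ρ H κ : ℝ} (hρ : 0 < ρ)
    (hH : 0 < H) (hκ : 1 ≤ κ) :
    ∃ C, 0 ≤ C ∧ ∀ {b c : ℝ}, ρ ≤ c - b → c - b ≤ H →
      ∀ {p q v k₀ k₁ : ℕ} {x y z : ℕ → ℝ}, QuasiUniform κ p x → FillsPeriod L p x →
        QuasiUniform κ q y → FillsPeriod M q y → QuasiUniform κ v z → k₀ ≤ k₁ → k₁ ≤ v →
        z k₀ = b → z k₁ = c → meshSize p q v x y z ≤ H →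
      ∀ {w : Pt → ℝ}, MemH2 L M b c w →
        l2NormSq L M b c w ≤ C * (nodeAvg p q k₀ k₁ (fun i j k => w (x i, y j, z k) ^ 2) +
          (secondNormSq L M b c w + nodeAvg p q k₀ k₁ (fun i j k => w (x i, y j, z k) ^ 2)) *
            meshSize p q v x y z) := by
  obtain ⟨C, hC, hHol⟩ := exists_sup_holder hL hM hρ hH
  set T := 24 * κ ^ 2 / ρ ^ 2 with hT
  have hT0 : 0 ≤ T := by positivity
  refine ⟨16 * κ ^ 3 * L * M * H * (1 + C * (1 + T + T * C)), by positivity, ?_⟩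
  intro b c hbc hcH p q v k₀ k₁ x y z qx fx qy fy qz hk hkv hzb hzc hdH w hw
  have hlt : b < c := by linarith
  have hk' : k₀ < k₁ := lt_of_le_of_ne hk fun h => by
    rw [h, hzc] at hzb; linarith
  have hv : 0 < v := by omega
  obtain ⟨α, β, hsup, hhol⟩ := hHol hbc hcH hw
  have hβ := sq_norm_slope_le (p := p) (q := q) (x := x) (y := y)
    hρ hbc qz hk' hkv hzb hzc hsup
  have hS0 : 0 ≤ secondNormSq L M b c w := secondNormSq_nonneg _ _ _ _ _
  have hE0 : 0 ≤ nodeAvg p q k₀ k₁ (fun i j k => w (x i, y j, z k) ^ 2) :=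
    nodeAvg_nonneg hk fun _ _ _ => sq_nonneg _
  have hd1 := qx.maxStep_pos (fx.pos hL)
  have hd2 := qy.maxStep_pos (fy.pos hM)
  have hd3 := qz.maxStep_pos hv
  have hd0 : 0 < meshSize p q v x y z := hd1.trans_le (le_max_left _ _)
  have hbox := fun m (hm : k₁ = k₀ + m) => l2NormSq_le_sum_boxes hL hM hlt qx fx qy fy qz hv
    (m := m) (Q := C * (secondNormSq L M b c w + ‖β‖ ^ 2) * meshSize p q v x y z)
    (hm ▸ hkv) hzb (hm ▸ hzc) hw (by positivity)
    (fun P hP P' hP' h1 h2 h3 => hhol P hP P' hP' _ hd0 hdH h1 h2 h3)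
  have hE : ∀ Q, nodeAvg p q k₀ k₁ (fun i j k => 2 * w (x i, y j, z k) ^ 2 + 2 * Q) =
      2 * nodeAvg p q k₀ k₁ (fun i j k => w (x i, y j, z k) ^ 2) + 2 * Q := fun Q => by
    rw [nodeAvg_add, nodeAvg_const_mul, nodeAvg_const hk]
  set d := meshSize p q v x y z
  set S := secondNormSq L M b c w
  set E := nodeAvg p q k₀ k₁ (fun i j k => w (x i, y j, z k) ^ 2)
  set Q := C * (S + ‖β‖ ^ 2) * d with hQ
  have hQ0 : 0 ≤ Q := by positivity
  obtain ⟨m, rfl⟩ := Nat.exists_eq_add_of_le hk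
  have hm : (1 : ℝ) ≤ m := by
    have : 1 ≤ m := by omega
    exact_mod_cast this
  -- The vertical sum lacks the last node. Adding its nonnegative term turns the sum into a full
  -- node average.
  have hsum : ∑ i ∈ Finset.range (p + 1), ∑ j ∈ Finset.range (q + 1), ∑ k ∈ Finset.range m,
      (2 * w (x i, y j, z (k₀ + k)) ^ 2 + 2 * Q) ≤
      ((p : ℝ) + 1) * ((q : ℝ) + 1) * ((m : ℝ) + 1) * (2 * E + 2 * Q) := by
    have e1 := nodeAvg_weight_mul (p := p) (q := q) hk
      (fun i j k => 2 * w (x i, y j, z k) ^ 2 + 2 * Q)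
    have e2 : ((k₀ + m : ℕ) : ℝ) - k₀ + 1 = m + 1 := by push_cast; ring
    rw [hE, e2] at e1
    rw [← e1]
    refine Finset.sum_le_sum fun i _ => Finset.sum_le_sum fun j _ => ?_
    have e3 := Finset.sum_Ico_eq_sum_range (fun k => 2 * w (x i, y j, z k) ^ 2 + 2 * Q) k₀ (k₀ + m)
    rw [Nat.add_sub_cancel_left] at e3
    rw [← e3]
    exact Finset.sum_le_sum_of_subset_of_nonneg Finset.Ico_subset_Icc_self
      fun k _ _ => by positivity
  have g1 := succ_mul_maxStep_le hL qx fx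
  have g2 := succ_mul_maxStep_le hM qy fy
  have g3 : ((m : ℝ) + 1) * maxStep v z ≤ 2 * κ * H := by
    have h1 := qz.mul_maxStep_le hk hkv
    rw [hzb, hzc] at h1
    have e2 : ((k₀ + m : ℕ) : ℝ) - k₀ = m := by push_cast; ring
    rw [e2] at h1
    have h2 : κ * (c - b) ≤ κ * H := by gcongr
    have h3 : maxStep v z ≤ m * maxStep v z := le_mul_of_one_le_left hd3.le hm
    linarith
  have fin : l2NormSq L M b c w ≤ 16 * κ ^ 3 * L * M * H * (E + Q) := by
    refine (hbox m rfl).trans ?_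
    calc _ ≤ maxStep p x * (maxStep q y * (maxStep v z *
          (((p : ℝ) + 1) * ((q : ℝ) + 1) * ((m : ℝ) + 1) * (2 * E + 2 * Q)))) := by gcongr
      _ = (((p : ℝ) + 1) * maxStep p x) * ((((q : ℝ) + 1) * maxStep q y) *
          ((((m : ℝ) + 1) * maxStep v z) * (2 * E + 2 * Q))) := by ring
      _ ≤ (2 * κ * L) * ((2 * κ * M) * ((2 * κ * H) * (2 * E + 2 * Q))) := by gcongr
      _ = _ := by ring
  refine fin.trans ?_
  rw [mul_assoc _ (1 + C * (1 + T + T * C))]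
  gcongr
  have hQ' : Q ≤ C * (1 + T + T * C) * ((S + E) * d) := by
    have : S + ‖β‖ ^ 2 ≤ (1 + T + T * C) * (S + E) := by
      have h1 : 0 ≤ T * S := by positivity
      have h2 : 0 ≤ T * C * E := by positivity
      linarith
    calc Q ≤ C * ((1 + T + T * C) * (S + E)) * d := by rw [hQ]; gcongr
      _ = _ := by ring
  have r1 : 0 ≤ (S + E) * d := by positivity
  have r2 : 0 ≤ C * (1 + T + T * C) * E := by positivity
  linarith

/-! ### Interpolation, the minimizer and the final estimate. -/

/-- Interpolation: the `H¹` norm is controlled by the `L²` norm and the second derivatives. -/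
theorem h1NormSq_le {L M b c : ℝ} (hL : 0 < L) (hM : 0 < M) {w : Pt → ℝ} (hw : MemH2 L M b c w)
    {s : ℝ} (hs : 0 < s) (hsc : s ≤ c - b) :
    h1NormSq L M b c w ≤
      (1 + 650 / s ^ 2) * l2NormSq L M b c w + 2 * s ^ 2 * secondNormSq L M b c w := by
  have hbc : b < c := by linarith
  obtain ⟨p, q, h⟩ := hw.fourierData hL hM hbc
  have hLM : 0 < (L * M)⁻¹ := inv_pos.2 (mul_pos hL hM)
  have S1 := ((h.sum_f.add h.sum_x).add h.sum_y).add h.sum_z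
  -- The constant is `648` from the vertical derivative plus one for each horizontal direction,
  -- where `X² ≤ 1/s² + s² X⁴`.
  have S2 := (h.sum_f.mul_left (1 + 650 / s ^ 2)).add (h.hasSum_modeEnergy.mul_left (2 * s ^ 2))
  have key := hasSum_le (fun k => ?_) S1 S2
  · rw [h1NormSq, Fin.sum_univ_three]
    refine le_of_mul_le_mul_left ?_ hLM
    linarith
  · rw [show 2 * Real.pi * (k.1 : ℝ) / L = freqX L k from rfl,
      show 2 * Real.pi * (k.2 : ℝ) / M = freqY M k from rfl, modeEnergy]
    have h1 := (h.curve k).integral_sq_p_le hs hsc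
    have hI : 0 ≤ ∫ z in b..c, ‖coef L M k (fun P => (w P : ℂ)) z‖ ^ 2 :=
      intervalIntegral.integral_nonneg hbc.le fun _ _ => sq_nonneg _
    have young : ∀ X : ℝ, X ^ 2 ≤ 1 / s ^ 2 + s ^ 2 * X ^ 4 := fun X => by
      have h2 : (1 / s) * s = 1 := one_div_mul_cancel hs.ne'
      have h3 : 1 / s ^ 2 + s ^ 2 * X ^ 4 - X ^ 2 = (1 / s - s * X ^ 2) ^ 2 + X ^ 2 := by
        have e : (1 / s - s * X ^ 2) ^ 2 = 1 / s ^ 2 - 2 * ((1 / s) * s) * X ^ 2 + s ^ 2 * X ^ 4 := by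
          ring
        rw [e, h2]; ring
      have := sq_nonneg (1 / s - s * X ^ 2)
      have := sq_nonneg X
      linarith
    have hX := mul_le_mul_of_nonneg_right (young (freqX L k)) hI
    have hY := mul_le_mul_of_nonneg_right (young (freqY M k)) hI
    have r : 0 ≤ s ^ 2 * ((freqX L k ^ 4 + freqY M k ^ 4) *
        ∫ z in b..c, ‖coef L M k (fun P => (w P : ℂ)) z‖ ^ 2) := by positivity
    have e : 650 / s ^ 2 = 648 / s ^ 2 + 2 * (1 / s ^ 2) := by ring
    rw [e]
    linarith

/-- With `η = δ + √d` the sampling inequality gives an `L²` square `≤ A η²`, because `δ² + d ≤ η²`.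
Interpolation at `s² = c₀ η` then balances `A η² / s²` against `s² K`, both of order `η`. -/
theorem exists_h1NormSq_le {L M : ℝ} (hL : 0 < L) (hM : 0 < M) {ρ H κ δ₀ K : ℝ} (hρ : 0 < ρ)
    (hH : 0 < H) (hκ : 1 ≤ κ) (hδ₀ : 0 < δ₀) (hK : 0 ≤ K) :
    ∃ C, 0 ≤ C ∧ ∀ {b c : ℝ}, ρ ≤ c - b → c - b ≤ H →
      ∀ {p q v k₀ k₁ : ℕ} {x y z : ℕ → ℝ}, QuasiUniform κ p x → FillsPeriod L p x →
        QuasiUniform κ q y → FillsPeriod M q y → QuasiUniform κ v z → k₀ ≤ k₁ → k₁ ≤ v →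
        z k₀ = b → z k₁ = c → meshSize p q v x y z ≤ H →
      ∀ {δ : ℝ}, 0 < δ → δ ≤ δ₀ → ∀ {w : Pt → ℝ}, MemH2 L M b c w →
        secondNormSq L M b c w ≤ K →
        nodeAvg p q k₀ k₁ (fun i j k => w (x i, y j, z k) ^ 2) ≤ K * δ ^ 2 →
        h1NormSq L M b c w ≤ C * (δ + Real.sqrt (meshSize p q v x y z)) := by
  obtain ⟨C, hC, hl2⟩ := exists_l2NormSq_le_nodeAvg hL hM hρ hH hκ
  set η₀ := δ₀ + Real.sqrt H with hη₀
  have hη₀0 : 0 < η₀ := by positivity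
  -- Chosen so that `c₀ η ≤ ρ²` whenever `η ≤ η₀`: the interpolation length then fits into the slab.
  set c₀ := ρ ^ 2 / η₀ with hc₀
  have hc₀0 : 0 < c₀ := by positivity
  set A := C * (K + K * δ₀ ^ 2) with hA
  refine ⟨A * η₀ + 650 * A / c₀ + 2 * c₀ * K, by positivity, ?_⟩
  intro b c hbc hcH p q v k₀ k₁ x y z qx fx qy fy qz hk hkv hzb hzc hdH δ hδ hδδ w hw hS hE
  have hl := hl2 hbc hcH qx fx qy fy qz hk hkv hzb hzc hdH hw
  have hd0 : 0 < meshSize p q v x y z := (qx.maxStep_pos (fx.pos hL)).trans_le (le_max_left _ _)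
  set d := meshSize p q v x y z
  have hsd := Real.sqrt_pos.2 hd0
  set η := δ + Real.sqrt d with hη
  have hη0 : 0 < η := by positivity
  have hηη : η ≤ η₀ := add_le_add hδδ (Real.sqrt_le_sqrt hdH)
  have hl' : l2NormSq L M b c w ≤ A * η ^ 2 := by
    refine hl.trans ?_
    rw [hA, mul_assoc]
    refine mul_le_mul_of_nonneg_left ?_ hC
    have h1 : (secondNormSq L M b c w + nodeAvg p q k₀ k₁ (fun i j k => w (x i, y j, z k) ^ 2)) * d ≤
        (K + K * δ₀ ^ 2) * d := by
      have : K * δ ^ 2 ≤ K * δ₀ ^ 2 := by gcongr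
      gcongr
      exact hE.trans this
    have h2 : η ^ 2 = δ ^ 2 + d + 2 * δ * Real.sqrt d := by
      rw [hη, add_sq, Real.sq_sqrt hd0.le]; ring
    rw [h2]
    have h3 : 0 ≤ (K + K * δ₀ ^ 2) * (2 * δ * Real.sqrt d) := by positivity
    have h4 : 0 ≤ K * δ₀ ^ 2 * δ ^ 2 := by positivity
    linarith
  have hs2 : Real.sqrt (c₀ * η) ^ 2 = c₀ * η := Real.sq_sqrt (by positivity)
  have hsρ : Real.sqrt (c₀ * η) ≤ ρ := by
    rw [Real.sqrt_le_left hρ.le, hc₀, div_mul_eq_mul_div, div_le_iff₀ hη₀0]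
    gcongr
  have h1 := h1NormSq_le hL hM hw (Real.sqrt_pos.2 (by positivity : 0 < c₀ * η)) (hsρ.trans hbc)
  rw [hs2] at h1
  refine h1.trans ?_
  calc (1 + 650 / (c₀ * η)) * l2NormSq L M b c w + 2 * (c₀ * η) * secondNormSq L M b c w
      ≤ (1 + 650 / (c₀ * η)) * (A * η ^ 2) + 2 * (c₀ * η) * K := by gcongr
    _ = (A * η + 650 * A / c₀ + 2 * c₀ * K) * η := by field_simp
    _ ≤ (A * η₀ + 650 * A / c₀ + 2 * c₀ * K) * η := by gcongr

/-- Comparison of a Tikhonov minimizer with the exact function. -/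
theorem NoisySmoothing.IsTikhonovMin.sub_bounds {L M b c δ : ℝ} {p q k₀ k₁ : ℕ} {x y z : ℕ → ℝ}
    {data : ℕ → ℕ → ℕ → ℝ} {u w : Pt → ℝ} (hk : k₀ ≤ k₁) (hδ : 0 < δ)
    (hmin : IsTikhonovMin L M b c p q k₀ k₁ x y z data (δ ^ 2) w) (hu : MemH2 L M b c u)
    (hdata : ∀ i j k, i ≤ p → j ≤ q → k₀ ≤ k → k ≤ k₁ →
      |u (x i, y j, z k) - data i j k| ≤ δ) :
    secondNormSq L M b c (fun P => w P - u P) ≤ 4 + 4 * secondNormSq L M b c u ∧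
    nodeAvg p q k₀ k₁ (fun i j k => (w (x i, y j, z k) - u (x i, y j, z k)) ^ 2) ≤
      (4 + 4 * secondNormSq L M b c u) * δ ^ 2 := by
  -- Since `ε = δ²`, misfit and penalty of the exact function are both of order `δ²`. Dividing the
  -- penalty by `δ²` bounds the second derivatives of the minimizer independently of the noise.
  have hJ : nodeAvg p q k₀ k₁ (fun i j k => (w (x i, y j, z k) - data i j k) ^ 2) +
      δ ^ 2 * secondNormSq L M b c w ≤
      nodeAvg p q k₀ k₁ (fun i j k => (u (x i, y j, z k) - data i j k) ^ 2) +
      δ ^ 2 * secondNormSq L M b c u := hmin.2 u hu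
  have hu2 : nodeAvg p q k₀ k₁ (fun i j k => (u (x i, y j, z k) - data i j k) ^ 2) ≤ δ ^ 2 := by
    rw [← nodeAvg_const (p := p) (q := q) hk (δ ^ 2)]
    refine nodeAvg_mono hk fun i j k hi hj hk0 hk1 => ?_
    rw [← sq_abs]
    exact pow_le_pow_left₀ (abs_nonneg _) (hdata i j k hi hj hk0 hk1) 2
  have hw0 : 0 ≤ nodeAvg p q k₀ k₁ (fun i j k => (w (x i, y j, z k) - data i j k) ^ 2) :=
    nodeAvg_nonneg hk fun _ _ _ => sq_nonneg _
  have hSw := secondNormSq_nonneg L M b c w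
  have hSu := secondNormSq_nonneg L M b c u
  have hδ2 : 0 < δ ^ 2 := by positivity
  have hSwu : secondNormSq L M b c w ≤ 1 + secondNormSq L M b c u := by
    refine le_of_mul_le_mul_left ?_ hδ2
    linarith
  constructor
  · have := hmin.1.secondNormSq_sub_le hu
    linarith
  · have h1 : nodeAvg p q k₀ k₁ (fun i j k => (w (x i, y j, z k) - u (x i, y j, z k)) ^ 2) ≤
        2 * nodeAvg p q k₀ k₁ (fun i j k => (w (x i, y j, z k) - data i j k) ^ 2) +
        2 * nodeAvg p q k₀ k₁ (fun i j k => (u (x i, y j, z k) - data i j k) ^ 2) := by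
      rw [← nodeAvg_const_mul, ← nodeAvg_const_mul, ← nodeAvg_add]
      refine nodeAvg_mono hk fun i j k _ _ _ _ => ?_
      linarith [sq_nonneg ((w (x i, y j, z k) - data i j k) + (u (x i, y j, z k) - data i j k))]
    have h2 : 0 ≤ δ ^ 2 * secondNormSq L M b c w := by positivity
    have h3 : 0 ≤ δ ^ 2 * secondNormSq L M b c u := by positivity
    linarith

theorem NoisySmoothing.IsGrid.meshSize_le {L M a κ : ℝ} {p q v : ℕ} {x y z : ℕ → ℝ} (hL : 0 < L)
    (hM : 0 < M) (ha : 0 < a) (h : IsGrid L M a κ p q v x y z) :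
    meshSize p q v x y z ≤ max (max L M) (2 * a) := by
  have hv : 0 < v := by
    rcases Nat.eq_zero_or_pos v with rfl | hv
    · have h1 := h.z_first
      have h2 := h.z_last
      linarith
    · exact hv
  have h1 := h.quasiUniform_x.maxStep_le_sub (h.fills_x.pos hL)
  have h2 := h.quasiUniform_y.maxStep_le_sub (h.fills_y.pos hM)
  have h3 := h.quasiUniform_z.maxStep_le_sub hv
  rw [h.z_first, h.z_last] at h3
  refine max_le ?_ (max_le ?_ ?_)
  · exact le_max_of_le_left (le_max_of_le_left (by linarith [h.fills_x.1]))
  · exact le_max_of_le_left (le_max_of_le_right (by linarith [h.fills_y.1]))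
  · exact le_max_of_le_right (by linarith)

theorem sqrt_add_sqrt_le {d δ : ℝ} (hd : 0 ≤ d) (hδ : 0 ≤ δ) :
    Real.sqrt (δ + Real.sqrt d) ≤ d ^ (1 / 4 : ℝ) + Real.sqrt δ := by
  have e : (d ^ (1 / 4 : ℝ)) ^ 2 = Real.sqrt d := by
    rw [← Real.rpow_natCast, ← Real.rpow_mul hd, Real.sqrt_eq_rpow]
    norm_num
  have h0 : 0 ≤ d ^ (1 / 4 : ℝ) := Real.rpow_nonneg hd _
  rw [Real.sqrt_le_left (by positivity), add_sq, e, Real.sq_sqrt hδ]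
  have : 0 ≤ 2 * d ^ (1 / 4 : ℝ) * Real.sqrt δ := by positivity
  linarith

end

/-- The error estimate at a fixed time, with a constant depending on `laplacianNorm` of the exact
function. -/
theorem exists_error_bound (L M a : ℝ) (hL : 0 < L) (hM : 0 < M) (ha : 0 < a)
    (uBot uTop : ℝ × ℝ → ℝ) (hBot : ContDiff ℝ 2 uBot) (hTop : ContDiff ℝ 2 uTop)
    (hBotPer : ∀ x y, uBot (x + L, y) = uBot (x, y) ∧ uBot (x, y + M) = uBot (x, y))
    (hTopPer : ∀ x y, uTop (x + L, y) = uTop (x, y) ∧ uTop (x, y + M) = uTop (x, y))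
    (κ ρ δ₀ : ℝ) (hρ : 0 < ρ) (R : ℝ) :
    ∃ C : ℝ, ∀ u : Pt → ℝ, MemH2 L M (-a) a u →
      (∀ x y, u (x, y, -a) = uBot (x, y) ∧ u (x, y, a) = uTop (x, y)) →
      laplacianNorm L M (-a) a u = R →
      ∀ (p q v : ℕ) (x y z : ℕ → ℝ), IsGrid L M a κ p q v x y z →
      ∀ vl vr : ℕ, vl < vr → vr ≤ v → -a + ρ ≤ z vl → z vr ≤ a - ρ →
      ∀ δ : ℝ, 0 < δ → δ ≤ δ₀ → ∀ data : ℕ → ℕ → ℕ → ℝ,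
        (∀ i j k, i ≤ p → j ≤ q → k ≤ v → (k ≤ vl ∨ vr ≤ k) →
          |u (x i, y j, z k) - data i j k| ≤ δ) →
      ∀ w : Pt → ℝ,
        IsTikhonovMin L M (-a) (z vl) p q 0 vl x y z data (δ ^ 2) w →
        IsTikhonovMin L M (z vr) a p q vr v x y z data (δ ^ 2) w →
        Real.sqrt (h1NormSq L M (-a) (z vl) (fun P => w P - u P) +
            h1NormSq L M (z vr) a (fun P => w P - u P)) ≤
          C * meshSize p q v x y z ^ (1 / 4 : ℝ) + C * Real.sqrt δ := by
  -- For `κ < 1` there is no grid, as the largest step is at least the smallest one.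
  rcases lt_or_ge κ 1 with hκ | hκ
  · exact ⟨0, fun u _ _ _ p q v x y z hg => absurd (hg.quasiUniform_x.one_le (hg.fills_x.pos hL))
      (not_le.2 hκ)⟩
  obtain ⟨B, hB⟩ := exists_secondNormSq_le hL hM (by linarith : -a < a) hBot hTop hBotPer hTopPer
  -- The maxima with `1` and `0` secure the positivity that is not assumed of `δ₀` and not known of
  -- `B`. The height bound also bounds the mesh size.
  obtain ⟨C, hC, hmain⟩ := exists_h1NormSq_le (H := max (max L M) (2 * a)) (δ₀ := max δ₀ 1)
    (K := 4 + 4 * max 0 (4 * R ^ 2 + B)) hL hM hρ (lt_max_of_lt_right (by linarith)) hκ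
    (lt_max_of_lt_right one_pos) (by positivity)
  refine ⟨Real.sqrt (2 * C), fun u hu hbd hR p q v x y z hg vl vr hlr hrv hl hr δ hδ hδδ data hdata
    w hwl hwr => ?_⟩
  have hd := hg.meshSize_le hL hM ha
  have hd0 : 0 ≤ meshSize p q v x y z :=
    (hg.quasiUniform_x.maxStep_pos (hg.fills_x.pos hL)).le.trans (le_max_left _ _)
  have hS : secondNormSq L M (-a) a u ≤ max 0 (4 * R ^ 2 + B) :=
    le_max_of_le_right (hR ▸ hB u hu hbd)
  have h0l : z 0 ≤ z vl := hg.quasiUniform_z.monotone (Nat.zero_le _) (by omega)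
  have hlr' : z vl ≤ z vr := hg.quasiUniform_z.monotone hlr.le hrv
  have hrv' : z vr ≤ z v := hg.quasiUniform_z.monotone hrv le_rfl
  have hz0 := hg.z_first
  have hzv := hg.z_last
  have side : ∀ {b c : ℝ} {k₀ k₁ : ℕ}, -a ≤ b → c ≤ a → ρ ≤ c - b → k₀ ≤ k₁ → k₁ ≤ v →
      z k₀ = b → z k₁ = c → (∀ k, k₀ ≤ k → k ≤ k₁ → k ≤ vl ∨ vr ≤ k) →
      IsTikhonovMin L M b c p q k₀ k₁ x y z data (δ ^ 2) w →
      h1NormSq L M b c (fun P => w P - u P) ≤ C * (δ + Real.sqrt (meshSize p q v x y z)) := by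
    intro b c k₀ k₁ hb hc hbc hk hkv hzb hzc hout hmin
    have hu' := hu.restrict hb hc
    have hSu := (hu.secondNormSq_restrict_le hb hc).trans hS
    obtain ⟨h1, h2⟩ := hmin.sub_bounds hk hδ hu' fun i j k hi hj hk0 hk1 =>
      hdata i j k hi hj (hk1.trans hkv) (hout k hk0 hk1)
    refine hmain hbc (le_max_of_le_right (by linarith)) hg.quasiUniform_x hg.fills_x
      hg.quasiUniform_y hg.fills_y hg.quasiUniform_z hk hkv hzb hzc hd hδ (le_max_of_le_left hδδ)
      (hmin.1.sub hu') (h1.trans (by linarith)) (h2.trans ?_)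
    gcongr
  have hleft := side le_rfl (by linarith) (by linarith) (Nat.zero_le vl) (by omega) hz0 rfl
    (fun k _ hk => Or.inl hk) hwl
  have hright := side (by linarith) le_rfl (by linarith) hrv le_rfl rfl hzv
    (fun k hk _ => Or.inr hk) hwr
  calc _ ≤ Real.sqrt (2 * C * (δ + Real.sqrt (meshSize p q v x y z))) :=
        Real.sqrt_le_sqrt (by linarith)
    _ = Real.sqrt (2 * C) * Real.sqrt (δ + Real.sqrt (meshSize p q v x y z)) :=
        Real.sqrt_mul (by positivity) _
    _ ≤ Real.sqrt (2 * C) * (meshSize p q v x y z ^ (1 / 4 : ℝ) + Real.sqrt δ) := by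
        gcongr
        exact sqrt_add_sqrt_le hd0 hδ.le
    _ = _ := mul_add _ _ _

theorem proposition2
    -- the geometry: periods `L`, `M` and the half-height `a` of `ℝ² × (-a, a)`
    (L M a : ℝ) (hL : 0 < L) (hM : 0 < M) (ha : 0 < a)
    -- the boundary data at `z = -a` and `z = a`
    (uBot uTop : ℝ × ℝ → ℝ) (hBot : ContDiff ℝ 2 uBot) (hTop : ContDiff ℝ 2 uTop)
    (hBotPer : ∀ x y, uBot (x + L, y) = uBot (x, y) ∧ uBot (x, y + M) = uBot (x, y))
    (hTopPer : ∀ x y, uTop (x + L, y) = uTop (x, y) ∧ uTop (x, y + M) = uTop (x, y))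
    -- a bound for the mesh ratios, a lower bound for the thickness of the two outer regions,
    -- and an upper bound for the noise level
    (κ ρ δ₀ : ℝ) (hρ : 0 < ρ) :
    ∃ C₂ C₃ : ℝ → ℝ,
      ∀ (T : ℝ) (u : ℝ → Pt → ℝ),
        (∀ᵐ t ∂(volume.restrict (Icc 0 T)), MemH2 L M (-a) a (u t) ∧
          ∀ x y, u t (x, y, -a) = uBot (x, y) ∧ u t (x, y, a) = uTop (x, y)) →
      ∀ (p q v : ℕ) (x y z : ℕ → ℝ), IsGrid L M a κ p q v x y z →
      -- the outer regions `ℝ² × [-a, z (vl t)]` and `ℝ² × [z (vr t), a]`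
      ∀ vl vr : ℝ → ℕ,
        (∀ t ∈ Icc 0 T, vl t < vr t ∧ vr t ≤ v ∧ -a + ρ ≤ z (vl t) ∧ z (vr t) ≤ a - ρ) →
      ∀ δ : ℝ, 0 < δ → δ ≤ δ₀ →
      -- the noisy data at the nodes of the outer regions
      ∀ uδ : ℝ → ℕ → ℕ → ℕ → ℝ,
        (∀ᵐ t ∂(volume.restrict (Icc 0 T)), ∀ i j k, i ≤ p → j ≤ q → k ≤ v →
          (k ≤ vl t ∨ vr t ≤ k) → |u t (x i, y j, z k) - uδ t i j k| ≤ δ) →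
      -- the smoothed data, for the regularization parameter `ε = δ ^ 2`
      ∀ uε : ℝ → Pt → ℝ,
        (∀ᵐ t ∂(volume.restrict (Icc 0 T)),
          IsTikhonovMin L M (-a) (z (vl t)) p q 0 (vl t) x y z (uδ t) (δ ^ 2) (uε t) ∧
          IsTikhonovMin L M (z (vr t)) a p q (vr t) v x y z (uδ t) (δ ^ 2) (uε t)) →
      ∀ᵐ t ∂(volume.restrict (Icc 0 T)),
        Real.sqrt
            (h1NormSq L M (-a) (z (vl t)) (fun P => uε t P - u t P) +
              h1NormSq L M (z (vr t)) a (fun P => uε t P - u t P)) ≤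
          C₂ (laplacianNorm L M (-a) a (u t)) * meshSize p q v x y z ^ (1 / 4 : ℝ) +
            C₃ (laplacianNorm L M (-a) a (u t)) * Real.sqrt δ := by
  -- The fixed-time constant is chosen as a function of the Laplacian norm before `u`, the grid and
  -- the data are introduced, and it serves as both `C₂` and `C₃`.
  choose C hC using exists_error_bound L M a hL hM ha uBot uTop hBot hTop hBotPer hTopPer κ ρ δ₀ hρ
  refine ⟨C, C, fun T u hu p q v x y z hg vl vr hv δ hδ hδδ uδ hdata uε hmin => ?_⟩
  filter_upwards [hu, hdata, hmin, ae_restrict_mem measurableSet_Icc] with t hut hdt hmt ht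
  obtain ⟨h1, h2, h3, h4⟩ := hv t ht
  exact hC _ (u t) hut.1 hut.2 rfl p q v x y z hg (vl t) (vr t) h1 h2 h3 h4 δ hδ hδδ (uδ t) hdt
    (uε t) hmt.1 hmt.2
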